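/- **Theorem (Hodge decomposition over $GL_q(N)$).** Let $N\ge 0$ be an integer and let $q\in\mathbb C$ be nonzero and not a root of unity; put $\lambda=q-q^{-1}$. Let $R_{12}$ be the standard Drinfeld–Jimbo matrix $$R^{i_1i_2}_{j_1j_2}=\delta^{i_1}_{j_1}\delta^{i_2}_{j_2}\bigl(1+(q-1)\delta^{i_1i_2}\bigr)+\lambda\,\delta^{i_1}_{j_2}\delta^{i_2}_{j_1}\Theta_{i_1i_2},\qquad \Theta_{ij}=1\text{ if }i>j,\ \Theta_{ij}=0\text{ otherwise},$$ let $P_{12}$ be the permutation matrix and $\hat R=P_{12}R_{12}$. Let $\mathcal D$ be the unital associative $\mathbb C$-algebra generated by the entries of the $N\times N$ matrices $T,\omega,L,L^{-1},J$ with the relations $LL^{-1}=L^{-1}L=1$ and, writing $X_1=X\otimes 1$, $X_2=1\otimes X$, $$\omega_2\hat R^{-1}\omega_2\hat R=-\hat R^{-1}\omega_2\hat R^{-1}\omega_2,\quad \omega_2\hat RL_2\hat R=\hat RL_2\hat R\omega_2,\quad \omega_2\hat RJ_2\hat R+\hat RJ_2\hat R\omega_2=-\hat R,$$ $$L_2\hat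 RL_2\hat R=\hat RL_2\hat RL_2,\quad J_2\hat RL_2\hat R=\hat RL_2\hat RJ_2,\quad J_2\hat RJ_2\hat R=-\hat R^{-1}J_2\hat RJ_2,$$ $$\hat RT_1T_2=T_1T_2\hat R,\quad \omega_1T_2=T_2\hat R^{-1}\omega_2\hat R^{-1},\quad J_1T_2=T_2\hat RJ_2\hat R,\quad L_1T_2=T_2\hat RL_2\hat R.$$ Let $\mathcal F$ be the left $\mathcal D$-module generated by a vector $|0\rangle$ with the defining relations $(L^i_j-\delta^i_j)|0\rangle=0$ and $J^i_j|0\rangle=0$, that is, $\mathcal F=\mathcal D/I$ with $I$ the left ideal generated by all $L^i_j-\delta^i_j$ and $J^i_j$. A polynomial $|\Psi\rangle=\Psi[T,\omega]$ is a vector $p\,|0\rangle\in\mathcal F$ with $p$ in the subalgebra of $\mathcal D$ generated by the entries of $T$ and $\omega$. For a matrix $Y$ of operators on $\mathcal F$ let $\mathrm{Tr}_q(Y)=\mathrm{Tr}(D^{-1}Y)=\sum_{i=1}^N q^{2(N-i)+1}\,Y^i_i$. Then the matrix $1+\lambda\,\omega J$ of operators on $\mathcal F$ is invertible, so that the BRST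 operator, the anti-BRST operator and the quantum Laplace operator $$Q=\tfrac1\lambda\bigl(\mathrm{Tr}_q(\omega L(1+\lambda\omega J)^{-1})-\mathrm{Tr}_q(\omega)\bigr),\quad Q^*=\tfrac1\lambda\bigl(\mathrm{Tr}_q(JL^{-1}(1+\lambda J\omega))-\mathrm{Tr}_q(J)\bigr),\quad \Delta=QQ^*+Q^*Q$$ are defined on $\mathcal F$; and for every polynomial $|\Psi\rangle$ there are polynomials $|\Omega\rangle,|\chi\rangle,|\Phi\rangle$ with $$|\Psi\rangle=|\Omega\rangle+Q|\chi\rangle+Q^*|\Phi\rangle,\qquad \Delta|\Omega\rangle=0 .$$ -/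

import Mathlib

noncomputable section

namespace QuantumGL

open scoped Kronecker

/-- `λ = q - q⁻¹`. -/
def lam (q : ℂ) : ℂ := q - q⁻¹

/-- The standard Drinfeld-Jimbo `R`-matrix of `GL_q(N)`; the row index is `(i₁, i₂)`, the column
index is `(j₁, j₂)`. -/
def R (N : ℕ) (q : ℂ) : Matrix (Fin N × Fin N) (Fin N × Fin N) ℂ :=
  Matrix.of fun i j =>
    (if i.1 = j.1 then 1 else 0) * (if i.2 = j.2 then 1 else 0) *
        (1 + (q - 1) * (if i.1 = i.2 then 1 else 0)) +
      (q - q⁻¹) * (if i.1 = j.2 then 1 else 0) * (if i.2 = j.1 then 1 else 0) *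
        (if i.2 < i.1 then 1 else 0)

/-- The permutation matrix `P₁₂`. -/
def permMatrix (N : ℕ) : Matrix (Fin N × Fin N) (Fin N × Fin N) ℂ :=
  Matrix.of fun i j => if i.1 = j.2 ∧ i.2 = j.1 then 1 else 0

/-- The braid form `R̂ = P₁₂ R₁₂` of the `R`-matrix. -/
def Rhat (N : ℕ) (q : ℂ) : Matrix (Fin N × Fin N) (Fin N × Fin N) ℂ :=
  permMatrix N * R N q

/-- The generators of the differential algebra: the coordinates `T` of the quantum group, the
differential forms `ω`, the vector fields `L`, the entries of the inverse matrix `L⁻¹`, and the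
inner derivations `J`. -/
inductive Gen (N : ℕ) : Type
  | T (i j : Fin N)
  | ω (i j : Fin N)
  | L (i j : Fin N)
  | Linv (i j : Fin N)
  | J (i j : Fin N)

/-- The free algebra on the generators. -/
abbrev Free (N : ℕ) : Type := FreeAlgebra ℂ (Gen N)

/-- Matrices on the tensor product of two copies of the `N`-dimensional space, with entries in the
free algebra. -/
abbrev Mat2 (N : ℕ) : Type := Matrix (Fin N × Fin N) (Fin N × Fin N) (Free N)

/-- `X₁ = X ⊗ 1` for the matrix `X` of the generators of one kind. -/
def in1 {N : ℕ} (g : Fin N → Fin N → Gen N) : Mat2 N :=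
  (Matrix.of fun i j => FreeAlgebra.ι ℂ (g i j)) ⊗ₖ (1 : Matrix (Fin N) (Fin N) (Free N))

/-- `X₂ = 1 ⊗ X` for the matrix `X` of the generators of one kind. -/
def in2 {N : ℕ} (g : Fin N → Fin N → Gen N) : Mat2 N :=
  (1 : Matrix (Fin N) (Fin N) (Free N)) ⊗ₖ (Matrix.of fun i j => FreeAlgebra.ι ℂ (g i j))

/-- The numerical matrix `R̂`, with entries regarded as scalars of the free algebra. -/
def RM (N : ℕ) (q : ℂ) : Mat2 N := (Rhat N q).map (algebraMap ℂ (Free N))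

/-- The numerical matrix `R̂⁻¹`, with entries regarded as scalars of the free algebra. -/
def RMinv (N : ℕ) (q : ℂ) : Mat2 N := (Rhat N q)⁻¹.map (algebraMap ℂ (Free N))

open Gen in
/-- The relations of the differential algebra over `GL_q(N)` in matrix form: `MatRel N q X Y`
stands for the relation `X = Y`. -/
inductive MatRel (N : ℕ) (q : ℂ) : Mat2 N → Mat2 N → Prop
  | ωω : MatRel N q (in2 ω * RMinv N q * in2 ω * RM N q)
      (-(RMinv N q * in2 ω * RMinv N q * in2 ω))
  | ωL : MatRel N q (in2 ω * RM N q * in2 L * RM N q) (RM N q * in2 L * RM N q * in2 ω)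
  | ωJ : MatRel N q (in2 ω * RM N q * in2 J * RM N q + RM N q * in2 J * RM N q * in2 ω) (-RM N q)
  | LL : MatRel N q (in2 L * RM N q * in2 L * RM N q) (RM N q * in2 L * RM N q * in2 L)
  | JL : MatRel N q (in2 J * RM N q * in2 L * RM N q) (RM N q * in2 L * RM N q * in2 J)
  | JJ : MatRel N q (in2 J * RM N q * in2 J * RM N q) (-(RMinv N q * in2 J * RM N q * in2 J))
  | TT : MatRel N q (RM N q * in1 T * in2 T) (in1 T * in2 T * RM N q)
  | ωT : MatRel N q (in1 ω * in2 T) (in2 T * RMinv N q * in2 ω * RMinv N q)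
  | JT : MatRel N q (in1 J * in2 T) (in2 T * RM N q * in2 J * RM N q)
  | LT : MatRel N q (in1 L * in2 T) (in2 T * RM N q * in2 L * RM N q)
  | LLinv : MatRel N q (in2 L * in2 Linv) 1
  | LinvL : MatRel N q (in2 Linv * in2 L) 1

/-- The defining relations of the differential algebra over `GL_q(N)`, entry by entry. -/
def Rel (N : ℕ) (q : ℂ) (x y : Free N) : Prop :=
  ∃ X Y : Mat2 N, MatRel N q X Y ∧ ∃ a b, x = X a b ∧ y = Y a b

/-- The differential algebra over `GL_q(N)`. -/
abbrev DiffAlg (N : ℕ) (q : ℂ) : Type := RingQuot (Rel N q)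

/-- The class of a generator in the differential algebra. -/
def gen (N : ℕ) (q : ℂ) (x : Gen N) : DiffAlg N q :=
  RingQuot.mkAlgHom ℂ (Rel N q) (FreeAlgebra.ι ℂ x)

/-- The left ideal generated by the annihilation operators `L^i_j - δ^i_j` and `J^i_j`. -/
def annihilators (N : ℕ) (q : ℂ) : Submodule (DiffAlg N q) (DiffAlg N q) :=
  Submodule.span (DiffAlg N q)
    ({x | ∃ i j : Fin N, x = gen N q (Gen.L i j) - (if i = j then 1 else 0)} ∪
      {x | ∃ i j : Fin N, x = gen N q (Gen.J i j)})

/-- The left module over the differential algebra generated by one vector `|0⟩` subject to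
`(L^i_j - δ^i_j)|0⟩ = 0` and `J^i_j|0⟩ = 0`. -/
abbrev Fock (N : ℕ) (q : ℂ) : Type := DiffAlg N q ⧸ annihilators N q

/-- The vector `|0⟩`. -/
def vac (N : ℕ) (q : ℂ) : Fock N q := (annihilators N q).mkQ 1

/-- The space of polynomials `Ψ[T, ω]`: the vectors `p|0⟩` for `p` in the subalgebra generated by
the `T^i_j` and `ω^i_j`. -/
def polynomials (N : ℕ) (q : ℂ) : Set (Fock N q) :=
  {v | ∃ p ∈ Algebra.adjoin ℂ
      ({x | ∃ i j : Fin N, x = gen N q (Gen.T i j)} ∪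
        {x | ∃ i j : Fin N, x = gen N q (Gen.ω i j)}), v = p • vac N q}

/-- The matrix of operators on `Fock N q` given by the action of the generators of one kind. -/
def opMatrix (N : ℕ) (q : ℂ) (g : Fin N → Fin N → Gen N) :
    Matrix (Fin N) (Fin N) (Module.End ℂ (Fock N q)) :=
  Matrix.of fun i j => Algebra.lsmul ℂ ℂ (Fock N q) (gen N q (g i j))

/-- The quantum trace `Tr_q Y = Tr (D⁻¹ Y)`, where `D⁻¹` is diagonal with the `i`-th entry
`q ^ (2 * (N - i) + 1)` for `i = 1, …, N` (the indices of `Fin N` start at `0`). -/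
def qTrace (N : ℕ) (q : ℂ) (Y : Matrix (Fin N) (Fin N) (Module.End ℂ (Fock N q))) :
    Module.End ℂ (Fock N q) :=
  ∑ i : Fin N, q ^ (2 * ((N : ℤ) - ((i : ℕ) + 1)) + 1) • Y i i

/-- `W = 1 + λ ω J`. -/
def W (N : ℕ) (q : ℂ) : Matrix (Fin N) (Fin N) (Module.End ℂ (Fock N q)) :=
  1 + lam q • (opMatrix N q Gen.ω * opMatrix N q Gen.J)

/-- The BRST operator
`Q = λ⁻¹ (Tr_q (ω L (1 + λ ω J)⁻¹) - Tr_q ω)`; the inverse is that of the ring of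
matrices of operators. -/
def Q (N : ℕ) (q : ℂ) : Module.End ℂ (Fock N q) :=
  (lam q)⁻¹ • (qTrace N q (opMatrix N q Gen.ω * opMatrix N q Gen.L * Ring.inverse (W N q)) -
    qTrace N q (opMatrix N q Gen.ω))

/-- The anti-BRST operator `Q* = λ⁻¹ (Tr_q (J L⁻¹ (1 + λ J ω)) - Tr_q J)`. -/
def Qstar (N : ℕ) (q : ℂ) : Module.End ℂ (Fock N q) :=
  (lam q)⁻¹ • (qTrace N q (opMatrix N q Gen.J * opMatrix N q Gen.Linv *
      (1 + lam q • (opMatrix N q Gen.J * opMatrix N q Gen.ω))) -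
    qTrace N q (opMatrix N q Gen.J))

/-- The quantum Laplace operator `Δ = Q Q* + Q* Q`. -/
def Laplacian (N : ℕ) (q : ℂ) : Module.End ℂ (Fock N q) :=
  Q N q * Qstar N q + Qstar N q * Q N q

end QuantumGL

end

/-! Normal ordering shows that every vector of the Fock space is a polynomial in `T` and `ω` applied
to the vacuum, so membership in `polynomials` is automatic (`mem_polynomials`). The decomposition
then follows from `ker Δ + range Δ = ⊤`, because `Δ y = Q (Q* y) + Q* (Q y)`. This sum is everything
as soon as `Δ` is diagonalizable, and that is the heart of the matter.

Put `U = 1 + λ ω J` and `Y = U L⁻¹ (1 + λ J ω)`. The quantum trace over the first space is invariant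
under conjugation by `R̂`; applied to the exchange relations it yields the anticommutators of the
traces that make up `Q` and `Q*`. They combine to `λ² Δ = Tr_q L + q^(2N) Tr_q Y - 2 Tr_q 1`
(`DiffOps.laplacian`). The two traces commute, so each can be diagonalized separately.

On words in `T` the matrix `L` acts through Jucys-Murphy elements of the Hecke algebra, built from
`1` by `A ↦ R̂ A₂ R̂`, and `Tr_q L` acts through an affine function of their sum. An entry of `ω`
has one index of the dual type; the `q`-antisymmetric tensor trades it for `N - 1` ordinary indices
(`isCovariant_eps`), and the same description then reaches the whole Fock space. For `Y` the
situation is simpler: it is scalar on `ω ⋯ ω |0⟩`, and words in `T` again produce Jucys-Murphy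
elements, now for `q⁻¹`.

Jucys-Murphy elements have eigenvalues `q ^ (2c)` with bounded integers `c`. For real `q > 0` they
are real symmetric, so a rank-two computation with joint eigenvectors (`eigenvalue_of_hecke`) gives
an explicit annihilating polynomial. Its value is holomorphic in `q`, hence zero for all `q ≠ 0`.
When `q` is not a root of unity the roots are distinct and semisimplicity follows.

Finally, `U` preserves a filtration by finite-dimensional spaces. The exchange relations make it
surjective on each of them, hence bijective (`FockRep.isUnit_u`). -/

noncomputable section

set_option linter.unusedSectionVars false

namespace QuantumGL

open Module Polynomial

/-! ### Operators on the right-hand tensor factors -/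

section Amplification

variable {ι τ A : Type*} [Fintype ι] [DecidableEq ι] [Fintype τ] [DecidableEq τ]
  [Ring A] [Algebra ℂ A]

/-- `1 ⊗ X`. -/
def amp (ι : Type*) [Fintype ι] [DecidableEq ι] :
    Matrix τ τ A →ₐ[ℂ] Matrix (ι × τ) (ι × τ) A where
  toFun X := Matrix.of fun i j => if i.1 = j.1 then X i.2 j.2 else 0
  map_one' := by
    ext i j
    simp only [Matrix.of_apply, Matrix.one_apply, Prod.ext_iff, ite_and]
  map_zero' := by ext i j; simp
  map_add' X Y := by
    ext i j
    simp only [Matrix.of_apply, Matrix.add_apply]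
    split_ifs <;> simp
  map_mul' X Y := by
    ext i j
    simp only [Matrix.of_apply, Matrix.mul_apply, Fintype.sum_prod_type]
    by_cases h : i.1 = j.1
    · simp [h, Finset.sum_ite_irrel]
    · rw [if_neg h, Finset.sum_eq_zero]
      intro a _
      apply Finset.sum_eq_zero
      intro b _
      by_cases h1 : i.1 = a
      · rw [if_neg (fun h2 => h (h1.trans h2)), mul_zero]
      · rw [if_neg h1, zero_mul]
  commutes' c := by
    ext i j
    simp only [Matrix.of_apply, Matrix.algebraMap_matrix_apply, Prod.ext_iff, ite_and]


@[simp] lemma amp_apply (X : Matrix τ τ A) (i j : ι × τ) :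
    amp ι X i j = if i.1 = j.1 then X i.2 j.2 else 0 := rfl

lemma amp_mulVec (X : Matrix τ τ ℂ) (φ : ι × τ → ℂ) (a : ι) (t : τ) :
    (amp ι X).mulVec φ (a, t) = X.mulVec (fun s => φ (a, s)) t := by
  simp [Matrix.mulVec, dotProduct, Fintype.sum_prod_type, Finset.sum_ite_irrel]

end Amplification

/-! ### The Hecke and braid relations for `R̂` -/

section Braid

variable {ι τ : Type*} [Fintype ι] [LinearOrder ι] [Fintype τ] [DecidableEq τ]

/-- The coefficient of the permuted word in the action of `R̂`. -/
def swapCoeff (q : ℂ) (a b : ι) : ℂ := if a = b then q else 1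

/-- The coefficient of the word itself in the action of `R̂`. -/
def stayCoeff (q : ℂ) (a b : ι) : ℂ := if a < b then lam q else 0

/-- The braid matrix `R̂` on the first two factors of `V ⊗ V ⊗ E`. -/
def braid (q : ℂ) : Matrix (ι × ι × τ) (ι × ι × τ) ℂ :=
  Matrix.of fun i j => (if i = (j.2.1, j.1, j.2.2) then swapCoeff q j.1 j.2.1 else 0) +
    (if i = j then stayCoeff q j.1 j.2.1 else 0)

lemma swapCoeff_comm (q : ℂ) (a b : ι) : swapCoeff q a b = swapCoeff q b a := by
  simp only [swapCoeff, eq_comm]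

lemma braid_transpose (q : ℂ) : (braid q : Matrix (ι × ι × τ) (ι × ι × τ) ℂ).transpose = braid q := by
  ext ⟨a, b, s⟩ ⟨c, d, t⟩
  simp only [Matrix.transpose_apply, braid, Matrix.of_apply, Prod.mk.injEq]
  congr 1
  · by_cases h : c = b ∧ d = a ∧ t = s
    · obtain ⟨rfl, rfl, rfl⟩ := h
      simp [swapCoeff_comm]
    · rw [if_neg h, if_neg]
      rintro ⟨rfl, rfl, rfl⟩
      exact h ⟨rfl, rfl, rfl⟩
  · by_cases h : c = a ∧ d = b ∧ t = s
    · obtain ⟨rfl, rfl, rfl⟩ := h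
      simp
    · rw [if_neg h, if_neg]
      rintro ⟨rfl, rfl, rfl⟩
      exact h ⟨rfl, rfl, rfl⟩

lemma braid_mulVec (q : ℂ) (φ : ι × ι × τ → ℂ) (a b : ι) (t : τ) :
    (braid q).mulVec φ (a, b, t) =
      swapCoeff q a b * φ (b, a, t) + stayCoeff q a b * φ (a, b, t) := by
  rw [← braid_transpose, Matrix.mulVec_transpose]
  simp [Matrix.vecMul, dotProduct, braid, mul_add, Finset.sum_add_distrib, mul_comm]

lemma matrix_ext_mulVec {σ : Type*} [Fintype σ] [DecidableEq σ] {X Y : Matrix σ σ ℂ}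
    (h : ∀ φ s, X.mulVec φ s = Y.mulVec φ s) : X = Y :=
  Matrix.toLin'.injective (LinearMap.ext fun φ => funext fun s => h φ s)

lemma braid_mul_self {q : ℂ} (hq : q ≠ 0) :
    (braid q * braid q : Matrix (ι × ι × τ) (ι × ι × τ) ℂ) = 1 + lam q • braid q := by
  refine matrix_ext_mulVec ?_
  rintro φ ⟨a, b, t⟩
  rw [← Matrix.mulVec_mulVec, Matrix.add_mulVec, Matrix.smul_mulVec]
  simp only [braid_mulVec, Pi.add_apply, Pi.smul_apply, Matrix.one_mulVec, smul_eq_mul]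
  rcases lt_trichotomy a b with h | rfl | h
  · simp [swapCoeff, stayCoeff, h, h.ne, h.ne', h.not_gt]
  · simp [swapCoeff, stayCoeff, lam]; field_simp; ring
  · simp [swapCoeff, stayCoeff, h, h.ne, h.ne', h.not_gt]

/-- All coefficients depend only on the relative order of the first three letters, so comparing the
two sides is a finite check. The quadratic relation `hl` enters only when letters coincide. -/
lemma braid_braid {q : ℂ} (hq : q ≠ 0) :
    (braid q * amp ι (braid q) * braid q : Matrix (ι × ι × ι × τ) (ι × ι × ι × τ) ℂ) =
      amp ι (braid q) * braid q * amp ι (braid q) := by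
  refine matrix_ext_mulVec ?_
  rintro φ ⟨a, b, c, t⟩
  simp only [← Matrix.mulVec_mulVec, braid_mulVec, amp_mulVec]
  have key : ∀ x y : ι, (x < y → swapCoeff q x y = 1 ∧ swapCoeff q y x = 1 ∧
      stayCoeff q x y = lam q ∧ stayCoeff q y x = 0) := fun x y h => by
    simp [swapCoeff, stayCoeff, h, h.ne, h.ne', h.not_gt]
  have diag : ∀ x : ι, swapCoeff q x x = q ∧ stayCoeff q x x = 0 := fun x => by
    simp [swapCoeff, stayCoeff]
  have hl : q * q = 1 + lam q * q := by
    simp only [lam]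
    field_simp
    ring
  have three : ∀ x y : ι, x = y ∨ x < y ∨ y < x := fun x y => by
    rcases lt_trichotomy x y with h | h | h <;> simp [h]
  rcases three a b with rfl | h | h
  · rcases three a c with rfl | h' | h'
    · simp only [diag]
    · simp only [diag, key _ _ h']; linear_combination (lam q * φ (a, a, c, t)) * hl
    · simp only [diag, key _ _ h']; linear_combination (0 : ℂ) * hl
  · rcases three b c with rfl | h' | h'
    · simp only [diag, key _ _ h]; linear_combination (-lam q * φ (a, b, b, t)) * hl
    · simp only [key _ _ h, key _ _ h', key _ _ (h.trans h')]; ring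
    · rcases three a c with rfl | h'' | h''
      · simp only [diag, key _ _ h]; linear_combination (0 : ℂ) * hl
      · simp only [key _ _ h, key _ _ h', key _ _ h'']; ring
      · simp only [key _ _ h, key _ _ h', key _ _ h'']; ring
  · rcases three b c with rfl | h' | h'
    · simp only [diag, key _ _ h]; ring
    · rcases three a c with rfl | h'' | h''
      · simp only [diag, key _ _ h]; linear_combination (0 : ℂ) * hl
      · simp only [key _ _ h, key _ _ h', key _ _ h'']; ring
      · simp only [key _ _ h, key _ _ h', key _ _ h'']; ring
    · simp only [key _ _ h, key _ _ h', key _ _ (h'.trans h)]; ring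

lemma commute_braid_amp_amp (q : ℂ) (X : Matrix τ τ ℂ) :
    Commute (braid q : Matrix (ι × ι × τ) (ι × ι × τ) ℂ) (amp ι (amp ι X)) := by
  refine matrix_ext_mulVec ?_
  rintro φ ⟨a, b, t⟩
  simp only [← Matrix.mulVec_mulVec, braid_mulVec, amp_mulVec]
  simp only [Matrix.mulVec, dotProduct, mul_add, Finset.sum_add_distrib, Finset.mul_sum]
  congr 1 <;> exact Finset.sum_congr rfl fun _ _ => by ring

end Braid

end QuantumGL

/-! ### Eigenvalues of Jucys-Murphy elements -/

namespace QuantumGL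

open Module Polynomial

/-- The polynomial whose roots are the `q ^ (2 c)` with `|c| ≤ m`. -/
def contentPoly (m : ℕ) (q : ℂ) : ℂ[X] :=
  ∏ c ∈ Finset.Icc (-(m : ℤ)) m, (X - C (q ^ (2 * c)))

lemma contentPoly_eval_eq_zero {m : ℕ} {q b : ℂ} :
    (contentPoly m q).eval b = 0 ↔ ∃ c : ℤ, |c| ≤ m ∧ b = q ^ (2 * c) := by
  simp only [contentPoly, eval_prod, Finset.prod_eq_zero_iff, Finset.mem_Icc, eval_sub, eval_X,
    eval_C, sub_eq_zero, abs_le]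

section Rank2

variable {V : Type*} [AddCommGroup V] [Module ℂ V]

lemma aeval_apply_of_eigenvector {f : End ℂ V} {μ : ℂ} {v : V} (h : f v = μ • v) (p : ℂ[X]) :
    aeval f p v = p.eval μ • v := by
  rcases eq_or_ne v 0 with rfl | hv
  · simp
  · exact Module.End.aeval_apply_of_hasEigenvector ⟨Module.End.mem_eigenspace_iff.2 h, hv⟩

lemma exists_joint_eigenvector [FiniteDimensional ℂ V] {f g : End ℂ V} (h : Commute f g) {b : ℂ}
    (hb : g.HasEigenvalue b) : ∃ v ≠ 0, g v = b • v ∧ ∃ a : ℂ, f v = a • v := by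
  have hm : Set.MapsTo f (g.eigenspace b) (g.eigenspace b) :=
    Module.End.mapsTo_genEigenspace_of_comm h.symm b 1
  have : Nontrivial (g.eigenspace b) := (Submodule.nontrivial_iff_ne_bot).2 hb
  obtain ⟨a, ha⟩ := Module.End.exists_eigenvalue (f.restrict hm)
  obtain ⟨v, hv⟩ := ha.exists_hasEigenvector
  refine ⟨v, fun h0 => hv.2 (Subtype.ext h0), Module.End.mem_eigenspace_iff.1 v.2, a, ?_⟩
  exact congrArg Subtype.val (Module.End.mem_eigenspace_iff.1 hv.1)

/-- The eigenvalues of consecutive Jucys-Murphy elements. -/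
lemma eigenvalue_of_hecke [FiniteDimensional ℂ V] {q : ℂ} (hq : q ≠ 0) {m : ℕ} {g y : End ℂ V}
    (hg : g * g = 1 + lam q • g) (hy : aeval y (contentPoly m q) = 0)
    (hcomm : Commute y (g * y * g)) {b : ℂ} (hb : (g * y * g).HasEigenvalue b) :
    ∃ c : ℤ, |c| ≤ m + 1 ∧ b = q ^ (2 * c) := by
  obtain ⟨v, hv0, hv, a, ha⟩ := exists_joint_eigenvector hcomm hb
  have root : ∀ {x : ℂ} {w : V}, w ≠ 0 → y w = x • w → (contentPoly m q).eval x = 0 := by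
    intro x w hw h
    have := aeval_apply_of_eigenvector h (contentPoly m q)
    rw [hy, LinearMap.zero_apply] at this
    exact (smul_eq_zero.1 this.symm).resolve_right hw
  by_cases hbm : (contentPoly m q).eval b = 0
  · obtain ⟨c, hc, h⟩ := contentPoly_eval_eq_zero.1 hbm
    exact ⟨c, hc.trans (by simp), h⟩
  have hab : a - b ≠ 0 := by
    intro h
    rw [sub_eq_zero] at h
    exact hbm (h ▸ root hv0 ha)
  have hgg : ∀ w, g (g w) = w + lam q • g w := fun w => by
    have := congrArg (fun f : End ℂ V => f w) hg
    simpa using this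
  -- Apply `g` to `g y g v = b v` and use the Hecke relation: on the span of `v` and `g v` the
  -- operator `y` is triangular with diagonal entries `a` and `b`.
  have hygv : y (g v) = b • g v - (b * lam q) • v := by
    have h1 : g (y (g v)) = b • v := by simpa using hv
    have h2 := congrArg g h1
    rw [hgg, h1, map_smul] at h2
    rw [eq_sub_iff_add_eq, ← h2, mul_comm, mul_smul]
  -- This `c` makes `g v + c v` satisfy the eigenvector equation of `y` for `b`. Since `b` is not a
  -- root of the polynomial annihilating `y`, that vector vanishes. So `v` is an eigenvector of `g`,
  -- with eigenvalue `q` or `-q⁻¹`, and `b` is `q²` or `q⁻²` times `a`: the exponent moves by one.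
  set c := b * lam q / (a - b) with hc
  have hcb : a * c - b * lam q = b * c := by
    rw [hc]; field_simp; ring
  have hu : y (g v + c • v) = b • (g v + c • v) := by
    rw [map_add, map_smul, hygv, ha, smul_add, smul_smul, smul_smul, ← hcb, sub_smul,
      mul_comm c a]
    abel
  have hu0 : g v + c • v = 0 := by
    by_contra h
    exact hbm (root h hu)
  have hgv : g v = (-c) • v := by
    rw [neg_smul]; exact eq_neg_of_add_eq_zero_left hu0
  have hquad : (-c) * (-c) = 1 + lam q * (-c) := by
    have := hgg v
    rw [hgv, map_smul, hgv, smul_smul, smul_smul, ← one_smul ℂ v, smul_smul, smul_smul, ← add_smul] at this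
    have := smul_left_injective ℂ hv0 this
    simpa using this
  have hbv : b = (-c) * (-c) * a := by
    have h1 : g (y (g v)) = b • v := by simpa using hv
    rw [hgv, map_smul, ha, map_smul, map_smul, hgv, smul_smul, smul_smul] at h1
    have := smul_left_injective ℂ hv0 h1
    rw [← this]; ring
  obtain ⟨d, hd, rfl⟩ := contentPoly_eval_eq_zero.1 (root hv0 ha)
  have hfac : (-c - q) * (-c + q⁻¹) = 0 := by
    have : q * q⁻¹ = 1 := mul_inv_cancel₀ hq
    simp only [lam] at hquad
    linear_combination hquad - this
  rw [abs_le] at hd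
  rcases mul_eq_zero.1 hfac with h | h
  · refine ⟨d + 1, abs_le.2 ⟨by linarith [hd.1], by linarith [hd.2]⟩, ?_⟩
    rw [hbv, sub_eq_zero.1 h, mul_add, zpow_add₀ hq]
    norm_num [zpow_ofNat]; ring
  · refine ⟨d - 1, abs_le.2 ⟨by linarith [hd.1], by linarith [hd.2]⟩, ?_⟩
    rw [hbv, eq_neg_of_add_eq_zero_left h, mul_sub, zpow_sub₀ hq]
    norm_num [zpow_ofNat]; field_simp

end Rank2

section Hermitian

variable {σ : Type*} [Fintype σ] [DecidableEq σ]

/-- The eigenbasis is what turns a bound on the eigenvalues into an annihilating polynomial without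
multiplicities. -/
lemma aeval_eq_zero_of_isHermitian {X : Matrix σ σ ℂ} (hX : X.IsHermitian) {p : ℂ[X]}
    (hp : ∀ b, Module.End.HasEigenvalue (Matrix.toLin' X) b → p.eval b = 0) : aeval X p = 0 := by
  apply Matrix.toLin'.injective
  rw [map_zero]
  have h1 : Matrix.toLin' (aeval X p) = aeval (Matrix.toLin' X) p :=
    (Polynomial.aeval_algHom_apply (Matrix.toLinAlgEquiv' : Matrix σ σ ℂ ≃ₐ[ℂ] _).toAlgHom X p).symm
  rw [h1]
  let b := hX.eigenvectorBasis.toBasis.map (WithLp.linearEquiv 2 ℂ (σ → ℂ))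
  refine b.ext fun j => ?_
  have hb : Matrix.toLin' X (b j) = (hX.eigenvalues j : ℂ) • b j := by
    have := hX.mulVec_eigenvectorBasis j
    simpa [b, Matrix.toLin'_apply] using this
  rw [aeval_apply_of_eigenvector hb, LinearMap.zero_apply, hp, zero_smul]
  exact Module.End.hasEigenvalue_of_hasEigenvector ⟨Module.End.mem_eigenspace_iff.2 hb, b.ne_zero j⟩

end Hermitian

end QuantumGL

namespace QuantumGL

open Module Polynomial

/-! ### Jucys-Murphy elements and their semisimplicity -/

section JucysMurphy

variable {ι τ : Type} [Fintype ι] [LinearOrder ι] [Fintype τ] [DecidableEq τ]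

/-- `R̂₁ A₂ R̂₁` for an operator `A` on `V ⊗ E`. -/
def dress (q : ℂ) (A : Matrix (ι × τ) (ι × τ) ℂ) : Matrix (ι × ι × τ) (ι × ι × τ) ℂ :=
  braid q * amp ι A * braid q

/-- `A` and `C`, both depending on `q`, are the Jucys-Murphy element on `V ⊗ E` and the sum of the
Jucys-Murphy elements on `E`, where `E` is a tensor power of `V` of exponent `m`. -/
structure IsJucysMurphy (A : ℂ → Matrix (ι × τ) (ι × τ) ℂ) (C : ℂ → Matrix τ τ ℂ) (m : ℕ) :
    Prop where
  transpose : ∀ q, (A q).transpose = A q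
  map_star : ∀ q, (A q).map star = A (star q)
  diff : ∀ i j, DifferentiableOn ℂ (fun q => A q i j) {0}ᶜ
  refl : ∀ q, q ≠ 0 → Commute (amp ι (A q)) (dress q (A q))
  comm : ∀ q, q ≠ 0 → Commute (A q) (amp ι (C q))
  ann : ∀ q, q ≠ 0 → aeval (A q) (contentPoly m q) = 0
  ss : ∀ q, q ≠ 0 → (∀ n : ℕ, 0 < n → q ^ n ≠ 1) →
    Module.End.IsSemisimple (Matrix.toLin' (C q))

/-- The empty tensor power: for `m = 0` the only exponent is `0` and `contentPoly` is `X - 1`. -/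
lemma isJucysMurphy_unit : IsJucysMurphy (ι := ι) (τ := Unit) (fun _ => 1) (fun _ => 0) 0 where
  transpose _ := Matrix.transpose_one
  map_star _ := by simp
  diff i j := by fun_prop
  refl q _ := by simp
  comm q _ := Commute.one_left _
  ann q _ := by simp [contentPoly]
  ss q _ _ := by simp

lemma amp_transpose (X : Matrix τ τ ℂ) : (amp ι X).transpose = amp ι X.transpose := by
  ext i j
  simp [eq_comm]

lemma amp_map_star (X : Matrix τ τ ℂ) : (amp ι X).map star = amp ι (X.map star) := by
  ext i j
  simp only [Matrix.map_apply, amp_apply]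
  split_ifs <;> simp

lemma star_lam (q : ℂ) : star (lam q) = lam (star q) := by simp [lam]

lemma braid_map_star (q : ℂ) :
    (braid q : Matrix (ι × ι × τ) (ι × ι × τ) ℂ).map star = braid (star q) := by
  ext i j
  simp only [braid, Matrix.map_apply, Matrix.of_apply, swapCoeff, stayCoeff, star_add,
    apply_ite star, star_zero, star_one, star_lam]

lemma braid_differentiableOn (i j : ι × ι × τ) :
    DifferentiableOn ℂ (fun q => braid q i j) {0}ᶜ := by
  simp only [braid, Matrix.of_apply, swapCoeff, stayCoeff, lam]
  have h : DifferentiableOn ℂ (fun q : ℂ => q - q⁻¹) {0}ᶜ :=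
    differentiableOn_id.sub (differentiableOn_id.inv fun x hx => hx)
  apply DifferentiableOn.add <;> split_ifs <;>
    first | exact h | exact differentiableOn_const _ | exact differentiableOn_id

lemma differentiableOn_mul {σ : Type*} [Fintype σ] {X Y : ℂ → Matrix σ σ ℂ}
    (hX : ∀ i j, DifferentiableOn ℂ (fun q => X q i j) {0}ᶜ)
    (hY : ∀ i j, DifferentiableOn ℂ (fun q => Y q i j) {0}ᶜ) (i j : σ) :
    DifferentiableOn ℂ (fun q => (X q * Y q) i j) {0}ᶜ := by
  simp only [Matrix.mul_apply]
  exact DifferentiableOn.fun_sum fun k _ => (hX i k).mul (hY k j)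

lemma differentiableOn_contentPoly {σ : Type*} [Fintype σ] [DecidableEq σ] {X : ℂ → Matrix σ σ ℂ}
    (hX : ∀ i j, DifferentiableOn ℂ (fun q => X q i j) {0}ᶜ) (m : ℕ) (i j : σ) :
    DifferentiableOn ℂ (fun q => aeval (X q) (contentPoly m q) i j) {0}ᶜ := by
  -- Matrices do not commute, so the product of the linear factors is taken along a list.
  have key : ∀ (l : List ℤ) (i j : σ), DifferentiableOn ℂ
      (fun q => (l.map fun c => X q - algebraMap ℂ _ (q ^ (2 * c))).prod i j) {0}ᶜ := by
    intro l
    induction l with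
    | nil => intro i j; simp only [List.map_nil, List.prod_nil]; exact differentiableOn_const _
    | cons c l ih =>
      intro i j
      simp only [List.map_cons, List.prod_cons]
      refine differentiableOn_mul (fun i j => ?_) ih i j
      simp only [Matrix.sub_apply, Matrix.algebraMap_matrix_apply]
      refine (hX i j).sub ?_
      split_ifs
      · exact fun z hz => (differentiableAt_zpow.2 (Or.inl hz)).differentiableWithinAt
      · exact differentiableOn_const _
  refine (key (Finset.Icc (-(m : ℤ)) m).toList i j).congr fun q _ => ?_
  rw [contentPoly, ← Finset.prod_map_toList, map_list_prod, List.map_map]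
  refine congrArg (fun l : List (Matrix σ σ ℂ) => l.prod i j) (List.map_congr_left fun c _ => ?_)
  simp

/-- A function holomorphic on the punctured plane that vanishes at the real points different from
`1` vanishes. -/
lemma eq_zero_of_real {f : ℂ → ℂ} (hf : DifferentiableOn ℂ f {0}ᶜ)
    (h : ∀ x : ℝ, 0 < x → x ≠ 1 → f x = 0) {q : ℂ} (hq : q ≠ 0) : f q = 0 := by
  have ho : IsOpen ({0}ᶜ : Set ℂ) := isOpen_compl_singleton
  have hc : IsPreconnected ({0}ᶜ : Set ℂ) :=
    (isConnected_compl_singleton_of_one_lt_rank (by simp) (0 : ℂ)).isPreconnected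
  refine (hf.analyticOnNhd ho).eqOn_zero_of_preconnected_of_frequently_eq_zero hc
    (z₀ := 1) (by simp) ?_ (show q ∈ ({0}ᶜ : Set ℂ) from hq)
  have ht : Filter.Tendsto (fun n : ℕ => ((1 + 1 / ((n : ℝ) + 1) : ℝ) : ℂ)) Filter.atTop
      (nhdsWithin 1 {1}ᶜ) := by
    rw [tendsto_nhdsWithin_iff]
    constructor
    · have : Filter.Tendsto (fun n : ℕ => (1 + 1 / ((n : ℝ) + 1) : ℝ)) Filter.atTop (nhds 1) := by
        simpa using tendsto_one_div_add_atTop_nhds_zero_nat.const_add (1 : ℝ)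
      exact (Complex.continuous_ofReal.tendsto' 1 1 (by simp)).comp this
    · refine Filter.Eventually.of_forall fun n => ?_
      have : (1 / ((n : ℝ) + 1)) ≠ 0 := by positivity
      simp only [Set.mem_compl_iff, Set.mem_singleton_iff]
      norm_cast
      simpa using this
  refine ht.frequently (Filter.Frequently.of_forall fun n => h _ (by positivity) ?_)
  have : (1 / ((n : ℝ) + 1)) ≠ 0 := by positivity
  simpa using this

/-- The roots `q ^ (2c)` are pairwise distinct because `q` has infinite order. -/
lemma contentPoly_squarefree {m : ℕ} {q : ℂ} (hq0 : q ≠ 0) (hq : ∀ n : ℕ, 0 < n → q ^ n ≠ 1) :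
    Squarefree (contentPoly m q) := by
  have hz : ∀ n : ℤ, n ≠ 0 → q ^ n ≠ 1 := by
    intro n hn h
    refine hq n.natAbs (Int.natAbs_pos.2 hn) ?_
    rcases Int.eq_nat_or_neg n with ⟨k, rfl | rfl⟩ <;> simpa using h
  have hinj : Function.Injective fun c : ℤ => q ^ (2 * c) := by
    intro a b hab
    by_contra hne
    refine hz (2 * a - 2 * b) (by omega) ?_
    rw [zpow_sub₀ hq0]
    simp only at hab
    rw [hab, div_self (zpow_ne_zero _ hq0)]
  have : (contentPoly m q).Separable :=
    Polynomial.separable_prod_X_sub_C_iff'.2 fun a _ b _ h => hinj h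
  exact this.squarefree

lemma isSemisimple_toLin {σ : Type*} [Fintype σ] [DecidableEq σ] {X : Matrix σ σ ℂ} {p : ℂ[X]}
    (hp : Squarefree p) (h : aeval X p = 0) : Module.End.IsSemisimple (Matrix.toLin' X) := by
  refine Module.End.isSemisimple_of_squarefree_aeval_eq_zero hp ?_
  have h1 : Matrix.toLin' (aeval X p) = aeval (Matrix.toLin' X) p :=
    (Polynomial.aeval_algHom_apply (Matrix.toLinAlgEquiv' : Matrix σ σ ℂ ≃ₐ[ℂ] _).toAlgHom X p).symm
  rw [← h1, h, map_zero]

/-- `amp` is an algebra homomorphism, so the squarefree minimal polynomial of `X` also annihilates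
`1 ⊗ X`. -/
lemma isSemisimple_amp {X : Matrix τ τ ℂ} (h : Module.End.IsSemisimple (Matrix.toLin' X)) :
    Module.End.IsSemisimple (Matrix.toLin' (amp ι X)) := by
  refine isSemisimple_toLin h.minpoly_squarefree ?_
  rw [Polynomial.aeval_algHom_apply]
  have h1 : Matrix.toLin' (aeval X (minpoly ℂ (Matrix.toLin' X))) =
      aeval (Matrix.toLin' X) (minpoly ℂ (Matrix.toLin' X)) :=
    (Polynomial.aeval_algHom_apply (Matrix.toLinAlgEquiv' : Matrix τ τ ℂ ≃ₐ[ℂ] _).toAlgHom X _).symm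
  rw [minpoly.aeval] at h1
  rw [Matrix.toLin'.injective (h1.trans (map_zero _).symm), map_zero]

variable {A : ℂ → Matrix (ι × τ) (ι × τ) ℂ} {C : ℂ → Matrix τ τ ℂ} {m : ℕ}

lemma IsJucysMurphy.isSemisimple (h : IsJucysMurphy A C m) {q : ℂ} (hq0 : q ≠ 0)
    (hq : ∀ n : ℕ, 0 < n → q ^ n ≠ 1) : Module.End.IsSemisimple (Matrix.toLin' (A q)) :=
  isSemisimple_toLin (contentPoly_squarefree hq0 hq) (h.ann q hq0)

lemma dress_transpose {q : ℂ} {X : Matrix (ι × τ) (ι × τ) ℂ} (h : X.transpose = X) :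
    (dress q X).transpose = dress q X := by
  simp only [dress, Matrix.transpose_mul, braid_transpose, amp_transpose, h, mul_assoc]

lemma dress_star {q q' : ℂ} {X Y : Matrix (ι × τ) (ι × τ) ℂ} (hq : star q = q')
    (h : X.map star = Y) : (dress q X).map star = dress q' Y := by
  have hm : ∀ U V : Matrix (ι × ι × τ) (ι × ι × τ) ℂ,
      (U * V).map star = U.map star * V.map star := fun U V =>
    Matrix.map_mul (f := starRingEnd ℂ)
  rw [dress, hm, hm, braid_map_star, amp_map_star, hq, h, dress]

/-- Write `g`, `s` for `R̂` in the first and second position and `b` for `A` behind them. The braid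
relation and `g b = b g` bring both products to the form `s g (⋯) g s`, with the two sides of the
reflection equation for `A` in the middle. -/
lemma IsJucysMurphy.dress_refl (h : IsJucysMurphy A C m) {q : ℂ} (hq : q ≠ 0) :
    Commute (amp ι (dress q (A q))) (dress q (dress q (A q))) := by
  have hr : Commute (amp ι (amp ι (A q))) (amp ι (dress q (A q))) := (h.refl q hq).map (amp ι)
  have hG : Commute (braid q) (amp ι (amp ι (A q))) := commute_braid_amp_amp q (A q)
  have hb := braid_braid (ι := ι) (τ := τ) hq
  have e : amp ι (dress q (A q)) = amp ι (braid q) * amp ι (amp ι (A q)) * amp ι (braid q) := by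
    rw [dress, map_mul, map_mul]
  rw [dress.eq_def q (dress q (A q)), e]
  rw [e] at hr
  generalize amp ι (amp ι (A q)) = b at *
  generalize (amp ι (braid q) : Matrix (ι × ι × ι × τ) (ι × ι × ι × τ) ℂ) = s at *
  generalize (braid q : Matrix (ι × ι × ι × τ) (ι × ι × ι × τ) ℂ) = g at *
  have hG' : g * b = b * g := hG
  have hr' : b * (s * b * s) = s * b * s * b := hr
  have e1 : s * b * s * (g * (s * b * s) * g) = s * g * (b * (s * b * s)) * g * s := by
    calc _ = s * b * (s * g * s) * b * s * g := by noncomm_ring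
      _ = s * (b * g) * s * (g * b) * s * g := by rw [← hb]; noncomm_ring
      _ = s * (g * b) * s * (b * g) * s * g := by rw [hG']
      _ = s * g * b * s * b * (g * s * g) := by noncomm_ring
      _ = _ := by rw [hb]; noncomm_ring
  have e2 : g * (s * b * s) * g * (s * b * s) = s * g * (s * b * s * b) * g * s := by
    calc _ = g * s * b * (s * g * s) * b * s := by noncomm_ring
      _ = g * s * (b * g) * s * (g * b) * s := by rw [← hb]; noncomm_ring
      _ = g * s * (g * b) * s * (b * g) * s := by rw [hG']
      _ = (g * s * g) * b * s * b * g * s := by noncomm_ring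
      _ = _ := by rw [hb]; noncomm_ring
  rw [Commute, SemiconjBy, e1, e2, hr']

/-- `eigenvalue_of_hecke` controls the spectrum but not the multiplicities in the minimal
polynomial. For real `q > 0` the element is real symmetric, which settles the multiplicities. The
entries of the polynomial in question are holomorphic on the punctured plane, so the identity
extends to every `q ≠ 0`. -/
lemma IsJucysMurphy.dress_ann (h : IsJucysMurphy A C m) {q : ℂ} (hq : q ≠ 0) :
    aeval (dress q (A q)) (contentPoly (m + 1) q) = 0 := by
  have hd : ∀ i j, DifferentiableOn ℂ (fun q => dress q (A q) i j) {0}ᶜ := by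
    refine differentiableOn_mul (differentiableOn_mul braid_differentiableOn ?_)
      braid_differentiableOn
    intro i j
    simp only [amp_apply]
    split_ifs
    · exact h.diff _ _
    · exact differentiableOn_const _
  ext i j
  refine eq_zero_of_real (differentiableOn_contentPoly hd (m + 1) i j) (fun x hx _ => ?_) hq
  have hx0 : (x : ℂ) ≠ 0 := by exact_mod_cast hx.ne'
  have hs : star (x : ℂ) = x := Complex.conj_ofReal x
  suffices H : aeval (dress (x : ℂ) (A x)) (contentPoly (m + 1) x) = 0 by
    rw [H]; rfl
  refine aeval_eq_zero_of_isHermitian ?_ ?_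
  · rw [Matrix.IsHermitian, Matrix.conjTranspose, dress_transpose (h.transpose x)]
    exact dress_star hs (by rw [h.map_star, hs])
  · intro b hb
    rw [contentPoly_eval_eq_zero]
    let Φ : Matrix (ι × ι × τ) (ι × ι × τ) ℂ ≃ₐ[ℂ] _ := Matrix.toLinAlgEquiv'
    have hb' : Module.End.HasEigenvalue (Φ (braid x) * Φ (amp ι (A x)) * Φ (braid x)) b := by
      rw [← map_mul, ← map_mul]; exact hb
    refine mod_cast eigenvalue_of_hecke hx0 (m := m) ?_ ?_ ?_ hb'
    · rw [← map_mul, braid_mul_self hx0, map_add, map_one, map_smul]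
    · rw [← AlgEquiv.coe_toAlgHom, Polynomial.aeval_algHom_apply, Polynomial.aeval_algHom_apply,
        h.ann _ hx0, map_zero, map_zero]
    · rw [← map_mul, ← map_mul]
      exact (h.refl _ hx0).map Φ

/-- Adding one tensor factor. -/
lemma IsJucysMurphy.step (h : IsJucysMurphy A C m) :
    IsJucysMurphy (fun q => dress q (A q)) (fun q => amp ι (C q) + A q) (m + 1) where
  transpose q := dress_transpose (h.transpose q)
  map_star q := dress_star rfl (h.map_star q)
  diff := by
    refine differentiableOn_mul (differentiableOn_mul braid_differentiableOn ?_)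
      braid_differentiableOn
    intro i j
    simp only [amp_apply]
    split_ifs
    · exact h.diff _ _
    · exact differentiableOn_const _
  refl q hq := h.dress_refl hq
  comm q hq := by
    rw [map_add]
    refine Commute.add_right ?_ (h.refl q hq).symm
    have h1 : Commute (amp ι (A q)) (amp ι (amp ι (C q))) := (h.comm q hq).map (amp ι)
    have h2 := commute_braid_amp_amp (ι := ι) q (C q)
    exact (h2.mul_left h1).mul_left h2
  ann q hq := h.dress_ann hq
  ss q hq0 hq := by
    rw [map_add]
    refine Module.End.IsSemisimple.add_of_commute ?_ (isSemisimple_amp (h.ss q hq0 hq))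
      (h.isSemisimple hq0 hq)
    exact ((h.comm q hq0).symm).map (Matrix.toLinAlgEquiv' : _ ≃ₐ[ℂ] Module.End ℂ (ι × τ → ℂ))

end JucysMurphy

end QuantumGL

namespace QuantumGL

/-! ### Exchange relations derived from the defining ones -/

section Relations

variable {S : Type*} [Ring S] [Algebra ℂ S] {c : ℂ} {r r' w j l k ui : S}

/-- In this section matrices on two spaces are letters of one ring: `r`, `r'`, `c` stand for `R̂`,
`R̂⁻¹`, `λ`; `w`, `l`, `k`, `j` for `ω`, `L`, `L⁻¹`, `J` in the second space; the suffix `1` marks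
the first space, and `t` is `T` in the second. -/
lemma braid_sq (hr : r * r' = 1) (hc : r = r' + c • (1 : S)) : r * r = 1 + c • r := by
  calc r * r = r * (r' + c • (1 : S)) := by rw [← hc]
    _ = _ := by rw [mul_add, hr, mul_smul_comm, mul_one]

lemma commute_inverse {x y z : S} (hy : y * z = 1) (hz : z * y = 1) (h : x * y = y * x) :
    x * z = z * x := by
  calc x * z = z * (y * x) * z := by rw [← mul_assoc z, hz, one_mul]
    _ = z * x * (y * z) := by rw [← h]; noncomm_ring
    _ = z * x := by rw [hy, mul_one]

/-- The square `r r` on the left contributes an extra `c r w`; it matches the inhomogeneous term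
that the `ωJ` relation produces in `w r' w j r`. -/
lemma rel_u_w (hr : r * r' = 1) (hr' : r' * r = 1) (hc : r = r' + c • (1 : S))
    (hww : w * r' * w * r = -(r' * w * r' * w)) (hwj : w * r * j * r + r * j * r * w = -r) :
    r * (1 + c • (w * j)) * r * w = w * r' * (1 + c • (w * j)) * r := by
  have h1 : w * r' * w = -(r * w * r' * w * r) := by
    calc w * r' * w = (r * r') * w * r' * w := by rw [hr, one_mul]
      _ = -(r * (-(r' * w * r' * w))) := by noncomm_ring
      _ = _ := by rw [← hww]; noncomm_ring
  have h2 : w * r * j * r = -r - r * j * r * w := by rw [← hwj]; abel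
  have h3 : w * r' * w * j * r = r * w + r * w * j * r * w := by
    calc w * r' * w * j * r = -(r * w * r' * (w * r * j * r)) := by rw [h1]; noncomm_ring
      _ = r * w * (r' * r) + r * w * (r' * r) * j * r * w := by rw [h2]; noncomm_ring
      _ = _ := by rw [hr', mul_one]
  calc r * (1 + c • (w * j)) * r * w = r * r * w + c • (r * w * j * r * w) := by
        simp only [mul_add, add_mul, mul_one, mul_smul_comm, smul_mul_assoc, mul_assoc]
    _ = w + c • (r * w + r * w * j * r * w) := by
        rw [braid_sq hr hc, add_mul, one_mul, smul_mul_assoc, smul_add, add_assoc]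
    _ = w * (r' * r) + c • (w * r' * w * j * r) := by rw [← h3, hr', mul_one]
    _ = _ := by simp only [mul_add, add_mul, mul_one, mul_smul_comm, smul_mul_assoc, mul_assoc]

lemma rel_j_r_w (hr' : r' * r = 1) (hwj : w * r * j * r + r * j * r * w = -r) :
    j * r * w = -1 - r' * w * r * j * r := by
  have : r' * (r * j * r * w) = r' * (-r - w * r * j * r) := by rw [← hwj]; noncomm_ring
  calc j * r * w = r' * (r * j * r * w) := by
        rw [← mul_assoc, ← mul_assoc, ← mul_assoc, hr', one_mul]
    _ = -(r' * r) - r' * w * r * j * r := by rw [this]; noncomm_ring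
    _ = _ := by rw [hr']

lemma rel_u_j (hr : r * r' = 1) (hr' : r' * r = 1) (hc : r = r' + c • (1 : S))
    (hjj : j * r * j * r = -(r' * j * r * j)) (hwj : w * r * j * r + r * j * r * w = -r) :
    j * r * (1 + c • (w * j)) * r = r' * (1 + c • (w * j)) * r * j := by
  have h1 : r * j * r * j * r = -(j * r * j) := by
    calc r * j * r * j * r = r * (j * r * j * r) := by noncomm_ring
      _ = -(r * r' * j * r * j) := by rw [hjj]; noncomm_ring
      _ = _ := by rw [hr, one_mul]
  have h2 : j * r * w * j * r = -(j * r) + r' * w * j * r * j := by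
    calc j * r * w * j * r = -(j * r) - r' * w * (r * j * r * j * r) := by
          rw [rel_j_r_w hr' hwj]; noncomm_ring
      _ = _ := by rw [h1]; noncomm_ring
  calc j * r * (1 + c • (w * j)) * r = j * (r * r) + c • (j * r * w * j * r) := by
        simp only [mul_add, add_mul, mul_one, mul_smul_comm, smul_mul_assoc, mul_assoc]
    _ = j + c • (r' * w * j * r * j) := by
        rw [braid_sq hr hc, h2, mul_add, mul_one, mul_smul_comm, smul_add, smul_neg]; abel
    _ = (r' * r) * j + c • (r' * w * j * r * j) := by rw [hr', one_mul]
    _ = _ := by simp only [mul_add, add_mul, mul_one, mul_smul_comm, smul_mul_assoc, mul_assoc]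

lemma rel_u'_w (hr : r * r' = 1) (hr' : r' * r = 1) (hc : r = r' + c • (1 : S))
    (hww : w * r' * w * r = -(r' * w * r' * w)) (hwj : w * r * j * r + r * j * r * w = -r) :
    r * (1 + c • (j * w)) * r' * w = w * r * (1 + c • (j * w)) * r := by
  have hc' : r' = r - c • (1 : S) := by rw [hc]; abel
  have h1 : r * w * r' * w = -(w * r' * w * r') := by
    calc r * w * r' * w = r * w * r' * w * (r * r') := by rw [hr, mul_one]
      _ = r * (w * r' * w * r) * r' := by noncomm_ring
      _ = -(r * r' * w * r' * w * r') := by rw [hww]; noncomm_ring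
      _ = _ := by rw [hr, one_mul]
  have h2 : r * j * r * w = -r - w * r * j * r := by rw [← hwj]; abel
  have h3 : r * j * w * r' * w = w * r' + w * r * j * w * r' + c • (r * j * w * r' * w * r') := by
    calc r * j * w * r' * w = r * j * (r' * r) * w * r' * w := by rw [hr', mul_one]
      _ = r * j * r' * (r * w * r' * w) := by noncomm_ring
      _ = -(r * j * r' * w * r' * w * r') := by rw [h1]; noncomm_ring
      _ = -(r * j * (r - c • (1 : S)) * w * r' * w * r') := by rw [← hc']
      _ = -((r * j * r * w) * r' * w * r') + c • (r * j * w * r' * w * r') := by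
          simp only [mul_sub, sub_mul, mul_one, mul_smul_comm, smul_mul_assoc, mul_assoc]; abel
      _ = (r * r') * w * r' + w * r * j * (r * r') * w * r' + c • (r * j * w * r' * w * r') := by
          rw [h2]; noncomm_ring
      _ = _ := by rw [hr]; noncomm_ring
  -- In `h3` the product `r j w r' w` occurs on both sides. As `1 - c r' = r' r'`, multiplying on
  -- the right by `r` twice isolates it.
  have h4 : r * j * w * r' * w = w * r + w * r * j * w * r := by
    calc r * j * w * r' * w = r * j * w * r' * w * (r - c • (1 : S)) * r := by
          rw [← hc', mul_assoc _ r' r, hr', mul_one]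
      _ = (r * j * w * r' * w * r - c • (r * j * w * r' * w)) * r := by
          simp only [mul_sub, mul_one, mul_smul_comm]
      _ = ((w * r' + w * r * j * w * r' + c • (r * j * w * r' * w * r')) * r
            - c • (r * j * w * r' * w)) * r := by rw [← h3]
      _ = (w * (r' * r) + w * r * j * w * (r' * r) + c • (r * j * w * r' * w * (r' * r))
            - c • (r * j * w * r' * w)) * r := by
          simp only [add_mul, smul_mul_assoc, mul_assoc]
      _ = _ := by rw [hr']; simp only [mul_one, add_sub_cancel_right, add_mul]
  calc r * (1 + c • (j * w)) * r' * w = r * r' * w + c • (r * j * w * r' * w) := by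
        simp only [mul_add, add_mul, mul_one, mul_smul_comm, smul_mul_assoc, mul_assoc]
    _ = w * (r * r) + c • (w * r * j * w * r) := by
        rw [h4, hr, braid_sq hr hc]
        simp only [mul_add, one_mul, mul_one, mul_smul_comm, smul_add, add_assoc]
    _ = _ := by simp only [mul_add, add_mul, mul_one, mul_smul_comm, smul_mul_assoc, mul_assoc]

/-- If `X a = b X` for units `a`, `b`, then `b⁻¹ X = X a⁻¹`. -/
lemma inverse_intertwine {x a a' b b' : S} (ha : a * a' = 1) (hb : b' * b = 1)
    (h : x * a = b * x) : b' * x = x * a' := by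
  calc b' * x = b' * (x * a) * a' := by rw [mul_assoc, mul_assoc, ha, mul_one]
    _ = b' * b * x * a' := by rw [h]; noncomm_ring
    _ = _ := by rw [hb, one_mul]

lemma mul_triple_inverse {x x' y y' z z' : S} (hx : x * x' = 1) (hy : y * y' = 1)
    (hz : z * z' = 1) : x * y * z * (z' * y' * x') = 1 := by
  calc x * y * z * (z' * y' * x') = x * (y * (z * z') * y') * x' := by noncomm_ring
    _ = 1 := by rw [hz, mul_one, hy, mul_one, hx]

variable {u : S}

/-- Inverting the exchange relation of `u` gives one for `ui`, which is composed with that of `l`.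
The product `l ui` is the factor `L U⁻¹` of the BRST operator. -/
lemma rel_v_w (hr : r * r' = 1) (hr' : r' * r = 1) (hu : u * ui = 1) (hu' : ui * u = 1)
    (huw : r * u * r * w = w * r' * u * r) (hwl : w * r * l * r = r * l * r * w) :
    r * (l * ui) * r' * w = w * r * (l * ui) * r := by
  have h : r' * ui * r' * w = w * (r' * ui * r) :=
    inverse_intertwine (a := r' * u * r) (b := r * u * r) (mul_triple_inverse hr' hu hr)
      (mul_triple_inverse hr' hu' hr') (by rw [huw]; noncomm_ring)
  calc r * (l * ui) * r' * w = r * l * (r * r') * ui * r' * w := by rw [hr]; noncomm_ring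
    _ = r * l * r * (r' * ui * r' * w) := by noncomm_ring
    _ = (r * l * r * w) * (r' * ui * r) := by rw [h]; noncomm_ring
    _ = w * r * l * (r * r') * ui * r := by rw [← hwl]; noncomm_ring
    _ = _ := by rw [hr]; noncomm_ring

lemma rel_j_v (hr : r * r' = 1) (hr' : r' * r = 1) (hu : u * ui = 1) (hu' : ui * u = 1)
    (huj : j * r * u * r = r' * u * r * j) (hjl : j * r * l * r = r * l * r * j) :
    j * r * (l * ui) * r' = r * (l * ui) * r * j := by
  have h : r' * ui * r * j = j * (r' * ui * r') :=
    inverse_intertwine (a := r * u * r) (b := r' * u * r) (mul_triple_inverse hr hu hr)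
      (mul_triple_inverse hr' hu' hr) (by rw [← huj]; noncomm_ring)
  calc j * r * (l * ui) * r' = j * r * l * (r * r') * ui * r' := by rw [hr]; noncomm_ring
    _ = (j * r * l * r) * (r' * ui * r') := by noncomm_ring
    _ = r * l * r * (j * (r' * ui * r')) := by rw [hjl]; noncomm_ring
    _ = r * l * (r * r') * ui * r * j := by rw [← h]; noncomm_ring
    _ = _ := by rw [hr]; noncomm_ring

/-- The inhomogeneous term of the `ωJ` relation leaves `v` and `1 + c w j` separated only by `r'`.
The partial trace removes this `r'`, and for `v = L U⁻¹` just `-L` remains. -/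
lemma rel_j_wv {v : S} (hr : r * r' = 1) (hr' : r' * r = 1) (hc : r = r' + c • (1 : S))
    (hwj : w * r * j * r + r * j * r * w = -r) (hjv : j * r * v * r' = r * v * r * j)
    (hvw : r * v * r' * w = w * r * v * r) :
    j * r * (w * v) * r' = -(v * r' * (1 + c • (w * j))) - r' * (w * v) * r * j := by
  calc j * r * (w * v) * r' = (j * r * w) * v * r' := by noncomm_ring
    _ = -(v * r') - r' * w * r * (j * r * v * r') := by rw [rel_j_r_w hr' hwj]; noncomm_ring
    _ = -(v * r') - r' * w * (r * r) * v * r * j := by rw [hjv]; noncomm_ring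
    _ = -(v * r') - r' * w * v * r * j - c • (r' * (w * r * v * r) * j) := by
        rw [braid_sq hr hc]
        simp only [mul_add, add_mul, mul_one, mul_smul_comm, smul_mul_assoc, mul_assoc]; abel
    _ = -(v * r') - r' * w * v * r * j - c • ((r' * r) * v * r' * w * j) := by
        rw [← hvw]; simp only [mul_assoc]
    _ = _ := by
        rw [hr']
        simp only [mul_add, one_mul, mul_one, mul_smul_comm, mul_assoc]; abel

lemma rel_w_wv {v : S} (hr : r * r' = 1) (hr' : r' * r = 1)
    (hww : w * r' * w * r = -(r' * w * r' * w)) (hvw : r * v * r' * w = w * r * v * r) :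
    w * r' * (w * v) * r = -(r * (w * v) * r' * w) := by
  have h1 : w * r' * w = -(r * w * r' * w * r) := by
    calc w * r' * w = (r * r') * w * r' * w := by rw [hr, one_mul]
      _ = -(r * (-(r' * w * r' * w))) := by noncomm_ring
      _ = _ := by rw [← hww]; noncomm_ring
  calc w * r' * (w * v) * r = (w * r' * w) * v * r := by noncomm_ring
    _ = -(r * w * r' * (w * r * v * r)) := by rw [h1]; noncomm_ring
    _ = -(r * w * (r' * r) * v * r' * w) := by rw [← hvw]; noncomm_ring
    _ = _ := by rw [hr']; noncomm_ring

lemma rel_l_wv (hr : r * r' = 1) (hr' : r' * r = 1) (hwl : w * r * l * r = r * l * r * w)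
    (hll : l * r * l * r = r * l * r * l) (hul : ui * (r * l * r) = r * l * r * ui) :
    l * r * (w * (l * ui)) * r' = r' * (w * (l * ui)) * r * l := by
  calc l * r * (w * (l * ui)) * r' = (r' * r) * l * r * w * l * ui * r' := by
        rw [hr']; noncomm_ring
    _ = r' * (r * l * r * w) * l * ui * r' := by noncomm_ring
    _ = r' * w * (r * l * r * l) * ui * r' := by rw [← hwl]; noncomm_ring
    _ = r' * w * l * (r * l * r * ui) * r' := by rw [← hll]; noncomm_ring
    _ = r' * w * l * ui * r * l * (r * r') := by rw [← hul]; noncomm_ring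
    _ = _ := by rw [hr]; noncomm_ring

/-- Rewrites the `ωJ` relation through conjugates of `w` by `R̂`, the form whose partial trace
involves `Tr_q ω`. -/
lemma rel_w_j (hr : r * r' = 1) (hr' : r' * r = 1)
    (hwj : w * r * j * r + r * j * r * w = -r) : r' * w * r * j + j * r * w * r' = -r' := by
  rw [rel_j_r_w hr' hwj]
  calc _ = r' * w * r * j - r' - r' * w * r * j * (r * r') := by noncomm_ring
    _ = _ := by rw [hr]; noncomm_ring

lemma rel_n_w (hr : r * r' = 1) (hr' : r' * r = 1) (hlk : l * k = 1) (hkl : k * l = 1)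
    (hwl : w * r * l * r = r * l * r * w) (huw : r * u * r' * w = w * r * u * r) :
    r' * (k * u) * r' * w = w * r' * (k * u) * r := by
  have h : r' * k * r' * w = w * (r' * k * r') :=
    inverse_intertwine (a := r * l * r) (b := r * l * r) (mul_triple_inverse hr hlk hr)
      (mul_triple_inverse hr' hkl hr') (by rw [← hwl]; noncomm_ring)
  calc r' * (k * u) * r' * w = r' * k * (r' * r) * u * r' * w := by rw [hr']; noncomm_ring
    _ = r' * k * r' * (r * u * r' * w) := by noncomm_ring
    _ = (r' * k * r' * w) * r * u * r := by rw [huw]; noncomm_ring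
    _ = w * r' * k * (r' * r) * u * r := by rw [h]; noncomm_ring
    _ = _ := by rw [hr']; noncomm_ring

/-- Applied with `n = L⁻¹ (1 + λ J ω)`, so that `j n` is the matrix under the trace in the anti-BRST
operator. -/
lemma rel_m_w {n : S} (hr : r * r' = 1)
    (hwj : w * r * j * r + r * j * r * w = -r) (hnw : r' * n * r' * w = w * r' * n * r) :
    r * (j * n) * r' * w + w * r * (j * n) * r = -(n * r) := by
  have h2 : r * j * r * w = -r - w * r * j * r := by rw [← hwj]; abel
  calc _ = r * j * (r * r') * n * r' * w + w * r * (j * n) * r := by rw [hr]; noncomm_ring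
    _ = r * j * r * (r' * n * r' * w) + w * r * (j * n) * r := by noncomm_ring
    _ = (r * j * r * w) * r' * n * r + w * r * (j * n) * r := by rw [hnw]; noncomm_ring
    _ = -((r * r') * n * r) - w * r * j * (r * r') * n * r + w * r * (j * n) * r := by
        rw [h2]; noncomm_ring
    _ = _ := by rw [hr]; noncomm_ring

lemma rel_y_w {n : S} (hr : r * r' = 1)
    (huw : r * u * r * w = w * r' * u * r) (hnw : r' * n * r' * w = w * r' * n * r) :
    r * (u * n) * r' * w = w * r' * (u * n) * r := by
  calc r * (u * n) * r' * w = r * u * (r * r') * n * r' * w := by rw [hr]; noncomm_ring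
    _ = r * u * r * (r' * n * r' * w) := by noncomm_ring
    _ = (r * u * r * w) * r' * n * r := by rw [hnw]; noncomm_ring
    _ = w * r' * u * (r * r') * n * r := by rw [huw]; noncomm_ring
    _ = _ := by rw [hr]; noncomm_ring

lemma rel_l_y {y : S} (hr : r * r' = 1) (hr' : r' * r = 1) (h : y * (r * l * r) = r * l * r * y) :
    l * r * y * r' = r' * y * r * l := by
  calc l * r * y * r' = (r' * r) * l * r * y * r' := by rw [hr']; noncomm_ring
    _ = r' * (r * l * r * y) * r' := by noncomm_ring
    _ = r' * y * r * l * (r * r') := by rw [← h]; noncomm_ring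
    _ = _ := by rw [hr]; noncomm_ring

variable {t w1 l1 j1 k1 : S}

lemma rel_u_t (hr' : r' * r = 1) (hw : w1 * t = t * r' * w * r')
    (hj : j1 * t = t * r * j * r) :
    (1 + c • (w1 * j1)) * t = t * r' * (1 + c • (w * j)) * r := by
  have : w1 * j1 * t = t * r' * w * j * r := by
    calc w1 * j1 * t = w1 * t * r * j * r := by rw [mul_assoc, hj]; noncomm_ring
      _ = t * r' * w * (r' * r) * j * r := by rw [hw]; noncomm_ring
      _ = _ := by rw [hr', mul_one]
  rw [add_mul, one_mul, smul_mul_assoc, this]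
  simp only [mul_add, add_mul, mul_one, mul_smul_comm, smul_mul_assoc]
  rw [mul_assoc t r' r, hr', mul_one]
  simp only [mul_assoc]

lemma rel_u'_t (hr : r * r' = 1) (hw : w1 * t = t * r' * w * r') (hj : j1 * t = t * r * j * r) :
    (1 + c • (j1 * w1)) * t = t * r * (1 + c • (j * w)) * r' := by
  have : j1 * w1 * t = t * r * j * w * r' := by
    calc j1 * w1 * t = j1 * t * r' * w * r' := by rw [mul_assoc, hw]; noncomm_ring
      _ = t * r * j * (r * r') * w * r' := by rw [hj]; noncomm_ring
      _ = _ := by rw [hr, mul_one]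
  rw [add_mul, one_mul, smul_mul_assoc, this]
  simp only [mul_add, add_mul, mul_one, mul_smul_comm, smul_mul_assoc]
  rw [mul_assoc t r r', hr, mul_one]
  simp only [mul_assoc]

lemma rel_k_t (hr : r * r' = 1) (hlk : l * k = 1) (hkl1 : k1 * l1 = 1)
    (hl : l1 * t = t * r * l * r) : k1 * t = t * r' * k * r' := by
  have h : k1 * (t * r * l * r) = t := by rw [← hl, ← mul_assoc, hkl1, one_mul]
  calc k1 * t = k1 * t * (r * l * r * (r' * k * r')) := by
        rw [mul_triple_inverse hr hlk hr, mul_one]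
    _ = k1 * (t * r * l * r) * (r' * k * r') := by noncomm_ring
    _ = _ := by rw [h]; noncomm_ring

lemma rel_y_t {u1 n1 n : S} (hr : r * r' = 1) (hu : u1 * t = t * r' * u * r)
    (hn : n1 * t = t * r' * n * r') : u1 * n1 * t = t * r' * (u * n) * r' := by
  calc u1 * n1 * t = u1 * t * r' * n * r' := by rw [mul_assoc, hn]; noncomm_ring
    _ = t * r' * u * (r * r') * n * r' := by rw [hu]; noncomm_ring
    _ = _ := by rw [hr, mul_one]; noncomm_ring

lemma rel_n_t {u1 : S} (hr' : r' * r = 1) (hk : k1 * t = t * r' * k * r')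
    (hu : u1 * t = t * r * u * r') : k1 * u1 * t = t * r' * (k * u) * r' := by
  calc k1 * u1 * t = k1 * t * r * u * r' := by rw [mul_assoc, hu]; noncomm_ring
    _ = t * r' * k * (r' * r) * u * r' := by rw [hk]; noncomm_ring
    _ = _ := by rw [hr', mul_one]; noncomm_ring

end Relations

end QuantumGL

namespace QuantumGL

/-! ### `R̂` in coordinates and the weights of the quantum trace -/

section Numeric

variable {N : ℕ} {q : ℂ}

lemma Rhat_apply (i j : Fin N × Fin N) : Rhat N q i j =
    (if i = (j.2, j.1) then swapCoeff q j.1 j.2 else 0) +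
      (if i = j then stayCoeff q j.1 j.2 else 0) := by
  obtain ⟨a, b⟩ := i
  obtain ⟨c, d⟩ := j
  have : Rhat N q (a, b) (c, d) = R N q (b, a) (c, d) := by
    rw [Rhat, Matrix.mul_apply, Finset.sum_eq_single (b, a)]
    · simp [permMatrix]
    · rintro ⟨x, y⟩ _ h
      simp only [permMatrix, Matrix.of_apply]
      rw [if_neg, zero_mul]
      rintro ⟨rfl, rfl⟩
      exact h rfl
    · simp
  rw [this]
  simp only [R, Matrix.of_apply, Prod.mk.injEq, swapCoeff, stayCoeff, lam]
  by_cases h1 : b = c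
  · subst h1
    by_cases h2 : a = d
    · subst h2
      by_cases h3 : a = b
      · subst h3; simp
      · simp [h3, Ne.symm h3]
    · by_cases h3 : a = b
      · subst h3; simp [h2]
      · simp [h2, h3, Ne.symm h3]
  · by_cases h2 : b = d
    · subst h2
      by_cases h3 : a = c
      · subst h3; simp [h1]
      · simp [h1, h3]
    · simp [h1, h2]

lemma Rhat_eq_braid : Rhat N q = (braid (τ := Unit) q).submatrix (fun i => (i.1, i.2, ()))
    (fun i => (i.1, i.2, ())) := by
  ext ⟨a, b⟩ ⟨c, d⟩
  simp [Rhat_apply, braid]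

lemma Rhat_mul_self (hq : q ≠ 0) : Rhat N q * Rhat N q = 1 + lam q • Rhat N q := by
  let e : Fin N × Fin N ≃ Fin N × Fin N × Unit :=
    ⟨fun i => (i.1, i.2, ()), fun i => (i.1, i.2.1), fun _ => rfl, fun _ => rfl⟩
  have h : Rhat N q = (braid (τ := Unit) q).submatrix e e := Rhat_eq_braid
  rw [h, Matrix.submatrix_mul_equiv, braid_mul_self hq]
  ext i j
  simp [Matrix.one_apply]

lemma Rhat_mul_sub (hq : q ≠ 0) : Rhat N q * (Rhat N q - lam q • 1) = 1 := by
  rw [mul_sub, Rhat_mul_self hq, mul_smul_comm, mul_one, add_sub_cancel_right]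

lemma Rhat_inv (hq : q ≠ 0) : (Rhat N q)⁻¹ = Rhat N q - lam q • 1 :=
  Matrix.inv_eq_right_inv (Rhat_mul_sub hq)

/-- The diagonal entries of `D⁻¹`. -/
def qWeight (N : ℕ) (q : ℂ) (i : Fin N) : ℂ := q ^ (2 * ((N : ℤ) - ((i : ℕ) + 1)) + 1)

lemma sum_qWeight_lt (hq : q ≠ 0) (n : ℕ) (hn : n ≤ N) :
    lam q * ∑ i : Fin N, (if (i : ℕ) < n then qWeight N q i else 0) =
      q ^ (2 * (N : ℤ)) - q ^ (2 * ((N : ℤ) - n)) := by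
  induction n with
  | zero => simp
  | succ n ih =>
    have hs : ∑ i : Fin N, (if (i : ℕ) < n + 1 then qWeight N q i else 0) =
        (∑ i : Fin N, (if (i : ℕ) < n then qWeight N q i else 0)) + qWeight N q ⟨n, hn⟩ := by
      have : qWeight N q ⟨n, hn⟩ = ∑ i : Fin N, if i = ⟨n, hn⟩ then qWeight N q i else 0 := by simp
      rw [this, ← Finset.sum_add_distrib]
      refine Finset.sum_congr rfl fun i _ => ?_
      rcases lt_trichotomy (i : ℕ) n with h | h | h
      · rw [if_pos (by omega), if_pos h, if_neg (by rintro rfl; simp at h), add_zero]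
      · rw [if_pos (by omega), if_neg (by omega), if_pos (Fin.ext h), zero_add]
      · rw [if_neg (by omega), if_neg (by omega), if_neg (by rintro rfl; simp at h), add_zero]
    rw [hs, mul_add, ih (by omega), qWeight, lam]
    have e1 : 2 * ((N : ℤ) - n) = 2 * ((N : ℤ) - ((n : ℕ) + 1)) + 1 + 1 := by ring
    have e2 : 2 * ((N : ℤ) - ((n + 1 : ℕ) : ℤ)) = 2 * ((N : ℤ) - ((n : ℕ) + 1)) := by
      push_cast; ring
    rw [e1, e2, zpow_add_one₀ hq, zpow_add_one₀ hq]
    field_simp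
    ring

lemma sum_qWeight (hq : q ≠ 0) :
    lam q * ∑ i : Fin N, qWeight N q i = q ^ (2 * (N : ℤ)) - 1 := by
  have := sum_qWeight_lt (N := N) hq N le_rfl
  simpa using this

/-- The left side is a diagonal entry of the partial trace of `R̂`. Its independence of `c` is the
reason for this choice of weights. -/
lemma qWeight_telescope (hq : q ≠ 0) (c : Fin N) :
    q * qWeight N q c + lam q * ∑ i : Fin N, (if i < c then qWeight N q i else 0) =
      q ^ (2 * (N : ℤ)) := by
  have h := sum_qWeight_lt (N := N) hq c c.2.le
  have e : ∑ i : Fin N, (if i < c then qWeight N q i else 0) =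
    ∑ i : Fin N, (if (i : ℕ) < c then qWeight N q i else 0) := rfl
  rw [e, h, qWeight]
  have e1 : 2 * ((N : ℤ) - (c : ℕ)) = 2 * ((N : ℤ) - ((c : ℕ) + 1)) + 1 + 1 := by ring
  have e2 : q ^ (2 * ((N : ℤ) - (c : ℕ))) = q * q ^ (2 * ((N : ℤ) - ((c : ℕ) + 1)) + 1) := by
    rw [e1, zpow_add_one₀ hq, mul_comm]
  rw [e2]
  ring

/-- Collects the contributions to the coefficient of `X b d` in the partial trace of `R̂ X₂ R̂`,
apart from those that form `Tr_q X`. -/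
lemma sum_qWeight_stay (hq : q ≠ 0) (b d : Fin N) :
    (if b = d then qWeight N q b * (q * q - 1) else 0) + qWeight N q b * q * stayCoeff q b d +
      qWeight N q d * q * stayCoeff q d b +
        ∑ a, qWeight N q a * (stayCoeff q a b * stayCoeff q a d) = lam q * q ^ (2 * (N : ℤ)) := by
  have key : ∀ b d : Fin N, b ≤ d → ∑ a, qWeight N q a * (stayCoeff q a b * stayCoeff q a d) =
      lam q * (lam q * ∑ i : Fin N, (if i < b then qWeight N q i else 0)) := by
    intro b d hbd
    rw [Finset.mul_sum, Finset.mul_sum]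
    refine Finset.sum_congr rfl fun a _ => ?_
    by_cases h : a < b
    · simp [stayCoeff, h, h.trans_le hbd]; ring
    · simp [stayCoeff, h]
  have hql : q * q - 1 = lam q * q := by simp only [lam]; field_simp
  rcases lt_trichotomy b d with h | rfl | h
  · rw [key b d h.le, ← qWeight_telescope hq b]
    simp [stayCoeff, h, h.ne, h.not_gt]; ring
  · rw [key b b le_rfl, ← qWeight_telescope hq b, hql]
    simp [stayCoeff]; ring
  · simp only [mul_comm (stayCoeff q _ b)]
    rw [key d b h.le, ← qWeight_telescope hq d]
    simp [stayCoeff, h, h.ne', h.not_gt]; ring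

end Numeric

/-! ### The quantum trace over the first space -/

section PartialTrace

variable {N : ℕ} {q : ℂ} {A : Type*} [Ring A] [Algebra ℂ A]

/-- The matrix `R̂` with entries in an algebra. -/
def RA (N : ℕ) (q : ℂ) (A : Type*) [Ring A] [Algebra ℂ A] :
    Matrix (Fin N × Fin N) (Fin N × Fin N) A := (Rhat N q).map (algebraMap ℂ A)

/-- The matrix `R̂⁻¹` with entries in an algebra. -/
def RAinv (N : ℕ) (q : ℂ) (A : Type*) [Ring A] [Algebra ℂ A] :
    Matrix (Fin N × Fin N) (Fin N × Fin N) A := (Rhat N q)⁻¹.map (algebraMap ℂ A)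

lemma RA_mul_inv (hq : q ≠ 0) : RA N q A * RAinv N q A = 1 := by
  rw [RA, RAinv, ← Matrix.map_mul, Rhat_inv hq, Rhat_mul_sub hq]
  simp

lemma RA_inv_mul (hq : q ≠ 0) : RAinv N q A * RA N q A = 1 := by
  rw [RA, RAinv, ← Matrix.map_mul, Rhat_inv hq, mul_eq_one_comm.1 (Rhat_mul_sub hq)]
  simp

lemma RA_eq (hq : q ≠ 0) : RA N q A = RAinv N q A + lam q • 1 := by
  rw [RA, RAinv, Rhat_inv hq]
  ext i j
  by_cases h : i = j
  · subst h
    simp [Algebra.algebraMap_eq_smul_one]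
    module
  · simp [h]

lemma RA_mul_apply (X : Matrix (Fin N × Fin N) (Fin N × Fin N) A) (a b : Fin N)
    (y : Fin N × Fin N) : (RA N q A * X) (a, b) y =
      swapCoeff q a b • X (b, a) y + stayCoeff q a b • X (a, b) y := by
  have h : ∀ j : Fin N × Fin N, RA N q A (a, b) j =
      (if j = (b, a) then algebraMap ℂ A (swapCoeff q a b) else 0) +
        (if j = (a, b) then algebraMap ℂ A (stayCoeff q a b) else 0) := by
    rintro ⟨c, d⟩
    rw [RA, Matrix.map_apply, Rhat_apply, map_add]
    congr 1
    · by_cases h : c = b ∧ d = a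
      · obtain ⟨rfl, rfl⟩ := h
        simp [swapCoeff_comm]
      · have h' : ¬ (a = d ∧ b = c) := fun h0 => h ⟨h0.2.symm, h0.1.symm⟩
        simp [h, h']
    · by_cases h : c = a ∧ d = b
      · obtain ⟨rfl, rfl⟩ := h
        simp
      · have h' : ¬ (a = c ∧ b = d) := fun h0 => h ⟨h0.1.symm, h0.2.symm⟩
        simp [h, h']
  simp only [Matrix.mul_apply, h, add_mul, ite_mul, zero_mul, Finset.sum_add_distrib,
    Finset.sum_ite_eq', Finset.mem_univ, if_true, Algebra.smul_def]

lemma mul_RA_apply (X : Matrix (Fin N × Fin N) (Fin N × Fin N) A) (c d : Fin N)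
    (y : Fin N × Fin N) : (X * RA N q A) y (c, d) =
      swapCoeff q c d • X y (d, c) + stayCoeff q c d • X y (c, d) := by
  have h : ∀ j : Fin N × Fin N, RA N q A j (c, d) =
      (if j = (d, c) then algebraMap ℂ A (swapCoeff q c d) else 0) +
        (if j = (c, d) then algebraMap ℂ A (stayCoeff q c d) else 0) := by
    intro j
    simp only [RA, Matrix.map_apply, Rhat_apply, map_add, apply_ite (algebraMap ℂ A), map_zero]
  simp only [Matrix.mul_apply, h, mul_add, mul_ite, mul_zero, Finset.sum_add_distrib,
    Finset.sum_ite_eq', Finset.mem_univ, if_true, Algebra.smul_def, Algebra.commutes]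

/-- The quantum trace. -/
def qTr (q : ℂ) (X : Matrix (Fin N) (Fin N) A) : A := ∑ i, qWeight N q i • X i i

/-- The quantum trace over the first space. -/
def ptr (q : ℂ) : Matrix (Fin N × Fin N) (Fin N × Fin N) A →ₗ[ℂ] Matrix (Fin N) (Fin N) A where
  toFun Y := Matrix.of fun b d => ∑ a, qWeight N q a • Y (a, b) (a, d)
  map_add' X Y := by
    ext b d
    simp [smul_add, Finset.sum_add_distrib]
  map_smul' c X := by
    ext b d
    simp [Finset.smul_sum, smul_smul, mul_comm]

lemma ptr_apply (Y : Matrix (Fin N × Fin N) (Fin N × Fin N) A) (b d : Fin N) :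
    ptr q Y b d = ∑ a, qWeight N q a • Y (a, b) (a, d) := rfl

lemma ptr_mul_amp (Y : Matrix (Fin N × Fin N) (Fin N × Fin N) A) (X : Matrix (Fin N) (Fin N) A) :
    ptr q (Y * amp (Fin N) X) = ptr q Y * X := by
  ext b d
  simp only [ptr_apply, Matrix.mul_apply, Fintype.sum_prod_type, amp_apply, mul_ite, mul_zero,
    Finset.sum_ite_irrel, Finset.sum_const_zero, Finset.sum_ite_eq', Finset.mem_univ, if_true,
    Finset.smul_sum, Finset.sum_mul, smul_mul_assoc]
  exact Finset.sum_comm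

lemma ptr_amp_mul (X : Matrix (Fin N) (Fin N) A) (Y : Matrix (Fin N × Fin N) (Fin N × Fin N) A) :
    ptr q (amp (Fin N) X * Y) = X * ptr q Y := by
  ext b d
  simp only [ptr_apply, Matrix.mul_apply, Fintype.sum_prod_type, amp_apply, ite_mul, zero_mul,
    Finset.sum_ite_irrel, Finset.sum_const_zero, Finset.sum_ite_eq, Finset.mem_univ, if_true,
    Finset.smul_sum, Finset.mul_sum, mul_smul_comm]
  exact Finset.sum_comm

lemma ptr_RA (hq : q ≠ 0) :
    ptr q (RA N q A) = q ^ (2 * (N : ℤ)) • (1 : Matrix (Fin N) (Fin N) A) := by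
  ext b d
  rw [ptr_apply]
  have h : ∀ a, RA N q A (a, b) (a, d) =
      (if a = b then (if b = d then algebraMap ℂ A q else 0) else 0) +
        (if b = d then algebraMap ℂ A (if a < b then lam q else 0) else 0) := by
    intro a
    rw [RA, Matrix.map_apply, Rhat_apply, map_add]
    by_cases hbd : b = d
    · subst hbd
      by_cases hab : a = b
      · subst hab; simp [swapCoeff, stayCoeff]
      · simp [hab, stayCoeff]
    · by_cases hab : a = b
      · subst hab; simp [hbd]
      · simp only [Prod.mk.injEq, hbd, and_false, if_false, hab, map_zero, add_zero]
        rw [if_neg (fun h => hab h.2.symm), map_zero]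
  simp only [h, smul_add, smul_ite, smul_zero, Finset.sum_add_distrib, Finset.sum_ite_eq',
    Finset.mem_univ, if_true, Finset.sum_ite_irrel, Finset.sum_const_zero, Matrix.smul_apply,
    Matrix.one_apply]
  split_ifs
  · rw [← qWeight_telescope hq b, Finset.mul_sum, add_smul, Finset.sum_smul,
      Algebra.algebraMap_eq_smul_one, smul_smul, mul_comm]
    congr 1
    refine Finset.sum_congr rfl fun a _ => ?_
    split_ifs <;> simp [Algebra.algebraMap_eq_smul_one, smul_smul, mul_comm]
  · simp

lemma ptr_RA_amp_RA (hq : q ≠ 0) (X : Matrix (Fin N) (Fin N) A) :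
    ptr q (RA N q A * amp (Fin N) X * RA N q A) =
      Matrix.diagonal (fun _ => qTr q X) + (lam q * q ^ (2 * (N : ℤ))) • X := by
  ext b d
  rw [ptr_apply, mul_assoc]
  simp only [RA_mul_apply, mul_RA_apply, amp_apply, if_true]
  -- For `a = b = d` the coefficient `q²` is split as `1 + (q² - 1)`; the `1` supplies the missing
  -- summand of `Tr_q X`.
  have h : ∀ a, qWeight N q a • (swapCoeff q a b • (swapCoeff q a d • (if b = d then X a a else 0) +
      stayCoeff q a d • (if b = a then X a d else 0)) +
      stayCoeff q a b • (swapCoeff q a d • (if a = d then X b a else 0) +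
        stayCoeff q a d • X b d)) =
      (if b = d then qWeight N q a • X a a else 0) +
      (if a = b then (if b = d then (qWeight N q b * (q * q - 1)) • X b d else 0) else 0) +
      (if a = b then (qWeight N q b * q * stayCoeff q b d) • X b d else 0) +
      (if a = d then (qWeight N q d * q * stayCoeff q d b) • X b d else 0) +
      (qWeight N q a * (stayCoeff q a b * stayCoeff q a d)) • X b d := by
    intro a
    by_cases hbd : b = d
    · subst hbd
      by_cases hab : a = b
      · subst hab
        simp [swapCoeff, stayCoeff, smul_smul]
        module
      · simp [swapCoeff, hab, Ne.symm hab, smul_smul]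
    · by_cases hab : a = b
      · subst hab
        simp [swapCoeff, stayCoeff, hbd, smul_smul]
        ring_nf
      · by_cases had : a = d
        · subst had
          simp [swapCoeff, stayCoeff, hab, hbd, smul_smul]
          ring_nf
        · simp [hab, Ne.symm hab, had, hbd, smul_smul]
  simp only [h, Finset.sum_add_distrib, Finset.sum_ite_eq', Finset.mem_univ, if_true,
    Finset.sum_ite_irrel, Finset.sum_const_zero, ← Finset.sum_smul]
  rw [Matrix.add_apply, Matrix.smul_apply, ← sum_qWeight_stay hq b d, Matrix.diagonal_apply, qTr]
  simp only [add_smul, ite_smul, zero_smul]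
  abel

lemma ptr_one : ptr q (1 : Matrix (Fin N × Fin N) (Fin N × Fin N) A) =
    (∑ i, qWeight N q i) • (1 : Matrix (Fin N) (Fin N) A) := by
  ext b d
  simp [ptr_apply, Matrix.one_apply, Finset.sum_smul]

lemma ptr_RAinv (hq : q ≠ 0) : ptr q (RAinv N q A) = 1 := by
  have : RAinv N q A = RA N q A - lam q • 1 := by rw [RA_eq hq, add_sub_cancel_right]
  rw [this, map_sub, map_smul, ptr_RA hq, ptr_one, smul_smul, sum_qWeight hq, ← sub_smul,
    sub_sub_cancel, one_smul]

/-- Replacing the right-hand `R̂` by `R̂ - λ` cancels the excess term of `ptr_RA_amp_RA`. This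
invariance turns exchange relations between matrices into relations for quantum traces. -/
lemma ptr_RA_amp_RAinv (hq : q ≠ 0) (X : Matrix (Fin N) (Fin N) A) :
    ptr q (RA N q A * amp (Fin N) X * RAinv N q A) = Matrix.diagonal fun _ => qTr q X := by
  have : RAinv N q A = RA N q A - lam q • 1 := by rw [RA_eq hq, add_sub_cancel_right]
  rw [this, mul_sub, map_sub, mul_smul_comm, mul_one, map_smul, ptr_RA_amp_RA hq, ptr_mul_amp,
    ptr_RA hq, smul_mul_assoc, one_mul, smul_smul, add_sub_cancel_right]

lemma ptr_RAinv_amp_RA (hq : q ≠ 0) (X : Matrix (Fin N) (Fin N) A) :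
    ptr q (RAinv N q A * amp (Fin N) X * RA N q A) = Matrix.diagonal fun _ => qTr q X := by
  have : RAinv N q A = RA N q A - lam q • 1 := by rw [RA_eq hq, add_sub_cancel_right]
  rw [this, sub_mul, sub_mul, map_sub, smul_mul_assoc, one_mul, smul_mul_assoc, map_smul,
    ptr_RA_amp_RA hq, ptr_amp_mul, ptr_RA hq, mul_smul_comm, mul_one, smul_smul,
    add_sub_cancel_right]

lemma ptr_RAinv_amp_RAinv (hq : q ≠ 0) (X : Matrix (Fin N) (Fin N) A) :
    ptr q (RAinv N q A * amp (Fin N) X * RAinv N q A) =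
      Matrix.diagonal (fun _ => qTr q X) - lam q • X := by
  have : RAinv N q A = RA N q A - lam q • 1 := by rw [RA_eq hq, add_sub_cancel_right]
  conv_lhs => rw [this, mul_sub, ← this, map_sub, mul_smul_comm, mul_one, map_smul,
    ptr_RAinv_amp_RA hq, ptr_mul_amp, ptr_RAinv hq, one_mul]

/-- `X ⊗ 1`. -/
def ampLeft (X : Matrix (Fin N) (Fin N) A) : Matrix (Fin N × Fin N) (Fin N × Fin N) A :=
  Matrix.of fun i j => if i.2 = j.2 then X i.1 j.1 else 0

lemma ampLeft_mul_amp_apply (X Y : Matrix (Fin N) (Fin N) A) (i j : Fin N × Fin N) :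
    (ampLeft X * amp (Fin N) Y) i j = X i.1 j.1 * Y i.2 j.2 := by
  rw [Matrix.mul_apply, Finset.sum_eq_single (j.1, i.2)]
  · simp [ampLeft]
  · rintro ⟨c, d⟩ _ h
    by_cases h1 : i.2 = d
    · by_cases h2 : c = j.1
      · exact absurd (by rw [h1, h2]) h
      · simp [h2]
    · simp [ampLeft, h1]
  · simp

lemma ptr_ampLeft_mul_amp (X Y : Matrix (Fin N) (Fin N) A) :
    ptr q (ampLeft X * amp (Fin N) Y) = Matrix.diagonal (fun _ => qTr q X) * Y := by
  ext b d
  simp [ptr_apply, ampLeft_mul_amp_apply, Matrix.diagonal_mul, qTr, Finset.sum_mul]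

lemma ampLeft_mul (X Y : Matrix (Fin N) (Fin N) A) :
    ampLeft (X * Y) = ampLeft X * ampLeft Y := by
  ext ⟨a, b⟩ ⟨c, d⟩
  simp [ampLeft, Matrix.mul_apply, Fintype.sum_prod_type, Finset.sum_ite_irrel]

lemma ampLeft_one : ampLeft (1 : Matrix (Fin N) (Fin N) A) = 1 := by
  ext ⟨a, b⟩ ⟨c, d⟩
  simp only [ampLeft, Matrix.of_apply, Matrix.one_apply, Prod.mk.injEq]
  by_cases h : b = d <;> simp [h]

lemma ampLeft_add_smul (c : ℂ) (X : Matrix (Fin N) (Fin N) A) :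
    ampLeft (1 + c • X) = 1 + c • ampLeft X := by
  rw [← ampLeft_one]
  ext ⟨a, b⟩ ⟨c, d⟩
  simp only [ampLeft, Matrix.of_apply, Matrix.add_apply, Matrix.smul_apply]
  split_ifs <;> simp

end PartialTrace

end QuantumGL

namespace QuantumGL

/-! ### Quantum traces of operator matrices and the formula for the Laplace operator -/

section DiffOps

variable {N : ℕ} {q : ℂ} {A : Type*} [Ring A] [Algebra ℂ A]

/-- Matrices over an algebra that satisfy the relations of the differential algebra over `GL_q(N)`
(those between the entries of `T` excepted). -/
structure DiffOps (N : ℕ) (q : ℂ) {A : Type*} [Ring A] [Algebra ℂ A]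
    (T w L K J : Matrix (Fin N) (Fin N) A) : Prop where
  ww : amp (Fin N) w * RAinv N q A * amp (Fin N) w * RA N q A =
    -(RAinv N q A * amp (Fin N) w * RAinv N q A * amp (Fin N) w)
  wl : amp (Fin N) w * RA N q A * amp (Fin N) L * RA N q A =
    RA N q A * amp (Fin N) L * RA N q A * amp (Fin N) w
  wj : amp (Fin N) w * RA N q A * amp (Fin N) J * RA N q A +
    RA N q A * amp (Fin N) J * RA N q A * amp (Fin N) w = -RA N q A
  ll : amp (Fin N) L * RA N q A * amp (Fin N) L * RA N q A =
    RA N q A * amp (Fin N) L * RA N q A * amp (Fin N) L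
  jl : amp (Fin N) J * RA N q A * amp (Fin N) L * RA N q A =
    RA N q A * amp (Fin N) L * RA N q A * amp (Fin N) J
  jj : amp (Fin N) J * RA N q A * amp (Fin N) J * RA N q A =
    -(RAinv N q A * amp (Fin N) J * RA N q A * amp (Fin N) J)
  wt : ampLeft w * amp (Fin N) T = amp (Fin N) T * RAinv N q A * amp (Fin N) w * RAinv N q A
  jt : ampLeft J * amp (Fin N) T = amp (Fin N) T * RA N q A * amp (Fin N) J * RA N q A
  lt : ampLeft L * amp (Fin N) T = amp (Fin N) T * RA N q A * amp (Fin N) L * RA N q A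
  lk : L * K = 1
  kl : K * L = 1

lemma qTr_smul (c : ℂ) (X : Matrix (Fin N) (Fin N) A) : qTr q (c • X) = c • qTr q X := by
  simp [qTr, Finset.smul_sum, smul_smul, mul_comm]

lemma qTr_neg (X : Matrix (Fin N) (Fin N) A) : qTr q (-X) = -qTr q X := by
  simp [qTr]

lemma qTr_one : qTr q (1 : Matrix (Fin N) (Fin N) A) = (∑ i, qWeight N q i) • (1 : A) := by
  simp [qTr, Finset.sum_smul]

lemma qTr_anticommutator {x : A} {X Y : Matrix (Fin N) (Fin N) A}
    (h : X * Matrix.diagonal (fun _ => x) + Matrix.diagonal (fun _ => x) * X = Y) :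
    qTr q X * x + x * qTr q X = qTr q Y := by
  rw [← h, qTr, qTr, Finset.sum_mul, Finset.mul_sum, ← Finset.sum_add_distrib]
  exact Finset.sum_congr rfl fun i _ => by simp

/-- `U = 1 + λ ω J`. -/
def uMat (q : ℂ) (w J : Matrix (Fin N) (Fin N) A) : Matrix (Fin N) (Fin N) A :=
  1 + lam q • (w * J)

/-- `Y = U L⁻¹ (1 + λ J ω)`. -/
def yMat (q : ℂ) (w K J : Matrix (Fin N) (Fin N) A) : Matrix (Fin N) (Fin N) A :=
  uMat q w J * (K * uMat q J w)

lemma amp_uMat (w J : Matrix (Fin N) (Fin N) A) :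
    amp (Fin N) (uMat q w J) = 1 + lam q • (amp (Fin N) w * amp (Fin N) J) := by
  simp [uMat]

variable {T w L K J Ui : Matrix (Fin N) (Fin N) A}

lemma amp_mul_eq_one {X Y : Matrix (Fin N) (Fin N) A} (h : X * Y = 1) :
    amp (Fin N) X * amp (Fin N) Y = 1 := by
  rw [← map_mul, h, map_one]

namespace DiffOps

lemma u_w (h : DiffOps N q T w L K J) (hq : q ≠ 0) :
    RA N q A * amp (Fin N) (uMat q w J) * RA N q A * amp (Fin N) w =
      amp (Fin N) w * RAinv N q A * amp (Fin N) (uMat q w J) * RA N q A := by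
  rw [amp_uMat]
  exact rel_u_w (RA_mul_inv hq) (RA_inv_mul hq) (RA_eq hq) h.ww h.wj

lemma u_j (h : DiffOps N q T w L K J) (hq : q ≠ 0) :
    amp (Fin N) J * RA N q A * amp (Fin N) (uMat q w J) * RA N q A =
      RAinv N q A * amp (Fin N) (uMat q w J) * RA N q A * amp (Fin N) J := by
  rw [amp_uMat]
  exact rel_u_j (RA_mul_inv hq) (RA_inv_mul hq) (RA_eq hq) h.jj h.wj

lemma u'_w (h : DiffOps N q T w L K J) (hq : q ≠ 0) :
    RA N q A * amp (Fin N) (uMat q J w) * RAinv N q A * amp (Fin N) w =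
      amp (Fin N) w * RA N q A * amp (Fin N) (uMat q J w) * RA N q A := by
  rw [amp_uMat]
  exact rel_u'_w (RA_mul_inv hq) (RA_inv_mul hq) (RA_eq hq) h.ww h.wj

lemma n_w (h : DiffOps N q T w L K J) (hq : q ≠ 0) :
    RAinv N q A * amp (Fin N) (K * uMat q J w) * RAinv N q A * amp (Fin N) w =
      amp (Fin N) w * RAinv N q A * amp (Fin N) (K * uMat q J w) * RA N q A := by
  rw [map_mul]
  exact rel_n_w (RA_mul_inv hq) (RA_inv_mul hq) (amp_mul_eq_one h.lk) (amp_mul_eq_one h.kl) h.wl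
    (h.u'_w hq)

lemma y_w (h : DiffOps N q T w L K J) (hq : q ≠ 0) :
    RA N q A * amp (Fin N) (yMat q w K J) * RAinv N q A * amp (Fin N) w =
      amp (Fin N) w * RAinv N q A * amp (Fin N) (yMat q w K J) * RA N q A := by
  rw [yMat, map_mul]
  exact rel_y_w (RA_mul_inv hq) (h.u_w hq) (h.n_w hq)

/-- `Tr_q Y` commutes with `ω`. -/
lemma qTr_y_w (h : DiffOps N q T w L K J) (hq : q ≠ 0) :
    Matrix.diagonal (fun _ => qTr q (yMat q w K J)) * w =
      w * Matrix.diagonal (fun _ => qTr q (yMat q w K J)) := by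
  have := congrArg (ptr q) (h.y_w hq)
  rwa [ptr_mul_amp, ptr_RA_amp_RAinv hq, mul_assoc, mul_assoc, ptr_amp_mul, ← mul_assoc,
    ptr_RAinv_amp_RA hq] at this

/-- `ω`, `J` and `L⁻¹` in the second space each commute with `R̂ L₂ R̂`, and `Y` is a polynomial in
them. -/
lemma commute_l (h : DiffOps N q T w L K J) :
    amp (Fin N) (yMat q w K J) * (RA N q A * amp (Fin N) L * RA N q A) =
      RA N q A * amp (Fin N) L * RA N q A * amp (Fin N) (yMat q w K J) := by
  have hw : Commute (amp (Fin N) w) (RA N q A * amp (Fin N) L * RA N q A) := by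
    rw [Commute, SemiconjBy, ← h.wl]; noncomm_ring
  have hj : Commute (amp (Fin N) J) (RA N q A * amp (Fin N) L * RA N q A) := by
    rw [Commute, SemiconjBy, ← h.jl]; noncomm_ring
  have hl : Commute (RA N q A * amp (Fin N) L * RA N q A) (amp (Fin N) L) := by
    rw [Commute, SemiconjBy, ← h.ll]; noncomm_ring
  have hk : Commute (RA N q A * amp (Fin N) L * RA N q A) (amp (Fin N) K) :=
    commute_inverse (amp_mul_eq_one h.lk) (amp_mul_eq_one h.kl) hl
  rw [yMat, map_mul, map_mul, amp_uMat, amp_uMat]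
  exact (((Commute.one_left _).add_left ((hw.mul_left hj).smul_left _)).mul_left
    (hk.symm.mul_left ((Commute.one_left _).add_left ((hj.mul_left hw).smul_left _)))).eq

/-- `Tr_q Y` commutes with `L`. -/
lemma qTr_y_l (h : DiffOps N q T w L K J) (hq : q ≠ 0) :
    L * Matrix.diagonal (fun _ => qTr q (yMat q w K J)) =
      Matrix.diagonal (fun _ => qTr q (yMat q w K J)) * L := by
  have := congrArg (ptr q) (rel_l_y (RA_mul_inv hq) (RA_inv_mul hq) h.commute_l)
  rwa [ptr_mul_amp, ptr_RAinv_amp_RA hq, mul_assoc, mul_assoc, ptr_amp_mul, ← mul_assoc,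
    ptr_RA_amp_RAinv hq] at this

lemma u_t (h : DiffOps N q T w L K J) (hq : q ≠ 0) :
    ampLeft (uMat q w J) * amp (Fin N) T =
      amp (Fin N) T * RAinv N q A * amp (Fin N) (uMat q w J) * RA N q A := by
  rw [amp_uMat, uMat, ampLeft_add_smul, ampLeft_mul]
  exact rel_u_t (RA_inv_mul hq) h.wt h.jt

lemma y_t (h : DiffOps N q T w L K J) (hq : q ≠ 0) :
    ampLeft (yMat q w K J) * amp (Fin N) T =
      amp (Fin N) T * RAinv N q A * amp (Fin N) (yMat q w K J) * RAinv N q A := by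
  have hu : ampLeft (uMat q J w) * amp (Fin N) T =
      amp (Fin N) T * RA N q A * amp (Fin N) (uMat q J w) * RAinv N q A := by
    rw [amp_uMat, uMat, ampLeft_add_smul, ampLeft_mul]
    exact rel_u'_t (RA_mul_inv hq) h.wt h.jt
  have hk : ampLeft K * amp (Fin N) T =
      amp (Fin N) T * RAinv N q A * amp (Fin N) K * RAinv N q A :=
    rel_k_t (RA_mul_inv hq) (amp_mul_eq_one h.lk) (by rw [← ampLeft_mul, h.kl, ampLeft_one]) h.lt
  rw [yMat, map_mul, ampLeft_mul]
  refine rel_y_t (RA_mul_inv hq) (h.u_t hq) ?_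
  rw [map_mul, ampLeft_mul]
  exact rel_n_t (RA_inv_mul hq) hk hu

/-- With `R̂⁻¹` on both sides the partial trace keeps the term `-λ Y`. It is the increment by which
`Tr_q Y` changes when a letter `T` is added. -/
lemma qTr_y_t (h : DiffOps N q T w L K J) (hq : q ≠ 0) :
    Matrix.diagonal (fun _ => qTr q (yMat q w K J)) * T =
      T * (Matrix.diagonal (fun _ => qTr q (yMat q w K J)) - lam q • yMat q w K J) := by
  have := congrArg (ptr q) (h.y_t hq)
  rwa [ptr_ampLeft_mul_amp, mul_assoc, mul_assoc, ptr_amp_mul, ← mul_assoc,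
    ptr_RAinv_amp_RAinv hq] at this

/-- `Tr_q ω` is a conjugate of `J`. -/
lemma w_j (h : DiffOps N q T w L K J) (hq : q ≠ 0) :
    J * Matrix.diagonal (fun _ => qTr q w) + Matrix.diagonal (fun _ => qTr q w) * J = -1 := by
  have := congrArg (ptr q) (rel_w_j (RA_mul_inv hq) (RA_inv_mul hq) h.wj)
  rwa [map_add, ptr_mul_amp, ptr_RAinv_amp_RA hq, mul_assoc, mul_assoc, ptr_amp_mul, ← mul_assoc,
    ptr_RA_amp_RAinv hq, map_neg, ptr_RAinv hq, add_comm] at this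

/-- Let `n = L⁻¹ (1 + λ J ω)` and `M = J n`. The partial trace of `R̂ M₂ R̂` exceeds `Tr_q M` by a
multiple of `M`, and this excess completes `n` to `(1 + λ ω J) n = Y`. -/
lemma m_w (h : DiffOps N q T w L K J) (hq : q ≠ 0) :
    w * Matrix.diagonal (fun _ => qTr q (J * (K * uMat q J w))) +
      Matrix.diagonal (fun _ => qTr q (J * (K * uMat q J w))) * w =
        -(q ^ (2 * (N : ℤ)) • yMat q w K J) := by
  have := congrArg (ptr q) (rel_m_w (RA_mul_inv hq) h.wj (h.n_w hq))
  rw [map_add, ptr_mul_amp, ← map_mul, ptr_RA_amp_RAinv hq, mul_assoc (amp (Fin N) w),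
    mul_assoc (amp (Fin N) w), ptr_amp_mul, ← mul_assoc, ptr_RA_amp_RA hq, map_neg, ptr_amp_mul,
    ptr_RA hq, mul_smul_comm, mul_one, mul_add, mul_smul_comm] at this
  have e : yMat q w K J = K * uMat q J w + lam q • (w * (J * K * uMat q J w)) := by
    rw [yMat, uMat, add_mul, one_mul, smul_mul_assoc, mul_assoc w J, ← mul_assoc J K]
  rw [e, smul_add, neg_add, ← this, smul_smul, mul_comm (q ^ (2 * (N : ℤ))), ← mul_assoc J K]
  abel

lemma wv_l (h : DiffOps N q T w L K J) (hq : q ≠ 0) (hu : uMat q w J * Ui = 1)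
    (hu' : Ui * uMat q w J = 1) :
    L * Matrix.diagonal (fun _ => qTr q (w * (L * Ui))) =
      Matrix.diagonal (fun _ => qTr q (w * (L * Ui))) * L := by
  have hw : Commute (amp (Fin N) w) (RA N q A * amp (Fin N) L * RA N q A) := by
    rw [Commute, SemiconjBy, ← h.wl]; noncomm_ring
  have hj : Commute (amp (Fin N) J) (RA N q A * amp (Fin N) L * RA N q A) := by
    rw [Commute, SemiconjBy, ← h.jl]; noncomm_ring
  have huc : Commute (amp (Fin N) (uMat q w J)) (RA N q A * amp (Fin N) L * RA N q A) := by
    rw [amp_uMat]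
    exact (Commute.one_left _).add_left ((hw.mul_left hj).smul_left _)
  have hui := commute_inverse (amp_mul_eq_one hu) (amp_mul_eq_one hu') huc.symm
  have := congrArg (ptr q) (rel_l_wv (RA_mul_inv hq) (RA_inv_mul hq) h.wl h.ll hui.symm)
  rwa [← map_mul, ← map_mul, ptr_mul_amp, ptr_RAinv_amp_RA hq, mul_assoc, mul_assoc, ptr_amp_mul,
    ← mul_assoc, ptr_RA_amp_RAinv hq] at this

lemma wv_w (h : DiffOps N q T w L K J) (hq : q ≠ 0) (hu : uMat q w J * Ui = 1)
    (hu' : Ui * uMat q w J = 1) :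
    w * Matrix.diagonal (fun _ => qTr q (w * (L * Ui))) =
      -(Matrix.diagonal (fun _ => qTr q (w * (L * Ui))) * w) := by
  have hv := rel_v_w (RA_mul_inv hq) (RA_inv_mul hq) (amp_mul_eq_one hu) (amp_mul_eq_one hu')
    (h.u_w hq) h.wl
  have := congrArg (ptr q) (rel_w_wv (RA_mul_inv hq) (RA_inv_mul hq) h.ww hv)
  rwa [← map_mul, ← map_mul, map_neg, ptr_mul_amp, ptr_RA_amp_RAinv hq, mul_assoc, mul_assoc,
    ptr_amp_mul, ← mul_assoc, ptr_RAinv_amp_RA hq] at this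

lemma wv_j (h : DiffOps N q T w L K J) (hq : q ≠ 0) (hu : uMat q w J * Ui = 1)
    (hu' : Ui * uMat q w J = 1) :
    J * Matrix.diagonal (fun _ => qTr q (w * (L * Ui))) +
      Matrix.diagonal (fun _ => qTr q (w * (L * Ui))) * J = -L := by
  have hv := rel_v_w (RA_mul_inv hq) (RA_inv_mul hq) (amp_mul_eq_one hu) (amp_mul_eq_one hu')
    (h.u_w hq) h.wl
  have hj := rel_j_v (RA_mul_inv hq) (RA_inv_mul hq) (amp_mul_eq_one hu) (amp_mul_eq_one hu')
    (h.u_j hq) h.jl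
  have := congrArg (ptr q) (rel_j_wv (RA_mul_inv hq) (RA_inv_mul hq) (RA_eq hq) h.wj hj hv)
  rw [← amp_uMat, ← map_mul, ← map_mul, map_sub, map_neg, ptr_mul_amp, ptr_mul_amp, ptr_amp_mul,
    ptr_RAinv hq, mul_one, ptr_RAinv_amp_RA hq, mul_assoc, mul_assoc, ptr_amp_mul, ← mul_assoc,
    ptr_RA_amp_RAinv hq, mul_assoc L, hu', mul_one] at this
  rw [this, sub_add_cancel]

/-- The Laplace operator is a linear combination of `Tr_q L`, `Tr_q Y` and `1`. -/
lemma laplacian (h : DiffOps N q T w L K J) (hq : q ≠ 0) (hu : uMat q w J * Ui = 1)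
    (hu' : Ui * uMat q w J = 1) :
    (qTr q (w * (L * Ui)) - qTr q w) * (qTr q (J * (K * uMat q J w)) - qTr q J) +
      (qTr q (J * (K * uMat q J w)) - qTr q J) * (qTr q (w * (L * Ui)) - qTr q w) =
    qTr q L + q ^ (2 * (N : ℤ)) • qTr q (yMat q w K J) -
      (2 * ∑ i, qWeight N q i) • (1 : A) := by
  have h1 := qTr_anticommutator (q := q) (h.wv_j hq hu hu')
  have h2 := qTr_anticommutator (q := q) (h.w_j hq)
  have h3 := qTr_anticommutator (q := q) (h.m_w hq)
  -- The trace `D = Tr_q (ω L U⁻¹)` commutes with `L`, anticommutes with `ω` and has anticommutator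
  -- `-L` with `J`. Moving it through `J L⁻¹ (1 + λ J ω)` therefore leaves only `-1`.
  have h4 : qTr q (J * (K * uMat q J w)) * qTr q (w * (L * Ui)) +
      qTr q (w * (L * Ui)) * qTr q (J * (K * uMat q J w)) =
        qTr q (-1 : Matrix (Fin N) (Fin N) A) := by
    apply qTr_anticommutator
    have hJ := h.wv_j hq hu hu'
    have hL := h.wv_l hq hu hu'
    have hw := h.wv_w hq hu hu'
    generalize Matrix.diagonal (fun _ : Fin N => qTr q (w * (L * Ui))) = D at *
    have hK : K * D = D * K := (commute_inverse h.lk h.kl hL.symm).symm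
    have hJ' : D * J = -L - J * D := by rw [← hJ]; abel
    have hU : uMat q J w * D = D * uMat q J w + lam q • (L * w) := by
      have : J * w * D = D * (J * w) + L * w := by
        calc J * w * D = -(J * D * w) := by rw [mul_assoc, hw]; noncomm_ring
          _ = (-L - J * D) * w + L * w := by noncomm_ring
          _ = _ := by rw [← hJ']; noncomm_ring
      rw [uMat, add_mul, smul_mul_assoc, this, smul_add, mul_add, mul_smul_comm, one_mul, mul_one,
        add_assoc]
    calc J * (K * uMat q J w) * D + D * (J * (K * uMat q J w))
        = J * K * (uMat q J w * D) + (D * J) * (K * uMat q J w) := by noncomm_ring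
      _ = J * (K * D) * uMat q J w + lam q • (J * (K * L) * w) - (L * K) * uMat q J w
            - J * (D * K) * uMat q J w := by
          rw [hU, hJ', mul_add, mul_smul_comm]; noncomm_ring
      _ = lam q • (J * w) - uMat q J w := by rw [hK, h.lk, h.kl]; noncomm_ring
      _ = -1 := by rw [uMat]; abel
  rw [qTr_neg] at h1 h2 h3 h4
  rw [qTr_smul] at h3
  rw [qTr_one] at h2 h4
  generalize qTr q (w * (L * Ui)) = a at *
  generalize qTr q (J * (K * uMat q J w)) = b at *
  calc _ = (b * a + a * b) - (qTr q J * a + a * qTr q J) - (qTr q w * b + b * qTr q w) +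
        (qTr q J * qTr q w + qTr q w * qTr q J) := by noncomm_ring
    _ = _ := by rw [h1, h2, h3, h4, mul_smul, two_smul]; abel

end DiffOps

end DiffOps

end QuantumGL

namespace QuantumGL

/-! ### Braid operators on functions of words -/

section Lists

variable {ι : Type*} [LinearOrder ι] {M : Type*} [AddCommGroup M] [Module ℂ M]

/-- `R̂` acting on the first two letters of a word. -/
def listBraid (q : ℂ) (f : List ι → M) : List ι → M
  | a :: b :: l => swapCoeff q a b • f (b :: a :: l) + stayCoeff q a b • f (a :: b :: l)
  | l => f l

/-- An operator acting behind the first letter. -/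
def behind (X : (List ι → M) → List ι → M) (f : List ι → M) : List ι → M
  | [] => f []
  | a :: l => X (fun u => f (a :: u)) l

/-- Right multiplication by `R̂₁ R̂₂ ⋯ R̂ₙ`. -/
def descend (q : ℂ) : ℕ → (List ι → M) → List ι → M
  | 0, f => f
  | n + 1, f => behind (descend q n) (listBraid q f)

/-- Right multiplication by `R̂ₙ ⋯ R̂₂ R̂₁`. -/
def ascend (q : ℂ) : ℕ → (List ι → M) → List ι → M
  | 0, f => f
  | n + 1, f => listBraid q (behind (ascend q n) f)

lemma descend_succ_cons (q : ℂ) (n : ℕ) (f : List ι → M) (a : ι) (l : List ι) :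
    descend q (n + 1) f (a :: l) = descend q n (fun u => listBraid q f (a :: u)) l := rfl

lemma ascend_succ_cons (q : ℂ) (n : ℕ) (f : List ι → M) (a b : ι) (l : List ι) :
    ascend q (n + 1) f (a :: b :: l) =
      swapCoeff q a b • ascend q n (fun u => f (b :: u)) (a :: l) +
        stayCoeff q a b • ascend q n (fun u => f (a :: u)) (b :: l) := rfl

lemma listBraid_cons_cons (q : ℂ) (f : List ι → M) (a b : ι) (l : List ι) :
    listBraid q f (a :: b :: l) =
      swapCoeff q a b • f (b :: a :: l) + stayCoeff q a b • f (a :: b :: l) := rfl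

lemma listBraid_congr {q : ℂ} {f g : List ι → M} {l : List ι}
    (h : ∀ u : List ι, u.length = l.length → f u = g u) : listBraid q f l = listBraid q g l := by
  match l with
  | [] => exact h _ rfl
  | [a] => exact h _ rfl
  | a :: b :: l => rw [listBraid_cons_cons, listBraid_cons_cons, h (b :: a :: l) (by simp),
    h (a :: b :: l) rfl]

lemma descend_congr {q : ℂ} {n : ℕ} {f g : List ι → M} {l : List ι}
    (h : ∀ u : List ι, u.length = l.length → f u = g u) : descend q n f l = descend q n g l := by
  induction n generalizing f g l with
  | zero => exact h _ rfl
  | succ n ih =>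
    match l with
    | [] => exact h _ rfl
    | a :: l =>
      rw [descend_succ_cons, descend_succ_cons]
      exact ih fun u hu => listBraid_congr fun v hv => h v (by simp [hv, hu])

lemma ascend_congr {q : ℂ} {n : ℕ} {f g : List ι → M} {l : List ι}
    (h : ∀ u : List ι, u.length = l.length → f u = g u) : ascend q n f l = ascend q n g l := by
  induction n generalizing f g l with
  | zero => exact h _ rfl
  | succ n ih =>
    refine listBraid_congr fun v hv => ?_
    match v with
    | [] => exact h _ hv
    | a :: v => exact ih fun u hu => h _ (by simp [← hv, hu])

/-- Naturality with respect to linear combinations. -/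
lemma listBraid_sum {q : ℂ} {κ : Type*} (s : Finset κ) (g : κ → List ι → ℂ) (x : κ → M)
    (l : List ι) : listBraid q (fun u => ∑ b ∈ s, g b u • x b) l =
      ∑ b ∈ s, listBraid q (g b) l • x b := by
  match l with
  | [] => rfl
  | [a] => rfl
  | a :: b :: l =>
    simp only [listBraid_cons_cons, Finset.smul_sum, ← Finset.sum_add_distrib, add_smul,
      smul_eq_mul, mul_smul]

lemma descend_sum {q : ℂ} {κ : Type*} (s : Finset κ) (n : ℕ) (g : κ → List ι → ℂ) (x : κ → M)
    (l : List ι) : descend q n (fun u => ∑ b ∈ s, g b u • x b) l =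
      ∑ b ∈ s, descend q n (g b) l • x b := by
  induction n generalizing g l with
  | zero => rfl
  | succ n ih =>
    match l with
    | [] => exact listBraid_sum (q := q) s g x []
    | a :: l =>
      simp only [descend_succ_cons, listBraid_sum]
      exact ih _ _

lemma ascend_sum {q : ℂ} {κ : Type*} (s : Finset κ) (n : ℕ) (g : κ → List ι → ℂ) (x : κ → M)
    (l : List ι) : ascend q n (fun u => ∑ b ∈ s, g b u • x b) l =
      ∑ b ∈ s, ascend q n (g b) l • x b := by
  induction n generalizing g l with
  | zero => rfl
  | succ n ih =>
    match l with
    | [] => rfl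
    | [a] => exact ih _ []
    | a :: b :: l =>
      simp only [ascend_succ_cons, ih, Finset.smul_sum, ← Finset.sum_add_distrib, add_smul,
        smul_eq_mul, mul_smul]

lemma descend_append {q : ℂ} {n : ℕ} (f : List ι → M) (t l : List ι) (hl : n < l.length) :
    descend q n (fun u => f (u ++ t)) l = descend q n f (l ++ t) := by
  induction n generalizing f l with
  | zero => rfl
  | succ n ih =>
    match l with
    | a :: l =>
      simp only [List.length_cons, add_lt_add_iff_right] at hl
      rw [List.cons_append, descend_succ_cons, descend_succ_cons,
        ← ih (fun u => listBraid q f (a :: u)) l hl]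
      refine descend_congr fun u hu => ?_
      match u with
      | [] => simp at hu; omega
      | b :: u => rfl

/-- The last step of `descend`. -/
lemma descend_succ_append {q : ℂ} {n : ℕ} (f : List ι → M) (l s : List ι) (a b : ι)
    (hl : l.length = n) : descend q (n + 1) f (l ++ a :: b :: s) =
      swapCoeff q a b • descend q n f (l ++ b :: a :: s) +
        stayCoeff q a b • descend q n f (l ++ a :: b :: s) := by
  subst hl
  induction l generalizing f with
  | nil => rfl
  | cons c l ih =>
    rw [List.cons_append, List.length_cons, descend_succ_cons, ih]
    rfl

/-- The first `n` letters are `q`-antisymmetric, on words of length `n + k`. -/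
def QAntisymm (q : ℂ) : ℕ → ℕ → (List ι → ℂ) → Prop
  | 0, _, _ => True
  | 1, _, _ => True
  | n + 2, k, f => (∀ (a b : ι) (l : List ι), l.length = n + k →
      listBraid q f (a :: b :: l) = -q⁻¹ * f (a :: b :: l)) ∧
        ∀ a, QAntisymm q (n + 1) k (fun u => f (a :: u))

namespace QAntisymm

variable {q : ℂ} {n k : ℕ} {f g : List ι → ℂ}

lemma tail (h : QAntisymm q (n + 1) k f) (a : ι) : QAntisymm q n k (fun u => f (a :: u)) := by
  match n with
  | 0 => trivial
  | n + 1 => exact h.2 a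

lemma linear (hf : QAntisymm q n k f) (hg : QAntisymm q n k g) (c d : ℂ) :
    QAntisymm q n k (fun u => c * f u + d * g u) := by
  induction n generalizing f g with
  | zero => trivial
  | succ n ih =>
    cases n with
    | zero => trivial
    | succ n =>
      refine ⟨fun a b l hl => ?_, fun a => ih (hf.2 a) (hg.2 a)⟩
      have h1 := hf.1 a b l hl
      have h2 := hg.1 a b l hl
      simp only [listBraid_cons_cons, smul_eq_mul] at h1 h2 ⊢
      linear_combination c * h1 + d * h2

lemma append (hf : QAntisymm q n (k + 1) f) (x : ι) :
    QAntisymm q n k (fun u => f (u ++ [x])) := by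
  induction n generalizing f with
  | zero => trivial
  | succ n ih =>
    cases n with
    | zero => trivial
    | succ n =>
      exact ⟨fun a b l hl => hf.1 a b (l ++ [x]) (by simp [hl]; omega), fun a => ih (hf.2 a)⟩

end QAntisymm

lemma listBraid_braid {q : ℂ} (hq : q ≠ 0) [Fintype ι] (φ : ι → ι → ι → ℂ) :
    let G1 : (ι → ι → ι → ℂ) → ι → ι → ι → ℂ := fun φ a b c =>
      swapCoeff q a b * φ b a c + stayCoeff q a b * φ a b c
    let G2 : (ι → ι → ι → ℂ) → ι → ι → ι → ℂ := fun φ a b c =>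
      swapCoeff q b c * φ a c b + stayCoeff q b c * φ a b c
    ∀ a b c, G1 (G2 (G1 φ)) a b c = G2 (G1 (G2 φ)) a b c := by
  intro G1 G2 a b c
  have := congrFun (congrArg (fun X => X.mulVec fun i : ι × ι × ι × Unit => φ i.1 i.2.1 i.2.2.1)
    (braid_braid (ι := ι) (τ := Unit) hq)) (a, b, c, ())
  simpa only [← Matrix.mulVec_mulVec, braid_mulVec, amp_mulVec] using this

/-- The braid relation gives `(R̂₁ ⋯ R̂ₙ) R̂ᵢ = R̂ᵢ₊₁ (R̂₁ ⋯ R̂ₙ)` for `i < n`, so antisymmetry in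
the letters `2, …, n + 1` becomes antisymmetry in the first `n`. Only `i = 1` needs the braid
relation directly; the other positions are the induction. -/
lemma QAntisymm.descend [Fintype ι] {q : ℂ} (hq : q ≠ 0) {n : ℕ} {f : List ι → ℂ}
    (h : ∀ a, QAntisymm q n 0 (fun u => f (a :: u))) : QAntisymm q n 1 (descend q n f) := by
  induction n generalizing f with
  | zero => trivial
  | succ m ih =>
    have hs : ∀ a, QAntisymm q m 1 (fun u => QuantumGL.descend q (m + 1) f (a :: u)) := fun a => by
      simp only [descend_succ_cons]
      refine ih fun b => ?_
      simp only [listBraid_cons_cons, smul_eq_mul]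
      exact ((h b).tail a).linear ((h a).tail b) _ _
    cases m with
    | zero => trivial
    | succ m =>
      refine ⟨fun a b l hl => ?_, hs⟩
      have key : ∀ a b l, QuantumGL.descend q (m + 2) f (a :: b :: l) = QuantumGL.descend q m
        (fun u => listBraid q (fun v => listBraid q f (a :: v)) (b :: u)) l := fun _ _ _ => rfl
      rw [listBraid_cons_cons, key, key, smul_eq_mul, smul_eq_mul]
      -- Sums over `Fin 2` and `Fin 1` present the two sides as linear combinations, which
      -- naturality moves inside `descend`.
      have lin := descend_sum (q := q) (Finset.univ : Finset (Fin 2)) m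
        ![fun u => listBraid q (fun v => listBraid q f (b :: v)) (a :: u),
          fun u => listBraid q (fun v => listBraid q f (a :: v)) (b :: u)]
        ![swapCoeff q a b, stayCoeff q a b] l
      have lin2 := descend_sum (q := q) (Finset.univ : Finset (Fin 1)) m
        ![fun u => listBraid q (fun v => listBraid q f (a :: v)) (b :: u)] ![-q⁻¹] l
      simp only [Fin.sum_univ_two, Fin.sum_univ_one, Matrix.cons_val_zero, Matrix.cons_val_one,
        smul_eq_mul] at lin lin2
      rw [mul_comm (swapCoeff q a b), mul_comm (stayCoeff q a b), mul_comm (-q⁻¹), ← lin, ← lin2]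
      refine descend_congr fun u hu => ?_
      match u with
      | [] => simp at hu; omega
      | c :: u =>
        have hu' : u.length = m := by simp at hu; omega
        have hb := listBraid_braid hq (fun a b c => f (a :: b :: c :: u)) a b c
        have ha := fun a b c => (h a).1 b c u (by simpa using hu')
        simp only [listBraid_cons_cons, smul_eq_mul] at hb ha ⊢
        simp only [ha] at hb
        linear_combination hb

/-- The mirror image: `(R̂ₙ ⋯ R̂₁) R̂ᵢ₊₁ = R̂ᵢ (R̂ₙ ⋯ R̂₁)` moves the antisymmetric block back
behind the first letter. -/
lemma QAntisymm.ascend [Fintype ι] {q : ℂ} (hq : q ≠ 0) {n : ℕ} {f : List ι → ℂ}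
    (h : QAntisymm q n 1 f) (a : ι) : QAntisymm q n 0 (fun u => ascend q n f (a :: u)) := by
  induction n generalizing f a with
  | zero => trivial
  | succ m ih =>
    have hs : ∀ b, QAntisymm q m 0 (fun u => QuantumGL.ascend q (m + 1) f (a :: b :: u)) :=
      fun b => by
        simp only [ascend_succ_cons, smul_eq_mul]
        exact (ih (h.tail b) a).linear (ih (h.tail a) b) _ _
    cases m with
    | zero => trivial
    | succ m =>
      refine ⟨fun b c l hl => ?_, hs⟩
      have rel : ∀ x y w, swapCoeff q x y *
          QuantumGL.ascend q m (fun u => f (y :: x :: u)) (w :: l) + stayCoeff q x y *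
          QuantumGL.ascend q m (fun u => f (x :: y :: u)) (w :: l) =
          -q⁻¹ * QuantumGL.ascend q m (fun u => f (x :: y :: u)) (w :: l) := by
        intro x y w
        have lin := ascend_sum (q := q) (Finset.univ : Finset (Fin 2)) m
          ![fun u => f (y :: x :: u), fun u => f (x :: y :: u)]
          ![swapCoeff q x y, stayCoeff q x y] (w :: l)
        have lin2 := ascend_sum (q := q) (Finset.univ : Finset (Fin 1)) m
          ![fun u => f (x :: y :: u)] ![-q⁻¹] (w :: l)
        simp only [Fin.sum_univ_two, Fin.sum_univ_one, Matrix.cons_val_zero, Matrix.cons_val_one,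
          smul_eq_mul] at lin lin2
        rw [mul_comm (swapCoeff q x y), mul_comm (stayCoeff q x y), mul_comm (-q⁻¹), ← lin, ← lin2]
        refine ascend_congr fun u hu => ?_
        have := h.1 x y u (by simp at hu; omega)
        simp only [listBraid_cons_cons, smul_eq_mul] at this
        linear_combination this
      have hb := listBraid_braid hq
        (fun x y w => QuantumGL.ascend q m (fun u => f (x :: y :: u)) (w :: l)) a b c
      simp only [listBraid_cons_cons, ascend_succ_cons, smul_eq_mul] at hb ⊢
      simp only [rel] at hb
      linear_combination -hb

end Lists

end QuantumGL

namespace QuantumGL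

/-! ### The `q`-antisymmetric tensor -/

section Epsilon

variable {ι : Type*} [LinearOrder ι]

/-- The exchange factor of two `q`-antisymmetric letters. -/
def exchange (q : ℂ) (a b : ι) : ℂ := if a < b then 1 else if b < a then -q else 0

lemma exchange_self (q : ℂ) (a : ι) : exchange q a a = 0 := by simp [exchange]

lemma exchange_ne_zero {q : ℂ} (hq : q ≠ 0) {a b : ι} (h : a ≠ b) : exchange q a b ≠ 0 := by
  rcases lt_or_gt_of_ne h with h | h
  · simp [exchange, h]
  · simp [exchange, h, h.not_gt, hq]

/-- The `q`-antisymmetric tensor. -/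
def eps (q : ℂ) : List ι → ℂ
  | [] => 1
  | a :: l => (l.map (exchange q a)).prod * eps q l

lemma eps_cons (q : ℂ) (a : ι) (l : List ι) :
    eps q (a :: l) = (l.map (exchange q a)).prod * eps q l := rfl

lemma eps_eq_zero {q : ℂ} {l : List ι} (h : ¬ l.Nodup) : eps q l = 0 := by
  induction l with
  | nil => simp at h
  | cons a l ih =>
    rw [eps_cons]
    by_cases ha : a ∈ l
    · rw [List.prod_eq_zero, zero_mul]
      exact List.mem_map.2 ⟨a, ha, exchange_self q a⟩
    · rw [ih fun hl => h (List.nodup_cons.2 ⟨ha, hl⟩), mul_zero]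

lemma eps_ne_zero {q : ℂ} (hq : q ≠ 0) {l : List ι} (h : l.Nodup) : eps q l ≠ 0 := by
  induction l with
  | nil => simp [eps]
  | cons a l ih =>
    rw [List.nodup_cons] at h
    refine mul_ne_zero (List.prod_ne_zero ?_) (ih h.2)
    rw [List.mem_map]
    rintro ⟨b, hb, hb'⟩
    exact exchange_ne_zero hq (fun hab : a = b => h.1 (hab ▸ hb)) hb'

lemma eps_eq_one (q : ℂ) {l : List ι} (h : l.Pairwise (· < ·)) : eps q l = 1 := by
  induction l with
  | nil => rfl
  | cons a l ih =>
    rw [List.pairwise_cons] at h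
    rw [eps_cons, ih h.2, mul_one, List.prod_eq_one]
    simp only [List.mem_map]
    rintro _ ⟨b, hb, rfl⟩
    simp [exchange, h.1 b hb]

/-- The symmetric weight `φ` serves the induction: fixing the first letter multiplies `eps` by a
product of exchange factors, which is symmetric in the remaining letters. -/
lemma qAntisymm_mul_eps {q : ℂ} (hq : q ≠ 0) (n : ℕ) (φ : List ι → ℂ)
    (hφ : ∀ l l' : List ι, l.Perm l' → φ l = φ l') :
    QAntisymm q n 0 (fun u => φ u * eps q u) := by
  induction n generalizing φ with
  | zero => trivial
  | succ n ih =>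
    cases n with
    | zero => trivial
    | succ n =>
      refine ⟨fun a b l _ => ?_, fun a => ?_⟩
      · rw [listBraid_cons_cons, hφ _ _ (List.Perm.swap a b l)]
        simp only [eps_cons, List.map_cons, List.prod_cons, smul_eq_mul]
        rcases lt_trichotomy a b with h | rfl | h
        · simp only [exchange, h, h.not_gt, h.ne, swapCoeff, stayCoeff, if_true, if_false, lam]
          ring
        · simp [exchange_self]
        · simp only [exchange, h, h.not_gt, h.ne', swapCoeff, stayCoeff, if_true, if_false, lam]
          field_simp
          ring
      · have := ih (fun u => φ (a :: u) * (u.map (exchange q a)).prod) fun l l' h => by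
          rw [hφ _ _ (h.cons a), (h.map _).prod_eq]
        simpa only [eps_cons, mul_assoc] using this

lemma qAntisymm_eps {q : ℂ} (hq : q ≠ 0) (n : ℕ) : QAntisymm q n 0 (eps q (ι := ι)) := by
  simpa using qAntisymm_mul_eps (ι := ι) hq n (fun _ => 1) fun _ _ _ => rfl

namespace QAntisymm

variable {q : ℂ}

/-- The constant depends on the two words alone, not on `f`; it can therefore be determined by
evaluating at `eps`. -/
lemma apply_perm {l₁ l₂ : List ι} (h : l₁.Perm l₂) :
    ∃ c : ℂ, ∀ f, QAntisymm q l₁.length 0 f → f l₁ = c * f l₂ := by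
  induction h with
  | nil => exact ⟨1, fun f _ => (one_mul _).symm⟩
  | cons a _ ih =>
    obtain ⟨c, hc⟩ := ih
    exact ⟨c, fun f hf => hc _ (hf.tail a)⟩
  | swap a b l =>
    rcases lt_trichotomy a b with h | rfl | h
    · refine ⟨-q, fun f hf => ?_⟩
      have := hf.1 a b l rfl
      simp only [listBraid_cons_cons, h, h.ne, swapCoeff, stayCoeff, if_true, if_false, lam,
        smul_eq_mul] at this
      linear_combination this
    · exact ⟨1, fun f _ => (one_mul _).symm⟩
    · refine ⟨-q⁻¹, fun f hf => ?_⟩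
      have := hf.1 a b l rfl
      simp only [listBraid_cons_cons, h.not_gt, h.ne', swapCoeff, stayCoeff, if_false,
        smul_eq_mul] at this
      linear_combination this
  | trans h₁ _ ih₁ ih₂ =>
    obtain ⟨c, hc⟩ := ih₁
    obtain ⟨d, hd⟩ := ih₂
    refine ⟨c * d, fun f hf => ?_⟩
    rw [hc f hf, hd f (h₁.length_eq ▸ hf), mul_assoc]

lemma exists_perm_of_not_nodup {l : List ι} (hl : ¬ l.Nodup) :
    ∃ a t, List.Perm (a :: a :: t) l := by
  induction l with
  | nil => simp at hl
  | cons b l ih =>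
    by_cases hb : b ∈ l
    · exact ⟨b, l.erase b, (List.perm_cons_erase hb).symm.cons b⟩
    · obtain ⟨a, t, h⟩ := ih fun h => hl (List.nodup_cons.2 ⟨hb, h⟩)
      refine ⟨a, b :: t, List.Perm.trans ?_ (h.cons b)⟩
      exact ((List.Perm.swap b a t).cons a).trans (List.Perm.swap b a (a :: t))

/-- A repeated letter can be moved to the front, where antisymmetry says `q f = -q⁻¹ f`, that is,
`(q² + 1) f = 0`. -/
lemma apply_eq_zero (hq : q ≠ 0) (hq4 : q ^ 4 ≠ 1) {l : List ι} (hl : ¬ l.Nodup) {f : List ι → ℂ}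
    (hf : QAntisymm q l.length 0 f) : f l = 0 := by
  obtain ⟨a, t, ht⟩ := exists_perm_of_not_nodup hl
  obtain ⟨c, hc⟩ := apply_perm (q := q) ht.symm
  rw [hc f hf]
  rw [← ht.length_eq] at hf
  have := hf.1 a a t rfl
  simp only [listBraid_cons_cons, lt_irrefl, swapCoeff, stayCoeff, if_true, if_false,
    smul_eq_mul, zero_mul, add_zero] at this
  have h2 : (q ^ 2 + 1) * f (a :: a :: t) = 0 := by
    field_simp at this
    linear_combination this
  rcases mul_eq_zero.1 h2 with h | h
  · exact absurd (by linear_combination (q ^ 2 - 1) * h) hq4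
  · rw [h, mul_zero]

lemma of_append {n k : ℕ} {f : List ι → ℂ} (hf : ∀ x, QAntisymm q n k (fun u => f (u ++ [x]))) :
    QAntisymm q n (k + 1) f := by
  induction n generalizing f with
  | zero => trivial
  | succ n ih =>
    cases n with
    | zero => trivial
    | succ n =>
      refine ⟨fun a b l hl => ?_, fun a => ih fun x => (hf x).2 a⟩
      have hl0 : l ≠ [] := by rintro rfl; simp at hl
      rw [← List.dropLast_append_getLast hl0]
      exact (hf (l.getLast hl0)).1 a b l.dropLast (by simp [hl])

end QAntisymm

variable {N : ℕ} {q : ℂ}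

lemma perm_finRange {l : List (Fin N)} (hl : l.length = N) (hn : l.Nodup) :
    l.Perm (List.finRange N) := by
  rw [List.perm_ext_iff_of_nodup hn (List.nodup_finRange N)]
  intro a
  have : l.toFinset = Finset.univ := by
    rw [← Finset.card_eq_iff_eq_univ, List.toFinset_card_of_nodup hn, hl, Fintype.card_fin]
  simpa using Finset.ext_iff.1 this a

/-- The top `q`-antisymmetric power is one-dimensional: a word of length `N` either repeats a letter
or is a permutation of the sorted word. -/
lemma QAntisymm.apply_eq (hq : q ≠ 0) (hq4 : q ^ 4 ≠ 1) {l : List (Fin N)} (hl : l.length = N)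
    {f : List (Fin N) → ℂ} (hf : QAntisymm q N 0 f) :
    f l = eps q l * f (List.finRange N) := by
  by_cases hn : l.Nodup
  · obtain ⟨c, hc⟩ := QAntisymm.apply_perm (q := q) (perm_finRange hl hn)
    have := hc (eps q) (qAntisymm_eps hq _)
    rw [eps_eq_one q (List.pairwise_lt_finRange N), mul_one] at this
    rw [this, hc f (by rwa [hl])]
  · rw [QAntisymm.apply_eq_zero hq hq4 hn (f := f) (by rwa [hl]), eps_eq_zero hn, zero_mul]

lemma prod_swapCoeff (q : ℂ) (x : Fin N) :
    ((List.finRange N).map (swapCoeff q x)).prod = q := by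
  rw [← Fin.prod_univ_def]
  simp [swapCoeff]

lemma descend_eq_zero {n : ℕ} {f : List (Fin N) → ℂ} {l t : List (Fin N)} (hl : l.length = n + 1)
    (ht : ¬ t.Nodup) (hf : ∀ a u, ¬ u.Nodup → f (a :: u) = 0) : descend q n f (l ++ t) = 0 := by
  rw [← descend_append f t l (by omega)]
  have h0 := descend_sum (q := q) (∅ : Finset (Fin 1)) n (fun _ _ => (0 : ℂ)) (fun _ => (0 : ℂ)) l
  simp only [Finset.sum_empty] at h0
  rw [← h0]
  refine descend_congr fun u hu => ?_
  match u with
  | [] => simp at hu; omega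
  | a :: u => exact hf a _ fun h => ht (List.nodup_append.1 h).2.1

/-- At each step the word in which `a` and `x` stay in place has a nonzero coefficient only for `a <
x`. Then `x` occurs again in `s`, and the term vanishes by `hf`. Only the product of the swap
coefficients survives. -/
lemma descend_ordered {f : List (Fin N) → ℂ} (hf : ∀ a u, ¬ u.Nodup → f (a :: u) = 0)
    (x : Fin N) (p s : List (Fin N)) (hps : p ++ s = List.finRange N) :
    descend q p.length f (p ++ x :: s) = (p.map (swapCoeff q x)).prod * f (x :: p ++ s) := by
  induction p using List.reverseRecOn generalizing s with
  | nil => simp [descend]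
  | append_singleton p a ih =>
    rw [List.length_append, List.length_singleton, List.append_assoc, List.singleton_append,
      descend_succ_append f p s a x rfl]
    have h1 := ih (a :: s) (by simpa using hps)
    rw [h1]
    have h2 : stayCoeff q a x • descend q p.length f (p ++ a :: x :: s) = 0 := by
      by_cases hax : a < x
      · have hx : x ∈ s := by
          have hm : x ∈ p ++ [a] ++ s := hps ▸ List.mem_finRange x
          have hso : (p ++ [a] ++ s).Pairwise (· < ·) := hps ▸ List.pairwise_lt_finRange N
          simp only [List.append_assoc, List.pairwise_append, List.mem_append,List.singleton_append, List.mem_cons] at hm hso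
          rcases hm with hm | rfl | hm
          · exact absurd (hso.2.2 x hm a (Or.inl rfl)) hax.not_gt
          · exact absurd hax (lt_irrefl _)
          · exact hm
        rw [← List.singleton_append, ← List.append_assoc,
          descend_eq_zero (by simp) (by simp [hx]) hf, smul_zero]
      · simp [stayCoeff, hax]
    rw [h2, add_zero, smul_eq_mul, swapCoeff_comm]
    simp
    ring

/-- Moving one vector index through a full `q`-antisymmetrizer. -/
lemma descend_eps (hq : q ≠ 0) (hq4 : q ^ 4 ≠ 1) (i x : Fin N) {l : List (Fin N)}
    (hl : l.length = N) (h : List (Fin N) → ℂ)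
    (hh : ∀ j u, h (j :: u) = if i = j then eps q u else 0) :
    descend q N h (l ++ [x]) = if i = x then q * eps q l else 0 := by
  -- Antisymmetry in the first `N` letters reduces the evaluation to the sorted word.
  have h1 : QAntisymm q N 1 (descend q N h) := QAntisymm.descend hq fun a => by
    have := qAntisymm_mul_eps (ι := Fin N) hq N (fun _ => if i = a then 1 else 0)
      fun _ _ _ => rfl
    simpa [hh] using this
  rw [(h1.append x).apply_eq hq hq4 hl]
  have h2 := descend_ordered (q := q) (f := h) (fun a u hu => by simp [hh, eps_eq_zero hu]) x
    (List.finRange N) [] (by simp)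
  rw [List.length_finRange] at h2
  rw [h2, prod_swapCoeff, List.append_nil, hh, eps_eq_one q (List.pairwise_lt_finRange N)]
  split_ifs <;> ring

lemma ascend_ordered {f : List (Fin N) → ℂ} (hf : ∀ u a, ¬ u.Nodup → f (u ++ [a]) = 0)
    (j : Fin N) (p s : List (Fin N)) (hps : p ++ s = List.finRange N) :
    ascend q s.length (fun u => f (p ++ u)) (j :: s) =
      (s.map (swapCoeff q j)).prod * f (p ++ s ++ [j]) := by
  induction s generalizing p with
  | nil => simp [ascend]
  | cons b s ih =>
    rw [List.length_cons, ascend_succ_cons]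
    have h1 := ih (p ++ [b]) (by simpa using hps)
    have h2 : stayCoeff q j b • ascend q s.length (fun u => f (p ++ j :: u)) (b :: s) = 0 := by
      by_cases hjb : j < b
      · have hj : j ∈ p := by
          have hm : j ∈ p ++ (b :: s) := hps ▸ List.mem_finRange j
          have hso : (p ++ (b :: s)).Pairwise (· < ·) := hps ▸ List.pairwise_lt_finRange N
          simp only [List.pairwise_append, List.pairwise_cons, List.mem_append,
            List.mem_cons] at hm hso
          rcases hm with hm | rfl | hm
          · exact hm
          · exact absurd hjb (lt_irrefl _)
          · exact absurd (hso.2.1.1 j hm) hjb.not_gt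
        have h0 := ascend_sum (q := q) (∅ : Finset (Fin 1)) s.length (fun _ _ => (0 : ℂ))
          (fun _ => (0 : ℂ)) (b :: s)
        simp only [Finset.sum_empty] at h0
        rw [ascend_congr (g := fun _ => 0) (fun u hu => ?_), h0, smul_zero]
        have hu0 : u ≠ [] := by rintro rfl; simp at hu
        rw [← List.dropLast_append_getLast hu0, ← List.cons_append, ← List.append_assoc]
        refine hf _ _ fun hnd => ?_
        exact (List.nodup_append.1 hnd).2.2 j hj j (by simp) rfl
      · simp [stayCoeff, hjb]
    simp only [List.append_assoc, List.singleton_append] at h1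
    rw [h2, add_zero, smul_eq_mul, h1]
    simp
    ring

/-- Moving one vector index back through a full `q`-antisymmetrizer. -/
lemma ascend_eps (hq : q ≠ 0) (hq4 : q ^ 4 ≠ 1) (z j : Fin N) {K : List (Fin N)}
    (hK : K.length = N) (f : List (Fin N) → ℂ)
    (hf : ∀ u d, f (u ++ [d]) = if z = d then eps q u else 0) :
    ascend q N f (j :: K) = if z = j then q * eps q K else 0 := by
  have h1 : QAntisymm q N 1 f := QAntisymm.of_append fun d => by
    have := qAntisymm_mul_eps (ι := Fin N) hq N (fun _ => if z = d then 1 else 0)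
      fun _ _ _ => rfl
    simpa [hf] using this
  rw [(QAntisymm.ascend hq h1 j).apply_eq hq hq4 hK]
  have h2 := ascend_ordered (q := q) (f := f) (fun u a hu => by simp [hf, eps_eq_zero hu]) j
    [] (List.finRange N) (by simp)
  simp only [List.length_finRange, List.nil_append] at h2
  rw [h2, prod_swapCoeff, hf, eps_eq_one q (List.pairwise_lt_finRange N)]
  split_ifs <;> ring

end Epsilon

end QuantumGL

namespace QuantumGL

/-! ### Skew invertibility: single products recovered from contractions with `R̂` -/

section Skew

variable {N : ℕ} {q : ℂ} {F : Type*} [AddCommGroup F] [Module ℂ F]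

/-- `R̂` is skew invertible. -/
lemma mem_of_skew_RA (hq : q ≠ 0) (S : Submodule ℂ F) (x : Fin N → Fin N → F)
    (h : ∀ a d, swapCoeff q a d • x d a +
      (if a = d then ∑ c, stayCoeff q a c • x c c else 0) ∈ S) (c e : Fin N) : x c e ∈ S := by
  by_cases hce : c = e
  · subst hce
    -- Diagonal entries are recovered from the largest index downwards, since `stayCoeff q c d` is
    -- nonzero only for `c < d`.
    induction hn : N - (c : ℕ) using Nat.strong_induction_on generalizing c with
    | _ n ih =>
      have h1 := h c c
      have h2 : ∑ d, stayCoeff q c d • x d d ∈ S := by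
        refine S.sum_mem fun d _ => ?_
        by_cases hd : c < d
        · exact S.smul_mem _ (ih _ (by have := d.2; omega) d rfl)
        · simp [stayCoeff, hd]
      rw [if_pos rfl] at h1
      have h3 := (S.add_mem_iff_left h2).1 h1
      rw [swapCoeff, if_pos rfl] at h3
      exact (S.smul_mem_iff hq).1 h3
  · have := h e c
    rwa [if_neg (Ne.symm hce), add_zero, swapCoeff, if_neg (Ne.symm hce), one_smul] at this

/-- `R̂⁻¹` is skew invertible. -/
lemma mem_of_skew_RAinv (hq : q ≠ 0) (S : Submodule ℂ F) (x : Fin N → Fin N → F)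
    (h : ∀ a d, swapCoeff q a d • x d a +
      (if a = d then ∑ c, stayCoeff q a c • x c c else 0) -
      (if a = d then lam q • ∑ c, x c c else 0) ∈ S) (c e : Fin N) : x c e ∈ S := by
  by_cases hce : c = e
  · subst hce
    -- For the inverse the order is upwards: subtracting `λ` times the full sum leaves only indices
    -- below `c`.
    induction hn : (c : ℕ) using Nat.strong_induction_on generalizing c with
    | _ n ih =>
      have h1 := h c c
      rw [if_pos rfl, if_pos rfl] at h1
      have h2 : ∑ d, (if d < c then lam q else 0) • x d d ∈ S := by
        refine S.sum_mem fun d _ => ?_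
        by_cases hd : d < c
        · exact S.smul_mem _ (ih _ (by have : (d : ℕ) < c := hd; omega) d rfl)
        · simp [hd]
      have h3 : swapCoeff q c c • x c c + ∑ d, stayCoeff q c d • x d d - lam q • ∑ d, x d d =
          q⁻¹ • x c c - ∑ d, (if d < c then lam q else 0) • x d d := by
        have h4 : lam q • x c c = ∑ d, (if d = c then lam q else 0) • x d d := by
          simp [ite_smul]
        have h5 : lam q • ∑ d, x d d = ∑ d, stayCoeff q c d • x d d + lam q • x c c +
            ∑ d, (if d < c then lam q else 0) • x d d := by
          rw [h4, ← Finset.sum_add_distrib, ← Finset.sum_add_distrib, Finset.smul_sum]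
          refine Finset.sum_congr rfl fun d _ => ?_
          rcases lt_trichotomy c d with h | rfl | h
          · simp [stayCoeff, h, h.ne', h.not_gt]
          · simp [stayCoeff]
          · simp [stayCoeff, h, h.ne, h.not_gt]
        rw [h5, swapCoeff, if_pos rfl, lam, sub_smul]
        abel
      rw [h3] at h1
      have := S.add_mem h1 h2
      rw [sub_add_cancel] at this
      exact (S.smul_mem_iff (inv_ne_zero hq)).1 this
  · have := h e c
    rwa [if_neg (Ne.symm hce), if_neg (Ne.symm hce), add_zero, sub_zero, swapCoeff,
      if_neg (Ne.symm hce), one_smul] at this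

lemma amp_mul_RA_mul_amp_apply {A : Type*} [Ring A] [Algebra ℂ A] (X Y : Matrix (Fin N) (Fin N) A)
    (a b d f : Fin N) : (amp (Fin N) X * RA N q A * amp (Fin N) Y) (a, b) (d, f) =
      swapCoeff q a d • (X b d * Y a f) +
        if a = d then ∑ c, stayCoeff q a c • (X b c * Y c f) else 0 := by
  rw [mul_assoc, Matrix.mul_apply, Fintype.sum_prod_type, Finset.sum_eq_single a]
  · simp only [amp_apply, if_true, RA_mul_apply, mul_add, mul_smul_comm, Finset.sum_add_distrib]
    congr 1
    · rw [Finset.sum_eq_single d]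
      · simp
      · intro c _ hc
        simp [hc]
      · simp
    · split_ifs with h
      · rfl
      · simp
  · intro c _ hc
    refine Finset.sum_eq_zero fun e _ => ?_
    simp [amp_apply, Ne.symm hc]
  · simp

lemma amp_mul_RAinv_mul_amp_apply {A : Type*} [Ring A] [Algebra ℂ A] (hq : q ≠ 0)
    (X Y : Matrix (Fin N) (Fin N) A) (a b d f : Fin N) :
    (amp (Fin N) X * RAinv N q A * amp (Fin N) Y) (a, b) (d, f) =
      swapCoeff q a d • (X b d * Y a f) +
        (if a = d then ∑ c, stayCoeff q a c • (X b c * Y c f) else 0) -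
        (if a = d then lam q • ∑ c, X b c * Y c f else 0) := by
  have : RAinv N q A = RA N q A - lam q • 1 := by rw [RA_eq hq, add_sub_cancel_right]
  rw [this, mul_sub, sub_mul, Matrix.sub_apply, amp_mul_RA_mul_amp_apply, mul_smul_comm, mul_one,
    smul_mul_assoc, ← map_mul, Matrix.smul_apply, amp_apply, smul_ite, smul_zero, Matrix.mul_apply]

end Skew

/-! ### Matrices of operators and subspaces -/

section Maps

variable {F : Type*} [AddCommGroup F] [Module ℂ F] {κ : Type*} [Fintype κ] [DecidableEq κ]

/-- All entries of a matrix of operators map `P` to `S`. -/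
def EntriesMap (X : Matrix κ κ (Module.End ℂ F)) (P S : Submodule ℂ F) : Prop :=
  ∀ i j, ∀ x ∈ P, X i j x ∈ S

namespace EntriesMap

variable {X Y : Matrix κ κ (Module.End ℂ F)} {P S S' : Submodule ℂ F}

lemma mul (hX : EntriesMap X S S') (hY : EntriesMap Y P S) : EntriesMap (X * Y) P S' := by
  intro i j x hx
  rw [Matrix.mul_apply, LinearMap.sum_apply]
  exact S'.sum_mem fun k _ => hX _ _ _ (hY _ _ _ hx)

lemma add (hX : EntriesMap X P S) (hY : EntriesMap Y P S) : EntriesMap (X + Y) P S :=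
  fun i j x hx => S.add_mem (hX i j x hx) (hY i j x hx)

lemma sub (hX : EntriesMap X P S) (hY : EntriesMap Y P S) : EntriesMap (X - Y) P S :=
  fun i j x hx => S.sub_mem (hX i j x hx) (hY i j x hx)

lemma neg (hX : EntriesMap X P S) : EntriesMap (-X) P S :=
  fun i j x hx => S.neg_mem (hX i j x hx)

lemma smul (c : ℂ) (hX : EntriesMap X P S) : EntriesMap (c • X) P S :=
  fun i j x hx => S.smul_mem c (hX i j x hx)

lemma mono (hX : EntriesMap X P S) (h : S ≤ S') : EntriesMap X P S' :=
  fun i j x hx => h (hX i j x hx)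

lemma map_algebraMap (c : Matrix κ κ ℂ) (P : Submodule ℂ F) :
    EntriesMap (c.map (algebraMap ℂ (Module.End ℂ F))) P P := by
  intro i j x hx
  rw [Matrix.map_apply, Module.algebraMap_end_apply]
  exact P.smul_mem _ hx

lemma one (P : Submodule ℂ F) : EntriesMap (1 : Matrix κ κ (Module.End ℂ F)) P P := by
  intro i j x hx
  rw [Matrix.one_apply]
  split_ifs
  · exact hx
  · exact P.zero_mem

lemma amp {ι : Type*} [Fintype ι] [DecidableEq ι] (hX : EntriesMap X P S) :
    EntriesMap (QuantumGL.amp ι X) P S := by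
  intro i j x hx
  rw [amp_apply]
  split_ifs
  · exact hX _ _ _ hx
  · exact S.zero_mem

variable {N : ℕ} {q : ℂ}

lemma RA (P : Submodule ℂ F) : EntriesMap (QuantumGL.RA N q (Module.End ℂ F)) P P :=
  map_algebraMap _ P

lemma RAinv (P : Submodule ℂ F) : EntriesMap (QuantumGL.RAinv N q (Module.End ℂ F)) P P :=
  map_algebraMap _ P

end EntriesMap

end Maps

/-- A representation of the relations of the differential algebra on a space generated by a vacuum
vector. -/
structure FockRep (N : ℕ) (q : ℂ) {F : Type*} [AddCommGroup F] [Module ℂ F]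
    (T w L K J : Matrix (Fin N) (Fin N) (Module.End ℂ F)) (v : F) : Prop where
  ops : DiffOps N q T w L K J
  l_vac : ∀ i j, L i j v = if i = j then v else 0
  j_vac : ∀ i j, J i j v = 0
  cyclic : ∀ S : Submodule ℂ F, v ∈ S → EntriesMap T S S → EntriesMap w S S → EntriesMap L S S →
    EntriesMap K S S → EntriesMap J S S → S = ⊤

/-! ### The degree filtration and normal ordering -/

section Filtration

variable {N : ℕ} {q : ℂ} {F : Type*} [AddCommGroup F] [Module ℂ F]
  {T w L K J : Matrix (Fin N) (Fin N) (Module.End ℂ F)} {v : F}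

/-- The polynomials of degree less than `n`. -/
def lowDegree (T w : Matrix (Fin N) (Fin N) (Module.End ℂ F)) (v : F) : ℕ → Submodule ℂ F
  | 0 => ⊥
  | n + 1 => (Submodule.span ℂ {v} ⊔ lowDegree T w v n) ⊔
      ((⨆ i, ⨆ j, (lowDegree T w v n).map (T i j)) ⊔ ⨆ i, ⨆ j, (lowDegree T w v n).map (w i j))

lemma vac_mem_lowDegree (n : ℕ) : v ∈ lowDegree T w v (n + 1) :=
  le_sup_left (a := Submodule.span ℂ {v} ⊔ lowDegree T w v n)
    (le_sup_left (a := Submodule.span ℂ {v}) (Submodule.mem_span_singleton_self v))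

lemma lowDegree_le_succ (n : ℕ) : lowDegree T w v n ≤ lowDegree T w v (n + 1) :=
  le_sup_right.trans le_sup_left

lemma lowDegree_mono : Monotone (lowDegree T w v) := monotone_nat_of_le_succ lowDegree_le_succ

lemma t_lowDegree (n : ℕ) : EntriesMap T (lowDegree T w v n) (lowDegree T w v (n + 1)) :=
  fun i j _ hx => Submodule.mem_sup_right <| Submodule.mem_sup_left <|
    Submodule.mem_iSup_of_mem i <| Submodule.mem_iSup_of_mem j <| Submodule.mem_map_of_mem hx

lemma w_lowDegree (n : ℕ) : EntriesMap w (lowDegree T w v n) (lowDegree T w v (n + 1)) :=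
  fun i j _ hx => Submodule.mem_sup_right <| Submodule.mem_sup_right <|
    Submodule.mem_iSup_of_mem i <| Submodule.mem_iSup_of_mem j <| Submodule.mem_map_of_mem hx

lemma lowDegree_succ_le {n : ℕ} {S : Submodule ℂ F} (hv : v ∈ S) (h : lowDegree T w v n ≤ S)
    (hT : EntriesMap T (lowDegree T w v n) S) (hw : EntriesMap w (lowDegree T w v n) S) :
    lowDegree T w v (n + 1) ≤ S := by
  refine sup_le (sup_le ?_ h) (sup_le ?_ ?_)
  · rwa [Submodule.span_singleton_le_iff_mem]
  · exact iSup₂_le fun i j => Submodule.map_le_iff_le_comap.2 (hT i j)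
  · exact iSup₂_le fun i j => Submodule.map_le_iff_le_comap.2 (hw i j)

instance finite_lowDegree (n : ℕ) : Module.Finite ℂ (lowDegree T w v n) := by
  induction n with
  | zero => exact inferInstanceAs (Module.Finite ℂ (⊥ : Submodule ℂ F))
  | succ n ih =>
    have hmap (X : Matrix (Fin N) (Fin N) (Module.End ℂ F)) : Module.Finite ℂ
        (⨆ i, ⨆ j, (lowDegree T w v n).map (X i j) : Submodule ℂ F) :=
      have (i j : Fin N) : Module.Finite ℂ ((lowDegree T w v n).map (X i j)) := .map _ _
      have (i : Fin N) : Module.Finite ℂ (⨆ j, (lowDegree T w v n).map (X i j) : Submodule ℂ F) :=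
        Submodule.finite_iSup _
      Submodule.finite_iSup _
    have := hmap T
    have := hmap w
    rw [lowDegree]
    infer_instance

/-- To bound an operator on polynomials it suffices to treat the vacuum and the two kinds of
products. -/
lemma entriesMap_lowDegree_succ {X : Matrix (Fin N) (Fin N) (Module.End ℂ F)} {n : ℕ}
    {S : Submodule ℂ F} (hv : ∀ i j, X i j v ∈ S) (h : EntriesMap X (lowDegree T w v n) S)
    (hT : ∀ i j k l, ∀ x ∈ lowDegree T w v n, X i j (T k l x) ∈ S)
    (hw : ∀ i j k l, ∀ x ∈ lowDegree T w v n, X i j (w k l x) ∈ S) :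
    EntriesMap X (lowDegree T w v (n + 1)) S := fun i j =>
  lowDegree_succ_le (S := S.comap (X i j)) (hv i j) (h i j) (fun k l => hT i j k l)
    fun k l => hw i j k l

lemma apply_mem_of_RA (hq : q ≠ 0) {X Y : Matrix (Fin N) (Fin N) (Module.End ℂ F)}
    {P S : Submodule ℂ F}
    (h : EntriesMap (amp (Fin N) X * RA N q (Module.End ℂ F) * amp (Fin N) Y) P S)
    (b c e f : Fin N) (x : F) (hx : x ∈ P) : X b c (Y e f x) ∈ S := by
  refine mem_of_skew_RA hq S (fun c e => X b c (Y e f x)) (fun a d => ?_) c e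
  have := h (a, b) (d, f) x hx
  rw [amp_mul_RA_mul_amp_apply] at this
  split_ifs at this ⊢ with had <;> simpa using this

lemma apply_mem_of_RAinv (hq : q ≠ 0) {X Y : Matrix (Fin N) (Fin N) (Module.End ℂ F)}
    {P S : Submodule ℂ F}
    (h : EntriesMap (amp (Fin N) X * RAinv N q (Module.End ℂ F) * amp (Fin N) Y) P S)
    (b c e f : Fin N) (x : F) (hx : x ∈ P) : X b c (Y e f x) ∈ S := by
  refine mem_of_skew_RAinv hq S (fun c e => X b c (Y e f x)) (fun a d => ?_) c e
  have := h (a, b) (d, f) x hx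
  rw [amp_mul_RAinv_mul_amp_apply hq] at this
  split_ifs at this ⊢ with had <;> simpa using this

lemma apply_mem_of_ampLeft {X Y : Matrix (Fin N) (Fin N) (Module.End ℂ F)}
    {P S : Submodule ℂ F} (h : EntriesMap (ampLeft X * amp (Fin N) Y) P S)
    (b c e f : Fin N) (x : F) (hx : x ∈ P) : X b c (Y e f x) ∈ S := by
  have := h (b, e) (c, f) x hx
  rwa [ampLeft_mul_amp_apply] at this

namespace FockRep

variable (h : FockRep N q T w L K J v)
include h

lemma k_vac (i j : Fin N) : K i j v = if i = j then v else 0 := by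
  have := congrArg (fun X => X i j v) h.ops.kl
  simp only [Matrix.mul_apply, LinearMap.sum_apply, Module.End.mul_apply, h.l_vac,
    Matrix.one_apply] at this
  simp only [apply_ite (K i _), map_zero, Finset.sum_ite_eq', Finset.mem_univ, if_true] at this
  rw [this]
  split_ifs <;> rfl

/-- `J` is moved to the right until it meets the vacuum and vanishes. Passing `T` keeps the degree
count, and passing `ω` adds only the scalar term of the `ωJ` relation, in which that `ω` has been
removed. -/
lemma j_lowDegree (hq : q ≠ 0) (n : ℕ) :
    EntriesMap J (lowDegree T w v (n + 1)) (lowDegree T w v n) := by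
  -- Truncated subtraction lets the induction start at the zero space; `hup` restores one degree and
  -- treats `n = 0` separately.
  have hstep : ∀ n, EntriesMap J (lowDegree T w v n) (lowDegree T w v (n - 1)) := fun n => by
    induction n with
    | zero =>
      intro i j x hx
      have : x = 0 := hx
      rw [this, map_zero]
      exact Submodule.zero_mem _
    | succ n ih =>
      have hup : ∀ {X : Matrix (Fin N) (Fin N) (Module.End ℂ F)},
          (∀ m, EntriesMap X (lowDegree T w v m) (lowDegree T w v (m + 1))) →
          EntriesMap X (lowDegree T w v (n - 1)) (lowDegree T w v n) := fun {X} hX => by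
        cases n with
        | zero =>
          intro i j x hx
          have : x = 0 := hx
          rw [this, map_zero]
          exact Submodule.zero_mem _
        | succ n => exact hX n
      refine entriesMap_lowDegree_succ (fun i j => ?_) (ih.mono (lowDegree_mono (by omega)))
        (apply_mem_of_ampLeft ?_) (apply_mem_of_RA hq ?_)
      · rw [h.j_vac]; exact Submodule.zero_mem _
      · rw [h.ops.jt]
        exact (((hup t_lowDegree).amp.mul (.RA _)).mul ih.amp).mul (.RA _)
      · rw [rel_j_r_w (RA_inv_mul hq) h.ops.wj]
        exact (EntriesMap.one _).neg.sub
          (((((EntriesMap.RAinv _).mul (hup w_lowDegree).amp).mul (.RA _)).mul ih.amp).mul (.RA _))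
  exact hstep (n + 1)

lemma l_lowDegree (hq : q ≠ 0) (n : ℕ) :
    EntriesMap L (lowDegree T w v n) (lowDegree T w v n) := by
  induction n with
  | zero =>
    intro i j x hx
    have : x = 0 := hx
    rw [this, map_zero]
    exact Submodule.zero_mem _
  | succ n ih =>
    refine entriesMap_lowDegree_succ (fun i j => ?_) (ih.mono (lowDegree_le_succ n))
      (apply_mem_of_ampLeft ?_) (apply_mem_of_RA hq ?_)
    · rw [h.l_vac]
      split_ifs
      · exact vac_mem_lowDegree n
      · exact Submodule.zero_mem _
    · rw [h.ops.lt]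
      exact (((t_lowDegree n).amp.mul (.RA _)).mul ih.amp).mul (.RA _)
    · have : amp (Fin N) L * RA N q (Module.End ℂ F) * amp (Fin N) w =
          RAinv N q _ * amp (Fin N) w * RA N q _ * amp (Fin N) L * RA N q _ := by
        calc _ = RAinv N q _ * RA N q _ * amp (Fin N) L * RA N q (Module.End ℂ F) *
              amp (Fin N) w := by rw [RA_inv_mul hq, one_mul]
          _ = RAinv N q _ * (RA N q _ * amp (Fin N) L * RA N q (Module.End ℂ F) *
              amp (Fin N) w) := by noncomm_ring
          _ = _ := by rw [← h.ops.wl]; noncomm_ring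
      rw [this]
      exact ((((EntriesMap.RAinv _).mul (w_lowDegree n).amp).mul (.RA _)).mul ih.amp).mul (.RA _)

lemma k_lowDegree (hq : q ≠ 0) (n : ℕ) :
    EntriesMap K (lowDegree T w v n) (lowDegree T w v n) := by
  induction n with
  | zero =>
    intro i j x hx
    have : x = 0 := hx
    rw [this, map_zero]
    exact Submodule.zero_mem _
  | succ n ih =>
    refine entriesMap_lowDegree_succ (fun i j => ?_) (ih.mono (lowDegree_le_succ n))
      (apply_mem_of_ampLeft ?_) (apply_mem_of_RAinv hq ?_)
    · rw [h.k_vac]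
      split_ifs
      · exact vac_mem_lowDegree n
      · exact Submodule.zero_mem _
    · rw [rel_k_t (RA_mul_inv hq) (amp_mul_eq_one h.ops.lk)
        (by rw [← ampLeft_mul, h.ops.kl, ampLeft_one]) h.ops.lt]
      exact (((t_lowDegree n).amp.mul (.RAinv _)).mul ih.amp).mul (.RAinv _)
    · have hr := RA_mul_inv (N := N) (A := Module.End ℂ F) hq
      have hr' := RA_inv_mul (N := N) (A := Module.End ℂ F) hq
      have h1 := inverse_intertwine (x := amp (Fin N) w)
        (mul_triple_inverse hr (amp_mul_eq_one h.ops.lk) hr)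
        (mul_triple_inverse hr' (amp_mul_eq_one h.ops.kl) hr') (by rw [← h.ops.wl]; noncomm_ring)
      have : amp (Fin N) K * RAinv N q (Module.End ℂ F) * amp (Fin N) w =
          RA N q _ * amp (Fin N) w * RAinv N q _ * amp (Fin N) K * RAinv N q _ := by
        calc _ = RA N q _ * RAinv N q _ * amp (Fin N) K * RAinv N q (Module.End ℂ F) *
              amp (Fin N) w := by rw [hr, one_mul]
          _ = RA N q _ * (RAinv N q _ * amp (Fin N) K * RAinv N q (Module.End ℂ F) *
              amp (Fin N) w) := by noncomm_ring
          _ = _ := by rw [h1]; noncomm_ring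
      rw [this]
      exact ((((EntriesMap.RA _).mul (w_lowDegree n).amp).mul (.RAinv _)).mul ih.amp).mul
        (.RAinv _)

lemma exists_mem_lowDegree (hq : q ≠ 0) (x : F) : ∃ n, x ∈ lowDegree T w v n := by
  have key : ∀ x : F, (x ∈ ⨆ n, lowDegree T w v n) ↔ ∃ n, x ∈ lowDegree T w v n := fun x =>
    Submodule.mem_iSup_of_chain ⟨_, lowDegree_mono⟩ x
  rw [← key, h.cyclic (⨆ n, lowDegree T w v n)]
  · trivial
  · exact (key v).2 ⟨1, vac_mem_lowDegree 0⟩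
  · intro i j x hx
    obtain ⟨n, hn⟩ := (key x).1 hx
    exact (key _).2 ⟨n + 1, t_lowDegree n i j x hn⟩
  · intro i j x hx
    obtain ⟨n, hn⟩ := (key x).1 hx
    exact (key _).2 ⟨n + 1, w_lowDegree n i j x hn⟩
  · intro i j x hx
    obtain ⟨n, hn⟩ := (key x).1 hx
    exact (key _).2 ⟨n, h.l_lowDegree hq n i j x hn⟩
  · intro i j x hx
    obtain ⟨n, hn⟩ := (key x).1 hx
    exact (key _).2 ⟨n, h.k_lowDegree hq n i j x hn⟩
  · intro i j x hx
    obtain ⟨n, hn⟩ := (key x).1 hx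
    exact (key _).2 ⟨n, h.j_lowDegree hq n i j x (lowDegree_le_succ n hn)⟩

/-- Every vector is a polynomial in `T` and `ω` applied to the vacuum. -/
lemma eq_top (hq : q ≠ 0) {S : Submodule ℂ F} (hv : v ∈ S) (hT : EntriesMap T S S)
    (hw : EntriesMap w S S) : S = ⊤ := by
  have : ∀ n, lowDegree T w v n ≤ S := fun n => by
    induction n with
    | zero => exact bot_le
    | succ n ih =>
      exact lowDegree_succ_le hv ih (fun i j x hx => hT i j x (ih hx))
        fun i j x hx => hw i j x (ih hx)
  refine eq_top_iff.2 fun x _ => ?_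
  obtain ⟨n, hn⟩ := h.exists_mem_lowDegree hq x
  exact this n hn

end FockRep

end Filtration

end QuantumGL

namespace QuantumGL

section Act

variable {F : Type*} [AddCommGroup F] [Module ℂ F] {κ : Type*} [Fintype κ] [DecidableEq κ]

/-- A matrix of operators acting on columns. -/
def act : Matrix κ κ (Module.End ℂ F) ≃ₐ[ℂ] Module.End ℂ (κ → F) :=
  (endVecAlgEquivMatrixEnd κ ℂ ℂ F).symm

lemma act_apply (X : Matrix κ κ (Module.End ℂ F)) (x : κ → F) (i : κ) :
    act X x i = ∑ j, X i j (x j) := rfl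

lemma act_mul_apply (X Y : Matrix κ κ (Module.End ℂ F)) (x : κ → F) :
    act (X * Y) x = act X (act Y x) := by
  rw [map_mul, Module.End.mul_apply]

lemma act_amp_apply {ι : Type*} [Fintype ι] [DecidableEq ι] (X : Matrix κ κ (Module.End ℂ F))
    (x : ι × κ → F) (a : ι) (b : κ) :
    act (amp ι X) x (a, b) = act X (fun k => x (a, k)) b := by
  rw [act_apply, act_apply, Fintype.sum_prod_type, Finset.sum_eq_single a]
  · simp
  · intro c _ hc
    simp [Ne.symm hc]
  · simp

lemma act_ampLeft_apply {N : ℕ} (X : Matrix (Fin N) (Fin N) (Module.End ℂ F))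
    (x : Fin N × Fin N → F) (a b : Fin N) :
    act (ampLeft X) x (a, b) = act X (fun k => x (k, b)) a := by
  rw [act_apply, act_apply, Fintype.sum_prod_type]
  simp [ampLeft, DFunLike.ite_apply]

lemma act_single (X : Matrix κ κ (Module.End ℂ F)) (i j : κ) (x : F) :
    act X (Pi.single j x) i = X i j x := by
  rw [act_apply, Finset.sum_eq_single j]
  · rw [Pi.single_eq_same]
  · intro k _ hk
    rw [Pi.single_eq_of_ne hk, map_zero]
  · simp

lemma single_mem {P : Submodule ℂ F} {x : F} (hx : x ∈ P) (j i : κ) :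
    (Pi.single j x : κ → F) i ∈ P := by
  rw [Pi.single_apply]
  split_ifs
  · exact hx
  · exact P.zero_mem

lemma EntriesMap.act {X : Matrix κ κ (Module.End ℂ F)} {P S : Submodule ℂ F}
    (hX : EntriesMap X P S) {x : κ → F} (hx : ∀ i, x i ∈ P) (i : κ) : QuantumGL.act X x i ∈ S :=
  S.sum_mem fun j _ => hX i j _ (hx j)

end Act

/-! ### Invertibility of `1 + λ ω J` -/

section Invertible

variable {N : ℕ} {q : ℂ} {F : Type*} [AddCommGroup F] [Module ℂ F]
  {T w L K J : Matrix (Fin N) (Fin N) (Module.End ℂ F)} {v : F}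

namespace FockRep

variable (h : FockRep N q T w L K J v)
include h

lemma u_lowDegree (hq : q ≠ 0) (n : ℕ) :
    EntriesMap (uMat q w J) (lowDegree T w v n) (lowDegree T w v n) := by
  cases n with
  | zero =>
    intro i j x hx
    have : x = 0 := hx
    rw [this, map_zero]
    exact Submodule.zero_mem _
  | succ n =>
    exact (EntriesMap.one _).add (((w_lowDegree n).mul (h.j_lowDegree hq n)).smul _)

/-- `U` fixes the vacuum, and its exchange relations with `T` and `ω` carry preimages of lower
degree to preimages one degree higher. -/
lemma act_u_surjOn (hq : q ≠ 0) (n : ℕ) (x : Fin N → F) (hx : ∀ i, x i ∈ lowDegree T w v n) :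
    ∃ y : Fin N → F, (∀ i, y i ∈ lowDegree T w v n) ∧ act (uMat q w J) y = x := by
  suffices H : ∀ n, ∀ x ∈ lowDegree T w v n, ∀ b, Pi.single b x ∈
      (Submodule.pi (Set.univ : Set (Fin N)) fun _ => lowDegree T w v n).map
        (act (uMat q w J)) by
    have : x ∈ (Submodule.pi (Set.univ : Set (Fin N)) fun _ => lowDegree T w v n).map
        (act (uMat q w J)) := by
      rw [← Finset.univ_sum_single x]
      exact Submodule.sum_mem _ fun i _ => H n _ (hx i) i
    obtain ⟨y, hy, hyx⟩ := this
    exact ⟨y, fun i => hy i trivial, hyx⟩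
  clear! x n
  have hr := RA_mul_inv (N := N) (A := Module.End ℂ F) hq
  have hr' := RA_inv_mul (N := N) (A := Module.End ℂ F) hq
  intro n
  induction n with
  | zero =>
    intro x hx b
    have : x = 0 := hx
    rw [this, Pi.single_zero]
    exact Submodule.zero_mem _
  | succ n ih =>
    intro x hx b
    have ih2 : ∀ x : Fin N × Fin N → F, (∀ i, x i ∈ lowDegree T w v n) →
        ∃ y : Fin N × Fin N → F, (∀ i, y i ∈ lowDegree T w v n) ∧
          act (amp (Fin N) (uMat q w J)) y = x := by
      intro x hx
      have (a : Fin N) : (fun k => x (a, k)) ∈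
          (Submodule.pi (Set.univ : Set (Fin N)) fun _ => lowDegree T w v n).map
            (act (uMat q w J)) := by
        rw [← Finset.univ_sum_single (fun k => x (a, k))]
        exact Submodule.sum_mem _ fun i _ => ih _ (hx _) i
      choose y hy hyx using this
      refine ⟨fun i => y i.1 i.2, fun i => hy i.1 i.2 trivial, ?_⟩
      ext ⟨a, b⟩
      rw [act_amp_apply]
      exact congrFun (hyx a) b
    revert x
    change lowDegree T w v (n + 1) ≤ ((Submodule.pi (Set.univ : Set (Fin N))
      fun _ => lowDegree T w v (n + 1)).map (act (uMat q w J))).comap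
        (LinearMap.single ℂ (fun _ => F) b)
    refine lowDegree_succ_le ?_ ?_ ?_ ?_
    · refine ⟨Pi.single b v, fun i _ => single_mem (vac_mem_lowDegree n) b i, ?_⟩
      ext i
      rw [act_single]
      simp only [uMat, Matrix.add_apply, Matrix.smul_apply,
        LinearMap.add_apply, LinearMap.smul_apply, Matrix.mul_apply, LinearMap.sum_apply,
        Module.End.mul_apply, h.j_vac, map_zero, Finset.sum_const_zero, smul_zero, add_zero,
        Matrix.one_apply, LinearMap.coe_single, Pi.single_apply]
      split_ifs <;> rfl
    · intro x hx
      obtain ⟨y, hy, hyx⟩ := ih x hx b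
      exact ⟨y, fun i _ => lowDegree_le_succ n (hy i trivial), hyx⟩
    · intro e f x hx
      -- Since `U₁ T₂ = T₂ R̂⁻¹ U₂ R̂`, a solution of `U₂ y = R̂ x` in lower degree gives the
      -- preimage `T₂ R̂⁻¹ y` of `T₂ x`.
      obtain ⟨y, hy, hyx⟩ := ih2 (act (RA N q _) (Pi.single (b, f) x))
        ((EntriesMap.RA _).act (single_mem hx (b, f)))
      refine ⟨fun k => act (amp (Fin N) T) (act (RAinv N q _) y) (k, e),
        fun k _ => (t_lowDegree n).amp.act ((EntriesMap.RAinv _).act hy) _, ?_⟩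
      have key : act (ampLeft (uMat q w J)) (act (amp (Fin N) T) (act (RAinv N q _) y)) =
          act (amp (Fin N) T) (Pi.single (b, f) x) := by
        rw [← act_mul_apply, h.ops.u_t hq, ← act_mul_apply,
          mul_assoc _ (RA N q (Module.End ℂ F)), hr, mul_one, act_mul_apply, hyx,
          ← act_mul_apply, mul_assoc _ (RAinv N q (Module.End ℂ F)), hr', mul_one]
      ext a
      have := congrFun key (a, e)
      rw [act_ampLeft_apply] at this
      rw [this, act_single, amp_apply, LinearMap.coe_single, Pi.single_apply]
      dsimp only
      split_ifs <;> rfl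
    · intro e f x hx
      change Pi.single b (w e f x) ∈ (Submodule.pi (Set.univ : Set (Fin N))
        fun _ => lowDegree T w v (n + 1)).map (act (uMat q w J))
      -- The exchange relation yields preimages only of the combinations `R̂⁻¹ ω₂ x`, namely `R̂ ω₂
      -- R̂⁻¹ y` with `U₂ y = R̂ x`; skew invertibility isolates the single vectors.
      refine mem_of_skew_RAinv hq _ (fun c e => Pi.single c (w e f x)) (fun a d => ?_) b e
      obtain ⟨y, hy, hyx⟩ := ih2 (act (RA N q _) (Pi.single (d, f) x))
        ((EntriesMap.RA _).act (single_mem hx (d, f)))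
      have hrel : amp (Fin N) (uMat q w J) * (RA N q _ * amp (Fin N) w * RAinv N q _) =
          RAinv N q _ * amp (Fin N) w * RAinv N q _ * amp (Fin N) (uMat q w J) := by
        calc _ = RAinv N q _ * RA N q _ * amp (Fin N) (uMat q w J) *
              (RA N q _ * amp (Fin N) w * RAinv N q _) := by rw [hr', one_mul]
          _ = RAinv N q _ * (RA N q _ * amp (Fin N) (uMat q w J) * RA N q _ * amp (Fin N) w) *
              RAinv N q _ := by noncomm_ring
          _ = RAinv N q _ * amp (Fin N) w * RAinv N q _ * amp (Fin N) (uMat q w J) *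
              (RA N q _ * RAinv N q _) := by rw [h.ops.u_w hq]; noncomm_ring
          _ = _ := by rw [hr, mul_one]
      have key : act (amp (Fin N) (uMat q w J))
          (act (RA N q _ * amp (Fin N) w * RAinv N q _) y) =
            act (amp (Fin N) 1 * RAinv N q _ * amp (Fin N) w) (Pi.single (d, f) x) := by
        rw [← act_mul_apply, hrel, act_mul_apply, hyx, ← act_mul_apply,
          mul_assoc _ (RAinv N q (Module.End ℂ F)), hr', mul_one, map_one, one_mul]
      refine ⟨fun k => act (RA N q _ * amp (Fin N) w * RAinv N q _) y (a, k), fun k _ =>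
        (((EntriesMap.RA _).mul (w_lowDegree n).amp).mul (.RAinv _)).act hy _, ?_⟩
      ext c
      have := congrFun key (a, c)
      rw [act_amp_apply] at this
      rw [this, act_single, amp_mul_RAinv_mul_amp_apply hq]
      have hone (s t : Fin N) (X : Module.End ℂ F) : ((1 : Matrix (Fin N) (Fin N)
          (Module.End ℂ F)) c t * X) x = (Pi.single t (X x) : Fin N → F) c := by
        rw [Matrix.one_apply, Pi.single_apply]
        split_ifs <;> simp
      by_cases had : a = d
      · simp only [had, if_true, LinearMap.add_apply, LinearMap.sub_apply, LinearMap.smul_apply,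
          LinearMap.sum_apply, hone c, Pi.add_apply, Pi.sub_apply, Pi.smul_apply,
          Finset.sum_apply]
      · simp only [had, if_false, LinearMap.add_apply, LinearMap.sub_apply, LinearMap.smul_apply,
          LinearMap.zero_apply, hone c, Pi.add_apply, Pi.sub_apply, Pi.smul_apply, Pi.zero_apply]

/-- Any column lies in some step of the filtration. That step is finite-dimensional and `U` maps it
onto itself, so `U` is injective there. -/
lemma isUnit_u (hq : q ≠ 0) : IsUnit (uMat q w J) := by
  rw [← MulEquiv.isUnit_map (act (κ := Fin N) (F := F)), Module.End.isUnit_iff]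
  have hbound : ∀ x : Fin N → F, ∃ n, ∀ i, x i ∈ lowDegree T w v n := fun x => by
    choose n hn using fun i => h.exists_mem_lowDegree hq (x i)
    exact ⟨Finset.univ.sup n, fun i => lowDegree_mono (Finset.le_sup (Finset.mem_univ i)) (hn i)⟩
  constructor
  · rw [← LinearMap.ker_eq_bot, LinearMap.ker_eq_bot']
    intro x hx
    obtain ⟨n, hn⟩ := hbound x
    let P := Submodule.pi (Set.univ : Set (Fin N)) fun _ => lowDegree T w v n
    have hP : Module.Finite ℂ P := by
      let g : P →ₗ[ℂ] (Fin N → lowDegree T w v n) := LinearMap.pi fun i =>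
        ((LinearMap.proj i).comp P.subtype).codRestrict _ fun y => y.2 i trivial
      refine Module.Finite.of_injective g fun y z hyz => ?_
      ext i
      exact congrArg Subtype.val (congrFun hyz i)
    let f : P →ₗ[ℂ] P := (act (uMat q w J)).restrict fun y hy i _ =>
      (h.u_lowDegree hq n).act (fun i => hy i trivial) i
    have hf : Function.Surjective f := fun y => by
      obtain ⟨z, hz, hzy⟩ := h.act_u_surjOn hq n y fun i => y.2 i trivial
      exact ⟨⟨z, fun i _ => hz i⟩, Subtype.ext hzy⟩
    have hi := LinearMap.injective_iff_surjective.2 hf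
    have : (⟨x, fun i _ => hn i⟩ : P) = 0 := hi (Subtype.ext (by rw [map_zero]; exact hx))
    exact congrArg Subtype.val this
  · intro x
    obtain ⟨n, hn⟩ := hbound x
    obtain ⟨y, -, hy⟩ := h.act_u_surjOn hq n x hn
    exact ⟨y, hy⟩

end FockRep

end Invertible

end QuantumGL

namespace QuantumGL

/-! ### Entries of `R̂ Z₂ R̂`, numerical and operator-valued -/

section DressSum

variable {ι : Type*} [Fintype ι] [LinearOrder ι] {M : Type*} [AddCommGroup M] [Module ℂ M]

/-- The entries of `R̂ Z₂ R̂`. -/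
def dressSum (q : ℂ) (a b c d : ι) (Z : ι → ι → M) : M :=
  swapCoeff q c d • (swapCoeff q a b • (if b = d then Z a c else 0) +
      stayCoeff q a b • (if a = d then Z b c else 0)) +
    stayCoeff q c d • (swapCoeff q a b • (if b = c then Z a d else 0) +
      stayCoeff q a b • (if a = c then Z b d else 0))

lemma map_dressSum {M' : Type*} [AddCommGroup M'] [Module ℂ M'] (f : M →ₗ[ℂ] M') (q : ℂ)
    (a b c d : ι) (Z : ι → ι → M) :
    f (dressSum q a b c d Z) = dressSum q a b c d fun i j => f (Z i j) := by
  simp only [dressSum, map_add, map_smul, apply_ite f, map_zero]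

lemma dressSum_sum {κ : Type*} (s : Finset κ) (q : ℂ) (a b c d : ι) (g : κ → ι → ι → ℂ)
    (x : κ → M) : dressSum q a b c d (fun i j => ∑ t ∈ s, g t i j • x t) =
      ∑ t ∈ s, dressSum q a b c d (g t) • x t := by
  simp only [dressSum, add_smul, smul_eq_mul, mul_smul, Finset.sum_add_distrib, ite_smul,
    zero_smul, smul_add, ← Finset.smul_sum, Finset.sum_ite_irrel, Finset.sum_const_zero]

/-- Contraction of `R̂ Z₂ R̂` with a row. -/
lemma sum_smul_dressSum (q : ℂ) (f : ι → ι → ℂ) (c d : ι) (Z : ι → ι → M) :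
    ∑ a, ∑ b, f a b • dressSum q a b c d Z =
      swapCoeff q c d • ∑ b, (swapCoeff q d b * f b d + stayCoeff q d b * f d b) • Z b c +
        stayCoeff q c d • ∑ b, (swapCoeff q c b * f b c + stayCoeff q c b * f c b) • Z b d := by
  have h1 (u : ι → ι → ℂ) (z : ι) (W : ι → M) :
      ∑ a, ∑ b, u a b • (if b = z then W a else 0) = ∑ a, u a z • W a := by
    simp
  have h2 (u : ι → ι → ℂ) (z : ι) (W : ι → M) :
      ∑ a, ∑ b, u a b • (if a = z then W b else 0) = ∑ b, u z b • W b := by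
    rw [Finset.sum_comm]
    simp
  have h3 : ∀ a b, f a b • dressSum q a b c d Z =
      swapCoeff q c d • ((f a b * swapCoeff q a b) • (if b = d then Z a c else 0)) +
      stayCoeff q c d • ((f a b * swapCoeff q a b) • (if b = c then Z a d else 0)) +
      (swapCoeff q c d • ((f a b * stayCoeff q a b) • (if a = d then Z b c else 0)) +
      stayCoeff q c d • ((f a b * stayCoeff q a b) • (if a = c then Z b d else 0))) := by
    intro a b
    rw [dressSum]
    module
  simp only [h3, Finset.sum_add_distrib, ← Finset.smul_sum, h1, h2]
  have hs (z b : ι) : swapCoeff q z b * f b z = f b z * swapCoeff q b z := by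
    rw [swapCoeff_comm, mul_comm]
  have ht (z b : ι) : stayCoeff q z b * f z b = f z b * stayCoeff q z b := mul_comm _ _
  simp only [add_smul, Finset.sum_add_distrib, smul_add, hs, ht]
  abel

/-- One scalar combination describes both the Jucys-Murphy step and `R̂ X₂ R̂` for operators
(`RA_amp_RA_apply`); this links exchange relations with Jucys-Murphy elements. -/
lemma dress_apply {ι τ : Type} [Fintype ι] [LinearOrder ι] [Fintype τ] [DecidableEq τ] (q : ℂ)
    (A : Matrix (ι × τ) (ι × τ) ℂ) (a b c d : ι) (t t' : τ) :
    dress q A (a, b, t') (c, d, t) = dressSum q a b c d fun i j => A (i, t') (j, t) := by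
  have h1 : dress q A (a, b, t') (c, d, t) =
      (braid q).mulVec (fun x => (amp ι A * braid q : Matrix _ _ ℂ) x (c, d, t)) (a, b, t') := by
    rw [dress, mul_assoc]; rfl
  have h2 : ∀ x, (amp ι A * braid q : Matrix _ _ ℂ) x (c, d, t) =
      (braid q).mulVec (fun y => amp ι A x y) (c, d, t) := by
    intro x
    conv_rhs => rw [← braid_transpose, Matrix.mulVec_transpose]
    rfl
  rw [h1, braid_mulVec]
  simp only [h2, braid_mulVec, amp_apply, dressSum, smul_eq_mul]
  ring

variable {N : ℕ} {A : Type*} [Ring A] [Algebra ℂ A]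

lemma amp_mul_entry {ι τ : Type*} [Fintype ι] [DecidableEq ι] [Fintype τ] [DecidableEq τ]
    (X : Matrix τ τ A) (M : Matrix (ι × τ) (ι × τ) A) (a : ι) (b : τ) (y : ι × τ) :
    (amp ι X * M) (a, b) y = ∑ b', X b b' * M (a, b') y := by
  rw [Matrix.mul_apply, Fintype.sum_prod_type, Finset.sum_eq_single a]
  · simp
  · intro a' _ ha'
    simp [Ne.symm ha']
  · simp

lemma mul_amp_entry {ι τ : Type*} [Fintype ι] [DecidableEq ι] [Fintype τ] [DecidableEq τ]
    (X : Matrix τ τ A) (M : Matrix (ι × τ) (ι × τ) A) (a : ι) (b : τ) (y : ι × τ) :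
    (M * amp ι X) y (a, b) = ∑ b', M y (a, b') * X b' b := by
  rw [Matrix.mul_apply, Fintype.sum_prod_type, Finset.sum_eq_single a]
  · simp
  · intro a' _ ha'
    simp [ha']
  · simp

lemma RA_amp_RA_apply (q : ℂ) (X : Matrix (Fin N) (Fin N) A) (a b c d : Fin N) :
    (RA N q A * amp (Fin N) X * RA N q A) (a, b) (c, d) = dressSum q a b c d X := by
  simp only [RA_mul_apply, mul_RA_apply, amp_apply, dressSum]

/-- `R̂⁻¹` is the braid matrix for `q⁻¹` and the reversed order of the letters, so the theory of
`dress` applies to it as well. -/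
lemma RAinv_mul_apply {q : ℂ} (hq : q ≠ 0) (X : Matrix (Fin N × Fin N) (Fin N × Fin N) A)
    (a b : Fin N) (y : Fin N × Fin N) : (RAinv N q A * X) (a, b) y =
      swapCoeff q⁻¹ a b • X (b, a) y +
        stayCoeff q⁻¹ (OrderDual.toDual a) (OrderDual.toDual b) • X (a, b) y := by
  have : RAinv N q A = RA N q A - lam q • 1 := by rw [RA_eq hq, add_sub_cancel_right]
  rw [this, sub_mul, Matrix.sub_apply, RA_mul_apply, smul_mul_assoc, one_mul, Matrix.smul_apply]
  rcases lt_trichotomy a b with h | rfl | h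
  · simp [swapCoeff, stayCoeff, h, h.ne, h.not_gt]
  · simp [swapCoeff, stayCoeff, lam, sub_smul]
  · simp [swapCoeff, stayCoeff, h, h.ne', h.not_gt, lam, sub_smul]
    abel

lemma mul_RAinv_apply {q : ℂ} (hq : q ≠ 0) (X : Matrix (Fin N × Fin N) (Fin N × Fin N) A)
    (c d : Fin N) (y : Fin N × Fin N) : (X * RAinv N q A) y (c, d) =
      swapCoeff q⁻¹ c d • X y (d, c) +
        stayCoeff q⁻¹ (OrderDual.toDual c) (OrderDual.toDual d) • X y (c, d) := by
  have : RAinv N q A = RA N q A - lam q • 1 := by rw [RA_eq hq, add_sub_cancel_right]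
  rw [this, mul_sub, Matrix.sub_apply, mul_RA_apply, mul_smul_comm, mul_one, Matrix.smul_apply]
  rcases lt_trichotomy c d with h | rfl | h
  · simp [swapCoeff, stayCoeff, h, h.ne, h.not_gt]
  · simp [swapCoeff, stayCoeff, lam, sub_smul]
  · simp [swapCoeff, stayCoeff, h, h.ne', h.not_gt, lam, sub_smul]
    abel

lemma RAinv_amp_RAinv_apply {q : ℂ} (hq : q ≠ 0) (X : Matrix (Fin N) (Fin N) A)
    (a b c d : Fin N) : (RAinv N q A * amp (Fin N) X * RAinv N q A) (a, b) (c, d) =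
      dressSum q⁻¹ (OrderDual.toDual a) (OrderDual.toDual b) (OrderDual.toDual c)
        (OrderDual.toDual d) fun i j => X (OrderDual.ofDual i) (OrderDual.ofDual j) := by
  simp only [RAinv_mul_apply hq, mul_RAinv_apply hq, amp_apply, dressSum]
  rfl

end DressSum

/-! ### Families of vectors on which operators act through Jucys-Murphy elements -/

section Covariant

variable {ι : Type} [Fintype ι] [LinearOrder ι] {F : Type*} [AddCommGroup F] [Module ℂ F]
  {τ : Type} [Fintype τ] [DecidableEq τ]

/-- The operators `X` act on the family `e` through the matrix `κ A`. -/
def IsCovariant (X : ι → ι → Module.End ℂ F) (κ : ℂ) (A : Matrix (ι × τ) (ι × τ) ℂ)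
    (e : τ → F) : Prop :=
  ∀ i j t, X i j (e t) = κ • ∑ t', A (i, t') (j, t) • e t'

/-- Passing `T` replaces `X` by `R̂ X₂ R̂`, so a further letter `T` is a further tensor factor and
dresses `A`. -/
lemma IsCovariant.step {q κ : ℂ} {X T : ι → ι → Module.End ℂ F} {A : Matrix (ι × τ) (ι × τ) ℂ}
    {e : τ → F} (h : IsCovariant X κ A e)
    (hT : ∀ a b c d, X a c * T b d = ∑ b', T b b' * dressSum q a b' c d X) (b : ι) :
    IsCovariant X κ (dress q A) fun s : ι × τ => T b s.1 (e s.2) := by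
  intro a c s
  obtain ⟨d, t⟩ := s
  rw [← Module.End.mul_apply, hT, LinearMap.sum_apply, Fintype.sum_prod_type, Finset.smul_sum]
  refine Finset.sum_congr rfl fun b' _ => ?_
  have h1 := map_dressSum (LinearMap.applyₗ (R := ℂ) (M := F) (M₂ := F) (e t)) q a b' c d X
  simp only [LinearMap.applyₗ_apply_apply] at h1
  rw [Module.End.mul_apply, h1]
  have h2 : (fun i j => X i j (e t)) = fun i j => ∑ t', A (i, t') (j, t) • κ • e t' := by
    ext i j
    rw [h, Finset.smul_sum]
    exact Finset.sum_congr rfl fun t' _ => smul_comm _ _ _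
  rw [h2, dressSum_sum (κ := τ) Finset.univ q a b' c d (fun t' i j => A (i, t') (j, t)), map_sum,
    Finset.smul_sum]
  refine Finset.sum_congr rfl fun t' _ => ?_
  rw [dress_apply, map_smul, map_smul, smul_comm]

/-- The commutator of `Z` with `T` returns `T X`, on which `X` acts through `A`; this is the summand
that `C` gains with the new factor. -/
lemma IsCovariant.step_trace {κ c z : ℂ} {X T : ι → ι → Module.End ℂ F}
    {A : Matrix (ι × τ) (ι × τ) ℂ} {C : Matrix τ τ ℂ} {e : τ → F} (h : IsCovariant X κ A e)
    {Z : Module.End ℂ F} (hZ : ∀ b d, Z * T b d = T b d * Z - c • ∑ k, T b k * X k d)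
    (htr : ∀ t, Z (e t) = z • e t + (-(c * κ)) • ∑ t', C t' t • e t') (b : ι) (s : ι × τ) :
    Z (T b s.1 (e s.2)) = z • T b s.1 (e s.2) +
      (-(c * κ)) • ∑ s', (amp ι C + A) s' s • T b s'.1 (e s'.2) := by
  obtain ⟨d, t⟩ := s
  have h1 := LinearMap.congr_fun (hZ b d) (e t)
  have h2 : ∀ k, T b k (X k d (e t)) = κ • ∑ t', A (k, t') (d, t) • T b k (e t') := fun k => by
    rw [h, map_smul, map_sum]
    simp only [map_smul]
  simp only [Module.End.mul_apply, LinearMap.sub_apply, LinearMap.smul_apply, LinearMap.sum_apply,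
    htr, h2, map_add, map_smul, map_sum, ← Finset.smul_sum] at h1
  have h3 : ∑ s' : ι × τ, (amp ι C + A) s' (d, t) • T b s'.1 (e s'.2) =
      ∑ t', C t' t • T b d (e t') + ∑ k, ∑ t', A (k, t') (d, t) • T b k (e t') := by
    simp only [Matrix.add_apply, add_smul, Finset.sum_add_distrib, amp_apply]
    rw [Fintype.sum_prod_type, Fintype.sum_prod_type, Finset.sum_eq_single d]
    · simp
    · intro k _ hk
      simp [hk]
    · simp
  rw [h3, h1]
  module

/-- An operator that acts on a family of vectors through a semisimple matrix is diagonalizable on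
the span of the family. -/
lemma mem_iSup_eigenspace {f : Module.End ℂ F} {C : Matrix τ τ ℂ} {e : τ → F} (c d : ℂ)
    (hC : Module.End.IsSemisimple (Matrix.toLin' C))
    (h : ∀ t, f (e t) = c • e t + d • ∑ t', C t' t • e t') (t : τ) :
    e t ∈ ⨆ μ, f.eigenspace μ := by
  let Θ : (τ → ℂ) →ₗ[ℂ] F := Fintype.linearCombination ℂ e
  have hΘ : ∀ y, f (Θ y) = c • Θ y + d • Θ (C.mulVec y) := by
    intro y
    simp only [Θ, Fintype.linearCombination_apply, map_sum, map_smul, h, smul_add,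
      Finset.sum_add_distrib, Finset.smul_sum, Matrix.mulVec, dotProduct, Finset.sum_smul]
    congr 1
    · exact Finset.sum_congr rfl fun _ _ => smul_comm _ _ _
    · rw [Finset.sum_comm]
      refine Finset.sum_congr rfl fun _ _ => Finset.sum_congr rfl fun _ _ => ?_
      simp only [smul_smul]
      ring_nf
  have hs : (⨆ μ, Module.End.eigenspace (Matrix.toLin' C) μ) = ⊤ :=
    hC.iSup_eigenspace_eq_top
  have : Pi.single t 1 ∈ ⨆ μ, Module.End.eigenspace (Matrix.toLin' C) μ := hs ▸ Submodule.mem_top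
  have h2 : e t = Θ (Pi.single t 1) := by
    simp [Θ, Fintype.linearCombination_apply, Pi.single_apply]
  rw [h2]
  suffices (⨆ μ, Module.End.eigenspace (Matrix.toLin' C) μ) ≤ (⨆ μ, f.eigenspace μ).comap Θ from this ‹_›
  refine iSup_le fun μ y hy => ?_
  refine Submodule.mem_iSup_of_mem (c + d * μ) ?_
  rw [Module.End.mem_eigenspace_iff] at hy ⊢
  rw [Matrix.toLin'_apply] at hy
  rw [hΘ, hy, map_smul, add_smul, mul_smul]

end Covariant

/-! ### The quantum trace of a Jucys-Murphy element -/

section QTrace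

variable {N : ℕ} {q : ℂ} {τ : Type} [Fintype τ] [DecidableEq τ]

/-- The quantum trace of `A` over its first space is a linear function of `C`. -/
def HasTrace (N : ℕ) (q : ℂ) (A : Matrix (Fin N × τ) (Fin N × τ) ℂ) (C : Matrix τ τ ℂ) : Prop :=
  ∀ t' t, ∑ i, qWeight N q i * A (i, t') (i, t) =
    (∑ i, qWeight N q i) * (1 : Matrix τ τ ℂ) t' t + lam q * q ^ (2 * (N : ℤ)) * C t' t

lemma hasTrace_unit : HasTrace N q (τ := Unit) 1 0 := by
  intro t' t
  simp

/-- An instance of `ptr_RA_amp_RA` with entries in `Matrix τ τ ℂ`; its excess term is the multiple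
of `A` by which `C` grows. -/
lemma HasTrace.step (hq : q ≠ 0) {A : Matrix (Fin N × τ) (Fin N × τ) ℂ} {C : Matrix τ τ ℂ}
    (h : HasTrace N q A C) : HasTrace N q (dress q A) (amp (Fin N) C + A) := by
  rintro ⟨b, t'⟩ ⟨d, t⟩
  let X : Matrix (Fin N) (Fin N) (Matrix τ τ ℂ) :=
    Matrix.of fun i j => Matrix.of fun s' s => A (i, s') (j, s)
  have h1 := congrFun (congrFun (congrFun (congrFun (ptr_RA_amp_RA hq X) b) d) t') t
  rw [ptr_apply] at h1
  simp only [RA_amp_RA_apply] at h1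
  have h2 : ∀ a, (dressSum q a b a d X) t' t = dress q A (a, b, t') (a, d, t) := by
    intro a
    rw [dress_apply]
    exact map_dressSum (Matrix.entryLinearMap ℂ ℂ t' t) q a b a d X
  have h3 : qTr q X t' t = ∑ i, qWeight N q i * A (i, t') (i, t) := by
    simp [qTr, Matrix.sum_apply, X]
  simp only [Matrix.sum_apply, Matrix.smul_apply, h2, smul_eq_mul, Matrix.add_apply] at h1
  have h4 : X b d t' t = A (b, t') (d, t) := rfl
  rw [h1, h4, Matrix.add_apply, amp_apply, Matrix.diagonal_apply]
  by_cases hbd : b = d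
  · subst hbd
    have h5 : (1 : Matrix (Fin N × τ) (Fin N × τ) ℂ) (b, t') (b, t) =
        (1 : Matrix τ τ ℂ) t' t := by simp [Matrix.one_apply]
    rw [if_pos rfl, if_pos rfl, h3, h t' t, h5]
    ring
  · simp [hbd]

end QTrace

end QuantumGL

namespace QuantumGL

/-! ### Dressing an operator by a whole word -/

section DressWord

variable {ι : Type} [Fintype ι] [LinearOrder ι] {M : Type*} [AddCommGroup M] [Module ℂ M]

/-- Right multiplication by a matrix acting on the last letter. -/
def lastMul (Z : ι → ι → M) : (List ι → ℂ) → List ι → M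
  | _, [] => 0
  | f, [d] => ∑ x, f [x] • Z x d
  | f, a :: b :: l => lastMul Z (fun u => f (a :: u)) (b :: l)

lemma lastMul_append (Z : ι → ι → M) (f : List ι → ℂ) (l : List ι) (d : ι) :
    lastMul Z f (l ++ [d]) = ∑ x, f (l ++ [x]) • Z x d := by
  induction l generalizing f with
  | nil => rfl
  | cons a l ih =>
    cases l with
    | nil => rfl
    | cons b l => exact ih _

/-- Right multiplication by `R̂₁ ⋯ R̂ₙ Zₙ₊₁ R̂ₙ ⋯ R̂₁`. -/
def dressWord (q : ℂ) (n : ℕ) (Z : ι → ι → M) (f : List ι → ℂ) : List ι → M :=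
  ascend q n (lastMul Z (descend q n f))

lemma dressWord_succ (q : ℂ) (n : ℕ) (Z : ι → ι → M) (f : List ι → ℂ) (j k : ι) (l : List ι) :
    dressWord q (n + 1) Z f (j :: k :: l) =
      swapCoeff q j k • dressWord q n Z (fun u => listBraid q f (k :: u)) (j :: l) +
        stayCoeff q j k • dressWord q n Z (fun u => listBraid q f (j :: u)) (k :: l) := by
  have h (c d : ι) : ascend q n (fun u => lastMul Z (descend q (n + 1) f) (c :: u)) (d :: l) =
      dressWord q n Z (fun u => listBraid q f (c :: u)) (d :: l) := by
    refine ascend_congr fun u hu => ?_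
    match u with
    | [] => simp at hu
    | b :: u => rfl
  rw [dressWord, ascend_succ_cons, h, h]

lemma dressWord_one (q : ℂ) (Z : ι → ι → M) (f : List ι → ℂ) (j y : ι) :
    dressWord q 1 Z f [j, y] = ∑ a, ∑ b, f [a, b] • dressSum q a b j y Z := by
  rw [dressWord_succ, sum_smul_dressSum q (fun a b => f [a, b])]
  rfl

end DressWord

/-! ### Trading a dual index for `N - 1` ordinary ones -/

section Extension

variable {N : ℕ} {q : ℂ} {F : Type*} [AddCommGroup F] [Module ℂ F]
  {L : Fin N → Fin N → Module.End ℂ F}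

/-- Prefixing words of `n` letters to a family on which `R̂ L₂ R̂` acts through `κ A`. -/
lemma exists_prefixed {σ : Type} [Fintype σ] [DecidableEq σ] {x : Fin N → σ → F} {κ : ℂ}
    {A : ℂ → Matrix (Fin N × σ) (Fin N × σ) ℂ} {C : ℂ → Matrix σ σ ℂ} {m : ℕ} (hq : q ≠ 0)
    (hA : IsJucysMurphy A C m) (htr : HasTrace N q (A q) (C q))
    (hx : ∀ a b j s, ∑ y, dressSum q a b j y L (x y s) =
      κ • ∑ s', A q (a, s') (j, s) • x b s') (n : ℕ) :
    ∃ (ρ : Type) (_ : Fintype ρ) (_ : DecidableEq ρ)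
      (A' : ℂ → Matrix (Fin N × ρ) (Fin N × ρ) ℂ) (C' : ℂ → Matrix ρ ρ ℂ) (m' : ℕ)
      (word : ρ → List (Fin N)) (last : ρ → σ),
      IsJucysMurphy A' C' m' ∧ HasTrace N q (A' q) (C' q) ∧ (∀ r, (word r).length = n) ∧
      (∀ l s, l.length = n → ∃ r, word r = l ∧ last r = s) ∧
      ∀ (f : List (Fin N) → ℂ) (j : Fin N) (r : ρ),
        ∑ y, dressWord q (n + 1) L f (j :: (word r ++ [y])) (x y (last r)) =
          κ • ∑ r', ∑ b, (∑ i, f (i :: (word r' ++ [b])) * A' q (i, r') (j, r)) •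
            x b (last r') := by
  induction n with
  | zero =>
    refine ⟨σ, inferInstance, inferInstance, A, C, m, fun _ => [], id, hA, htr, fun _ => rfl,
      fun l s hl => ⟨s, (List.length_eq_zero_iff.1 hl).symm, rfl⟩, fun f j r => ?_⟩
    simp only [zero_add, List.nil_append, dressWord_one, LinearMap.sum_apply,
      LinearMap.smul_apply, id]
    calc ∑ y, ∑ a, ∑ b, f [a, b] • dressSum q a b j y L (x y r)
        = ∑ a, ∑ b, f [a, b] • ∑ y, dressSum q a b j y L (x y r) := by
          simp only [Finset.smul_sum]
          rw [Finset.sum_comm]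
          exact Finset.sum_congr rfl fun a _ => Finset.sum_comm
      _ = ∑ a, ∑ b, ∑ r', κ • (f [a, b] * A q (a, r') (j, r)) • x b r' := by
          refine Finset.sum_congr rfl fun a _ => Finset.sum_congr rfl fun b _ => ?_
          rw [hx, smul_comm, Finset.smul_sum, Finset.smul_sum]
          simp only [mul_smul]
      _ = _ := by
          simp only [Finset.smul_sum, Finset.sum_smul]
          rw [Finset.sum_comm]
          refine (Finset.sum_congr rfl fun b _ => Finset.sum_comm).trans ?_
          exact Finset.sum_comm
  | succ n ih =>
    obtain ⟨ρ, _, _, A', C', m', word, last, hA', htr', hlen, hsurj, hf⟩ := ih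
    refine ⟨Fin N × ρ, inferInstance, inferInstance, _, _, _, fun r => r.1 :: word r.2,
      fun r => last r.2, hA'.step, htr'.step hq, fun r => by simp [hlen], fun l s hl => ?_, ?_⟩
    · match l with
      | k :: l =>
        obtain ⟨r, hr, hr'⟩ := hsurj l s (by simpa using hl)
        exact ⟨(k, r), congrArg _ hr, hr'⟩
    · rintro f j ⟨k, r⟩
      simp only [List.cons_append, dressWord_succ q (n + 1), LinearMap.add_apply,
        LinearMap.smul_apply, Finset.sum_add_distrib, ← Finset.smul_sum, hf]
      rw [smul_comm _ κ, smul_comm _ κ, ← smul_add]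
      congr 1
      have h1 : ∀ (r' : ρ) (b : Fin N),
          ∑ k', (∑ i, f (i :: k' :: (word r' ++ [b])) *
            dress q (A' q) (i, k', r') (j, k, r)) • x b (last r') =
          (swapCoeff q j k * ∑ i, listBraid q f (k :: i :: (word r' ++ [b])) *
              A' q (i, r') (j, r) +
            stayCoeff q j k * ∑ i, listBraid q f (j :: i :: (word r' ++ [b])) *
              A' q (i, r') (k, r)) • x b (last r') := by
        intro r' b
        rw [← Finset.sum_smul, Finset.sum_comm]
        congr 1
        simp only [dress_apply]
        exact sum_smul_dressSum q (fun i k' => f (i :: k' :: (word r' ++ [b]))) j k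
          (fun i j => A' q (i, r') (j, r))
      rw [Fintype.sum_prod_type_right, Finset.smul_sum, Finset.smul_sum, ← Finset.sum_add_distrib]
      refine Finset.sum_congr rfl fun r' _ => ?_
      rw [Finset.smul_sum, Finset.smul_sum, ← Finset.sum_add_distrib]
      refine Eq.trans (Finset.sum_congr rfl fun b _ => ?_) Finset.sum_comm
      rw [h1, add_smul, mul_smul, mul_smul]

/-- Antisymmetrization turns such a family into one on which `L` acts. -/
lemma isCovariant_eps {n : ℕ} (hN : N = n + 1) (hq : q ≠ 0) (hq4 : q ^ 4 ≠ 1) {ρ σ : Type}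
    [Fintype ρ] [DecidableEq ρ] {x : Fin N → σ → F} {κ : ℂ}
    {A : Matrix (Fin N × ρ) (Fin N × ρ) ℂ} {word : ρ → List (Fin N)} {last : ρ → σ}
    (hlen : ∀ r, (word r).length = n)
    (hf : ∀ (f : List (Fin N) → ℂ) (j : Fin N) (r : ρ),
        ∑ y, dressWord q (n + 1) L f (j :: (word r ++ [y])) (x y (last r)) =
          κ • ∑ r', ∑ b, (∑ i, f (i :: (word r' ++ [b])) * A (i, r') (j, r)) •
            x b (last r')) :
    IsCovariant L ((q * q)⁻¹ * κ) A
      fun r => ∑ b, eps q (word r ++ [b]) • x b (last r) := by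
  intro a j r
  -- The row `f` is chosen as `δ` in the first letter times the `q`-antisymmetric tensor in the
  -- others. Going through the antisymmetrizer and back costs a factor `q` each way, so the dressed
  -- operator collapses to `q²` times the tensor times `L a j`.
  let h : List (Fin N) → ℂ
    | [] => 0
    | i :: u => if a = i then eps q u else 0
  have key : ∀ y, dressWord q (n + 1) L h (j :: (word r ++ [y])) =
      (q * q * eps q (word r ++ [y])) • L a j := by
    intro y
    rw [← hN]
    unfold dressWord
    have h1 : ascend q N (lastMul L (descend q N h)) (j :: (word r ++ [y])) =
        ascend q N (fun u => ∑ z, (if u.getLast? = some z then eps q u.dropLast else 0) •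
          (q • L a z)) (j :: (word r ++ [y])) := by
      refine ascend_congr fun u hu => ?_
      have hu0 : u ≠ [] := by rintro rfl; simp at hu
      have hl : u.dropLast.length = N := by
        rw [List.length_dropLast, hu]
        simp [hlen, hN]
      obtain ⟨l, d, rfl⟩ : ∃ l d, u = l ++ [d] :=
        ⟨_, _, (List.dropLast_append_getLast hu0).symm⟩
      rw [List.dropLast_concat] at hl
      rw [lastMul_append]
      simp only [descend_eps hq hq4 a _ hl h (fun _ _ => rfl), List.getLast?_concat,
        List.dropLast_concat, Option.some.injEq, ite_smul, zero_smul, Finset.sum_ite_eq,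
        Finset.mem_univ, if_true]
      rw [smul_smul, mul_comm]
    rw [h1, ascend_sum]
    have h2 : ∀ z, ascend q N (fun u : List (Fin N) =>
        if u.getLast? = some z then eps q u.dropLast else 0) (j :: (word r ++ [y])) =
          if z = j then q * eps q (word r ++ [y]) else 0 := fun z =>
      ascend_eps hq hq4 z j (by simp [hlen, hN]) _ fun u d => by simp [eq_comm]
    simp only [h2, ite_smul, zero_smul, Finset.sum_ite_eq', Finset.mem_univ, if_true]
    rw [smul_smul]
    congr 1
    ring
  have hfr := hf h j r
  simp only [key, LinearMap.smul_apply, h, ite_mul, zero_mul, Finset.sum_ite_eq, Finset.mem_univ,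
    if_true, mul_smul, ← Finset.smul_sum] at hfr
  rw [map_sum]
  simp only [map_smul, mul_smul]
  have hqq : q * q ≠ 0 := mul_ne_zero hq hq
  rw [eq_inv_smul_iff₀ hqq, mul_smul, hfr]
  simp only [Finset.smul_sum, smul_smul, mul_comm]

end Extension

end QuantumGL

namespace QuantumGL

lemma entriesMap_span {F : Type*} [AddCommGroup F] [Module ℂ F] {κ : Type*} [Fintype κ]
    [DecidableEq κ] {X : Matrix κ κ (Module.End ℂ F)} {s : Set F} {S : Submodule ℂ F}
    (h : ∀ i j, ∀ x ∈ s, X i j x ∈ S) : EntriesMap X (Submodule.span ℂ s) S := fun i j =>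
  (Submodule.span_le (p := S.comap (X i j))).2 fun x hx => h i j x hx

lemma EntriesMap.bot {F : Type*} [AddCommGroup F] [Module ℂ F] {κ : Type*} [Fintype κ]
    [DecidableEq κ] (X : Matrix κ κ (Module.End ℂ F)) : EntriesMap X ⊥ ⊥ := by
  intro i j x hx
  rw [(Submodule.mem_bot ℂ).1 hx, map_zero]
  exact Submodule.zero_mem _

/-! ### Diagonalizability of `Tr_q L` -/

section VectorFields

variable {N : ℕ} {q : ℂ} {F : Type*} [AddCommGroup F] [Module ℂ F]
  {T w L K J : Matrix (Fin N) (Fin N) (Module.End ℂ F)} {v : F}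

/-- The members of families on which `L` acts through a Jucys-Murphy element. -/
def IsCovariantVector (q : ℂ) (L : Matrix (Fin N) (Fin N) (Module.End ℂ F)) (x : F) : Prop :=
  ∃ (τ : Type) (_ : Fintype τ) (_ : DecidableEq τ) (A : ℂ → Matrix (Fin N × τ) (Fin N × τ) ℂ)
    (C : ℂ → Matrix τ τ ℂ) (m : ℕ) (κ : ℂ) (e : τ → F) (t : τ),
    IsJucysMurphy A C m ∧ HasTrace N q (A q) (C q) ∧ IsCovariant (fun i j => L i j) κ (A q) e ∧ x = e t

/-- By `HasTrace`, `Tr_q L` acts on the family through `κ (Tr_q 1 + λ q^(2N) C)`, and `C` is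
semisimple. -/
lemma IsCovariantVector.mem_iSup_eigenspace (hq0 : q ≠ 0) (hq : ∀ n : ℕ, 0 < n → q ^ n ≠ 1) {x : F}
    (h : IsCovariantVector q L x) : x ∈ ⨆ μ, (qTr q L).eigenspace μ := by
  obtain ⟨τ, _, _, A, C, m, κ, e, t, hA, htr, he, rfl⟩ := h
  refine QuantumGL.mem_iSup_eigenspace (κ * ∑ i, qWeight N q i) (κ * (lam q * q ^ (2 * (N : ℤ))))
    (hA.ss q hq0 hq) (fun t => ?_) t
  have he' : ∀ i, L i i (e t) = κ • ∑ t', A q (i, t') (i, t) • e t' := fun i => he i i t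
  have h1 : qTr q L (e t) = κ • ∑ t', (∑ i, qWeight N q i * A q (i, t') (i, t)) • e t' := by
    rw [qTr, LinearMap.sum_apply]
    simp only [LinearMap.smul_apply, he', smul_comm _ κ, ← Finset.smul_sum]
    congr 1
    simp only [Finset.smul_sum, Finset.sum_smul, smul_smul]
    rw [Finset.sum_comm]
  have htr' : ∀ t', ∑ i, qWeight N q i * A q (i, t') (i, t) = (∑ i, qWeight N q i) *
      (1 : Matrix τ τ ℂ) t' t + lam q * q ^ (2 * (N : ℤ)) * C q t' t := fun t' => htr t' t
  simp only [htr', Matrix.one_apply, add_smul, Finset.sum_add_distrib, mul_ite, mul_one, mul_zero,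
    ite_smul, zero_smul, Finset.sum_ite_eq', Finset.mem_univ, if_true, smul_add,
    mul_smul, ← Finset.smul_sum] at h1
  rw [h1]
  simp only [mul_smul]

lemma IsCovariantVector.t_apply (h : DiffOps N q T w L K J) (hq0 : q ≠ 0) {x : F}
    (hx : IsCovariantVector q L x) (b d : Fin N) : IsCovariantVector q L (T b d x) := by
  obtain ⟨τ, _, _, A, C, m, κ, e, t, hA, htr, he, rfl⟩ := hx
  refine ⟨_, inferInstance, inferInstance, _, _, _, κ, fun s => T b s.1 (e s.2), (d, t), hA.step,
    htr.step hq0, he.step (T := fun i j => T i j) (fun a b c d => ?_) b, rfl⟩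
  have := congrFun (congrFun h.lt (a, b)) (c, d)
  rw [ampLeft_mul_amp_apply, mul_assoc, mul_assoc, amp_mul_entry] at this
  rw [this]
  refine Finset.sum_congr rfl fun b' _ => ?_
  rw [← mul_assoc, RA_amp_RA_apply]

/-- Because `R̂ L₂ R̂` commutes with `ω₂`, the lower index of `ω` behaves as a new tensor factor,
while the upper one is contracted on the wrong side. Prefixing `N - 1` letters and antisymmetrizing
them with the upper index repairs this. -/
lemma IsCovariantVector.w_apply (h : DiffOps N q T w L K J) (hq0 : q ≠ 0) (hq4 : q ^ 4 ≠ 1) {z : F}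
    (hz : IsCovariantVector q L z) (b c : Fin N) :
    w b c z ∈ Submodule.span ℂ {x | IsCovariantVector q L x} := by
  obtain ⟨τ, _, _, A, C, m, κ, e, t, hA, htr, he, rfl⟩ := hz
  obtain ⟨n, rfl⟩ : ∃ n, N = n + 1 := ⟨N - 1, by have := b.2; omega⟩
  let x : Fin (n + 1) → Fin (n + 1) × τ → F := fun b s => w b s.1 (e s.2)
  have hx : ∀ a b j s, ∑ y, dressSum q a b j y (fun i j => L i j) (x y s) =
      κ • ∑ s', dress q (A q) (a, s') (j, s) • x b s' := by
    rintro a b j ⟨c, t⟩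
    have h1 := LinearMap.congr_fun (congrFun (congrFun h.wl (a, b)) (j, c)) (e t)
    rw [mul_assoc, mul_assoc, ← mul_assoc (RA (n + 1) q _), amp_mul_entry, mul_amp_entry] at h1
    simp only [RA_amp_RA_apply, LinearMap.sum_apply, Module.End.mul_apply] at h1
    refine h1.symm.trans ?_
    rw [Fintype.sum_prod_type, Finset.smul_sum]
    refine Finset.sum_congr rfl fun b' _ => ?_
    have h2 := map_dressSum (LinearMap.applyₗ (R := ℂ) (M := F) (M₂ := F) (e t)) q a b' j c
      fun i j => L i j
    simp only [LinearMap.applyₗ_apply_apply] at h2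
    have h3 : (fun i j => L i j (e t)) = fun i j => ∑ t', A q (i, t') (j, t) • κ • e t' := by
      ext i j
      rw [show L i j (e t) = κ • ∑ t', A q (i, t') (j, t) • e t' from he i j t, Finset.smul_sum]
      exact Finset.sum_congr rfl fun t' _ => smul_comm _ _ _
    rw [h2, h3, dressSum_sum (κ := τ) Finset.univ q a b' j c (fun t' i j => A q (i, t') (j, t)),
      map_sum, Finset.smul_sum]
    refine Finset.sum_congr rfl fun t' _ => ?_
    rw [dress_apply, map_smul, map_smul, smul_comm]
  obtain ⟨ρ, _, _, A', C', m', word, last, hA', htr', hlen, hsurj, hf⟩ :=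
    exists_prefixed hq0 hA.step (htr.step hq0) hx n
  have hcov := isCovariant_eps rfl hq0 hq4 hlen hf
  -- The prefix is the sorted list of all letters except `b`: in the antisymmetrized sum every `b' ≠
  -- b` repeats a letter, and only a nonzero multiple of `ω b c z` remains.
  obtain ⟨r, hr, hr'⟩ := hsurj ((List.finRange (n + 1)).erase b) (c, t)
    (by rw [List.length_erase_of_mem (List.mem_finRange b), List.length_finRange]; rfl)
  have hmem : (∑ b', eps q (word r ++ [b']) • x b' (last r)) ∈
      Submodule.span ℂ {x | IsCovariantVector q L x} :=
    Submodule.subset_span ⟨ρ, _, _, A', C', m', _, _, r, hA', htr', hcov, rfl⟩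
  have hnd : ((List.finRange (n + 1)).erase b).Nodup := (List.nodup_finRange _).erase b
  rw [hr, hr', Finset.sum_eq_single b] at hmem
  · refine (Submodule.smul_mem_iff _ (eps_ne_zero hq0 ?_)).1 hmem
    rw [List.nodup_append]
    refine ⟨hnd, List.nodup_singleton _, fun a ha a' ha' => ?_⟩
    rw [List.mem_singleton] at ha'
    subst ha'
    exact ((List.nodup_finRange _).mem_erase_iff.1 ha).1
  · intro b' _ hb'
    rw [eps_eq_zero, zero_smul]
    intro hn
    refine (List.nodup_append.1 hn).2.2 b' ?_ b' (by simp) rfl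
    exact (List.nodup_finRange _).mem_erase_iff.2 ⟨hb', List.mem_finRange _⟩
  · simp

/-- The quantum trace of `L` is diagonalizable. -/
lemma FockRep.iSup_eigenspace_qTr_l (h : FockRep N q T w L K J v) (hq0 : q ≠ 0)
    (hq : ∀ n : ℕ, 0 < n → q ^ n ≠ 1) : ⨆ μ, (qTr q L).eigenspace μ = ⊤ := by
  have htop : Submodule.span ℂ {x | IsCovariantVector q L x} = ⊤ := by
    refine h.eq_top hq0 (Submodule.subset_span ?_) (entriesMap_span fun b d x hx => ?_)
      (entriesMap_span fun b c x hx => hx.w_apply h.ops hq0 (hq 4 (by norm_num)) b c)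
    · refine ⟨Unit, _, inferInstance, _, _, _, 1, fun _ => v, (), isJucysMurphy_unit, hasTrace_unit,
        fun i j t => ?_, rfl⟩
      simp [h.l_vac, Matrix.one_apply]
    · exact Submodule.subset_span (hx.t_apply h.ops hq0 b d)
  rw [eq_top_iff, ← htop, Submodule.span_le]
  exact fun x hx => hx.mem_iSup_eigenspace hq0 hq

end VectorFields

/-! ### Diagonalizability of `Tr_q Y` -/

section Casimir

variable {N : ℕ} {q : ℂ} {F : Type*} [AddCommGroup F] [Module ℂ F]
  {T w L K J : Matrix (Fin N) (Fin N) (Module.End ℂ F)} {v : F}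

/-- The vectors on which `Y` is the scalar `κ` and `Tr_q Y` is the scalar `z`. -/
def scalarVectors (q : ℂ) (Y : Matrix (Fin N) (Fin N) (Module.End ℂ F)) (κ z : ℂ) :
    Submodule ℂ F :=
  (⨅ i, ⨅ j, LinearMap.ker (Y i j - (if i = j then κ else 0) • (1 : Module.End ℂ F))) ⊓
    (qTr q Y).eigenspace z

lemma mem_scalarVectors {Y : Matrix (Fin N) (Fin N) (Module.End ℂ F)} {κ z : ℂ} {x : F} :
    x ∈ scalarVectors q Y κ z ↔ (∀ i j, Y i j x = (if i = j then κ else 0) • x) ∧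
      qTr q Y x = z • x := by
  simp only [scalarVectors, Submodule.mem_inf, Submodule.mem_iInf, LinearMap.mem_ker,
    LinearMap.sub_apply, LinearMap.smul_apply, Module.End.one_apply, sub_eq_zero,
    Module.End.mem_eigenspace_iff]

/-- The exchange relation of `Y` with `ω` is also satisfied by scalars, hence by `Y - κ`, which can
be moved to the right of `ω`. Skew invertibility separates the entries, and `Tr_q Y` commutes with
`ω`. -/
lemma DiffOps.w_scalarVectors (h : DiffOps N q T w L K J) (hq0 : q ≠ 0) (κ z : ℂ) :
    EntriesMap w (scalarVectors q (yMat q w K J) κ z) (scalarVectors q (yMat q w K J) κ z) := by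
  set Y := yMat q w K J with hY
  have h0 : EntriesMap (Y - κ • 1) (scalarVectors q Y κ z) ⊥ := by
    intro i j x hx
    rw [mem_scalarVectors] at hx
    rw [Submodule.mem_bot, Matrix.sub_apply, LinearMap.sub_apply, hx.1, Matrix.smul_apply,
      Matrix.one_apply]
    split_ifs <;> simp
  have h1 : amp (Fin N) (Y - κ • 1) * RAinv N q (Module.End ℂ F) * amp (Fin N) w =
      RAinv N q _ * amp (Fin N) w * RAinv N q _ * amp (Fin N) (Y - κ • 1) * RA N q _ := by
    have hr' := RA_inv_mul (N := N) (A := Module.End ℂ F) hq0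
    calc _ = RAinv N q _ * (RA N q (Module.End ℂ F) * amp (Fin N) Y * RAinv N q _ *
          amp (Fin N) w) - κ • (RAinv N q _ * amp (Fin N) w) := by
          rw [map_sub, map_smul, map_one, sub_mul, sub_mul, smul_mul_assoc, one_mul,
            smul_mul_assoc, ← mul_assoc, ← mul_assoc, ← mul_assoc, hr', one_mul]
      _ = RAinv N q _ * amp (Fin N) w * RAinv N q _ * amp (Fin N) Y * RA N q _ -
          κ • (RAinv N q _ * amp (Fin N) w * (RAinv N q _ * RA N q _)) := by
          rw [h.y_w hq0, hr', mul_one]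
          noncomm_ring
      _ = _ := by
          rw [map_sub, map_smul, map_one]
          noncomm_ring
  have h2 : EntriesMap (amp (Fin N) (Y - κ • 1) * RAinv N q (Module.End ℂ F) * amp (Fin N) w)
      (scalarVectors q Y κ z) ⊥ := by
    rw [h1]
    exact ((EntriesMap.bot _).mul h0.amp).mul (.RA _)
  intro e f x hx
  refine mem_scalarVectors.2 ⟨fun b c => ?_, ?_⟩
  · have := apply_mem_of_RAinv hq0 h2 b c e f x hx
    rw [Submodule.mem_bot, Matrix.sub_apply, LinearMap.sub_apply, sub_eq_zero] at this
    rw [this, Matrix.smul_apply, Matrix.one_apply]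
    split_ifs <;> simp
  · have := congrArg (fun X => X e f x) (h.qTr_y_w hq0)
    simp only [Matrix.diagonal_mul, Matrix.mul_diagonal, Module.End.mul_apply] at this
    rw [this, (mem_scalarVectors.1 hx).2, map_smul]

/-- On the vacuum `J R̂ ω` reduces to `-1`. Its partial trace determines `J ω |0⟩`, and `λ Tr_q 1 =
q^(2N) - 1` then makes `1 + λ J ω` the scalar `q^(-2N)`; `L⁻¹` and `U` act as the identity. -/
lemma FockRep.vac_mem_scalarVectors (h : FockRep N q T w L K J v) (hq0 : q ≠ 0) :
    v ∈ scalarVectors q (yMat q w K J) (q ^ (2 * (N : ℤ)))⁻¹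
      ((q ^ (2 * (N : ℤ)))⁻¹ * ∑ i, qWeight N q i) := by
  have hq2 : q ^ (2 * (N : ℤ)) ≠ 0 := zpow_ne_zero _ hq0
  have hJ0 : EntriesMap J (Submodule.span ℂ {v}) ⊥ := entriesMap_span fun i j x hx => by
    rw [Set.mem_singleton_iff.1 hx, h.j_vac]
    exact Submodule.zero_mem _
  have hjw : ∀ b f, (J * w) b f v =
      (-((q ^ (2 * (N : ℤ)))⁻¹ * ∑ i, qWeight N q i)) • if b = f then v else 0 := by
    intro b f
    have h1 : ptr q (amp (Fin N) J * RA N q (Module.End ℂ F) * amp (Fin N) w) b f v =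
        -((∑ i, qWeight N q i) • if b = f then v else 0) := by
      have h2 : EntriesMap (RAinv N q (Module.End ℂ F) * amp (Fin N) w *
          RA N q (Module.End ℂ F) * amp (Fin N) J *
          RA N q (Module.End ℂ F)) (Submodule.span ℂ {v}) ⊥ :=
        ((EntriesMap.bot _).mul hJ0.amp).mul (.RA _)
      have h3 : ∀ a, (RAinv N q (Module.End ℂ F) * amp (Fin N) w * RA N q (Module.End ℂ F) *
          amp (Fin N) J * RA N q (Module.End ℂ F)) (a, b) (a, f) v = 0 := fun a =>
        (Submodule.mem_bot ℂ).1 (h2 _ _ _ (Submodule.mem_span_singleton_self v))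
      rw [rel_j_r_w (RA_inv_mul hq0) h.ops.wj, ptr_apply, LinearMap.sum_apply]
      simp only [LinearMap.smul_apply, Matrix.sub_apply, Matrix.neg_apply, LinearMap.sub_apply,
        h3, sub_zero, LinearMap.neg_apply, Matrix.one_apply, Prod.mk.injEq, true_and,
        smul_neg, Finset.sum_neg_distrib, Finset.sum_smul]
      congr 1
      refine Finset.sum_congr rfl fun i _ => ?_
      split_ifs <;> simp
    rw [ptr_mul_amp, ptr_amp_mul, ptr_RA hq0, mul_smul_comm, mul_one, smul_mul_assoc,
      Matrix.smul_apply, LinearMap.smul_apply] at h1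
    rw [neg_smul, mul_smul, ← smul_neg, ← h1, inv_smul_smul₀ hq2]
  have hu' : ∀ b f, uMat q J w b f v = (q ^ (2 * (N : ℤ)))⁻¹ • if b = f then v else 0 := by
    intro b f
    rw [uMat, Matrix.add_apply, Matrix.smul_apply, LinearMap.add_apply, LinearMap.smul_apply, hjw,
      smul_smul]
    have : (1 : Matrix (Fin N) (Fin N) (Module.End ℂ F)) b f v = (1 : ℂ) • if b = f then v else 0 := by
      rw [Matrix.one_apply, one_smul]
      split_ifs <;> simp
    rw [this, ← add_smul]
    congr 1
    have hs := sum_qWeight (N := N) hq0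
    field_simp
    linear_combination -hs
  have hku : ∀ b f, (K * uMat q J w) b f v = (q ^ (2 * (N : ℤ)))⁻¹ • if b = f then v else 0 := by
    intro b f
    simp only [Matrix.mul_apply, LinearMap.sum_apply, Module.End.mul_apply, hu', map_smul,
      apply_ite (DFunLike.coe (K _ _)), map_zero, ← Finset.smul_sum, Finset.sum_ite_eq', Finset.mem_univ,
      if_true, h.k_vac]
  have hu : ∀ b f, uMat q w J b f v = if b = f then v else 0 := by
    intro b f
    simp only [uMat, Matrix.add_apply, Matrix.smul_apply, LinearMap.add_apply,
      LinearMap.smul_apply, Matrix.mul_apply, LinearMap.sum_apply, Module.End.mul_apply, h.j_vac,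
      map_zero, Finset.sum_const_zero, smul_zero, add_zero, Matrix.one_apply]
    split_ifs <;> rfl
  have hy : ∀ b f, yMat q w K J b f v = (q ^ (2 * (N : ℤ)))⁻¹ • if b = f then v else 0 := by
    intro b f
    rw [yMat, Matrix.mul_apply]
    simp only [LinearMap.sum_apply, Module.End.mul_apply, hku, map_smul,
      apply_ite (DFunLike.coe (uMat q w J _ _)), map_zero, ← Finset.smul_sum, Finset.sum_ite_eq', Finset.mem_univ,
      if_true, hu]
  refine mem_scalarVectors.2 ⟨fun i j => ?_, ?_⟩
  · rw [hy]
    split_ifs <;> simp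
  · rw [qTr, LinearMap.sum_apply]
    simp only [LinearMap.smul_apply, hy, if_true, smul_smul]
    rw [← Finset.sum_smul, ← Finset.sum_mul, mul_comm]

/-- The span of the words of length `n` in the entries of `T` applied to a subspace. -/
def tPower (T : Matrix (Fin N) (Fin N) (Module.End ℂ F)) (S : Submodule ℂ F) : ℕ → Submodule ℂ F
  | 0 => S
  | n + 1 => ⨆ i, ⨆ j, (tPower T S n).map (T i j)

lemma tPower_succ_le {S P : Submodule ℂ F} {n : ℕ} (h : EntriesMap T (tPower T S n) P) :
    tPower T S (n + 1) ≤ P :=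
  iSup₂_le fun i j => Submodule.map_le_iff_le_comap.2 (h i j)

lemma t_tPower (S : Submodule ℂ F) (n : ℕ) :
    EntriesMap T (tPower T S n) (tPower T S (n + 1)) := fun i j _ hx =>
  Submodule.mem_iSup_of_mem i <| Submodule.mem_iSup_of_mem j <| Submodule.mem_map_of_mem hx

lemma DiffOps.w_tPower (h : DiffOps N q T w L K J) {S : Submodule ℂ F} (hS : EntriesMap w S S)
    (n : ℕ) : EntriesMap w (tPower T S n) (tPower T S n) := by
  induction n with
  | zero => exact hS
  | succ n ih =>
    have h1 : EntriesMap (ampLeft w * amp (Fin N) T) (tPower T S n) (tPower T S (n + 1)) := by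
      rw [h.wt]
      exact (((t_tPower S n).amp.mul (.RAinv _)).mul ih.amp).mul (.RAinv _)
    intro i j
    exact tPower_succ_le (P := (tPower T S (n + 1)).comap (w i j)) fun k l x hx =>
      apply_mem_of_ampLeft h1 i j k l x hx

/-- The members of families on which `Y` and `Tr_q Y` act through Jucys-Murphy elements. -/
def IsDualVector (q : ℂ) (Y : Matrix (Fin N) (Fin N) (Module.End ℂ F)) (κ z : ℂ) (x : F) : Prop :=
  ∃ (τ : Type) (_ : Fintype τ) (_ : DecidableEq τ)
    (A : ℂ → Matrix ((Fin N)ᵒᵈ × τ) ((Fin N)ᵒᵈ × τ) ℂ)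
    (C : ℂ → Matrix τ τ ℂ) (m : ℕ) (e : τ → F) (t : τ),
    IsJucysMurphy A C m ∧ IsCovariant (fun i j => Y (OrderDual.ofDual i) (OrderDual.ofDual j)) κ (A q⁻¹) e ∧
      (∀ t, qTr q Y (e t) = z • e t + (-(lam q * κ)) • ∑ t', C q⁻¹ t' t • e t') ∧ x = e t

lemma IsDualVector.t_apply (h : DiffOps N q T w L K J) (hq0 : q ≠ 0) {κ z : ℂ} {x : F}
    (hx : IsDualVector q (yMat q w K J) κ z x) (b d : Fin N) :
    IsDualVector q (yMat q w K J) κ z (T b d x) := by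
  obtain ⟨τ, _, _, A, C, m, e, t, hA, he, htr, rfl⟩ := hx
  refine ⟨(Fin N)ᵒᵈ × τ, inferInstance, inferInstance, _, _, _,
    fun s => T b (OrderDual.ofDual s.1) (e s.2), (OrderDual.toDual d, t), hA.step,
    he.step (T := fun i j => T (OrderDual.ofDual i) (OrderDual.ofDual j)) (fun a b c d => ?_)
      (OrderDual.toDual b),
    he.step_trace (T := fun i j => T (OrderDual.ofDual i) (OrderDual.ofDual j)) (fun b d => ?_)
      htr (OrderDual.toDual b), rfl⟩
  · have := congrFun (congrFun (h.y_t hq0) (OrderDual.ofDual a, OrderDual.ofDual b))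
      (OrderDual.ofDual c, OrderDual.ofDual d)
    rw [ampLeft_mul_amp_apply, mul_assoc, mul_assoc, amp_mul_entry] at this
    refine this.trans (Fintype.sum_equiv OrderDual.toDual _ _ fun b' => ?_)
    rw [← mul_assoc, RAinv_amp_RAinv_apply hq0]
    rfl
  · have h1 := congrFun (congrFun (h.qTr_y_t hq0) (OrderDual.ofDual b)) (OrderDual.ofDual d)
    rw [Matrix.diagonal_mul, mul_sub, Matrix.sub_apply, Matrix.mul_diagonal, mul_smul_comm,
      Matrix.smul_apply, Matrix.mul_apply] at h1
    exact h1

/-- `ω` can be moved to the right of `T`, so words in `T` applied to `scalarVectors` span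
everything. On scalar vectors the family is trivial, and each `T` adds a Jucys-Murphy step for
`q⁻¹`, which is not a root of unity either. -/
lemma FockRep.iSup_eigenspace_qTr_y (h : FockRep N q T w L K J v) (hq0 : q ≠ 0)
    (hq : ∀ n : ℕ, 0 < n → q ^ n ≠ 1) : ⨆ μ, (qTr q (yMat q w K J)).eigenspace μ = ⊤ := by
  set κ := (q ^ (2 * (N : ℤ)))⁻¹ with hκ
  set z := (q ^ (2 * (N : ℤ)))⁻¹ * ∑ i, qWeight N q i with hz
  set S := scalarVectors q (yMat q w K J) κ z with hS
  have htop : ⨆ n, tPower T S n = ⊤ := by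
    refine h.eq_top hq0 (Submodule.mem_iSup_of_mem 0 (h.vac_mem_scalarVectors hq0)) ?_ ?_
    · intro i j
      exact iSup_le (a := (⨆ n, tPower T S n).comap (T i j)) fun n x hx =>
        Submodule.mem_iSup_of_mem (n + 1) (t_tPower S n i j x hx)
    · intro i j
      exact iSup_le (a := (⨆ n, tPower T S n).comap (w i j)) fun n x hx =>
        Submodule.mem_iSup_of_mem n
          (h.ops.w_tPower (h.ops.w_scalarVectors hq0 κ z) n i j x hx)
  have hle : ∀ n, tPower T S n ≤
      Submodule.span ℂ {x | IsDualVector q (yMat q w K J) κ z x} := fun n => by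
    induction n with
    | zero =>
      intro x hx
      obtain ⟨h1, h2⟩ := mem_scalarVectors.1 hx
      refine Submodule.subset_span ⟨Unit, inferInstance, inferInstance, _, _, _, fun _ => x, (),
        isJucysMurphy_unit, fun i j t => ?_, fun t => ?_, rfl⟩
      · refine (h1 (OrderDual.ofDual i) (OrderDual.ofDual j)).trans ?_
        by_cases hij : i = j
        · subst hij
          have : (1 : Matrix ((Fin N)ᵒᵈ × Unit) ((Fin N)ᵒᵈ × Unit) ℂ) (i, ()) (i, t) = 1 :=
            Matrix.one_apply_eq _
          simp [this]
        · simp [hij]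
      · simp [h2]
    | succ n ih =>
      refine tPower_succ_le fun i j x hx => ?_
      refine entriesMap_span (X := T) (fun b d x hx => ?_) i j x (ih hx)
      exact Submodule.subset_span (hx.t_apply h.ops hq0 b d)
  rw [eq_top_iff, ← htop]
  refine (iSup_le hle).trans (Submodule.span_le.2 ?_)
  rintro _ ⟨τ, _, _, A, C, m, e, t, hA, -, htr, rfl⟩
  refine QuantumGL.mem_iSup_eigenspace z (-(lam q * κ)) (hA.ss q⁻¹ (inv_ne_zero hq0) ?_) htr t
  intro n hn
  rw [inv_pow, Ne, inv_eq_one]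
  exact hq n hn

end Casimir

end QuantumGL

namespace QuantumGL

/-! ### Commuting diagonalizable operators -/

section Diagonalizable

variable {F : Type*} [AddCommGroup F] [Module ℂ F]

/-- Applying `g - ν₀` deletes one component and rescales the others by nonzero factors, which gives
the induction. -/
lemma mem_of_sum_eigenvectors_mem {g : Module.End ℂ F} {P : Submodule ℂ F}
    (hP : ∀ x ∈ P, g x ∈ P) (s : Finset ℂ) (y : ℂ → F) (hy : ∀ ν, g (y ν) = ν • y ν)
    (h : ∑ ν ∈ s, y ν ∈ P) : ∀ ν ∈ s, y ν ∈ P := by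
  induction s using Finset.induction_on generalizing y with
  | empty => simp
  | insert ν₀ s hν₀ ih =>
    have h1 : ∑ ν ∈ s, (ν - ν₀) • y ν ∈ P := by
      have h2 : g (∑ ν ∈ insert ν₀ s, y ν) - ν₀ • ∑ ν ∈ insert ν₀ s, y ν =
          ∑ ν ∈ s, (ν - ν₀) • y ν := by
        rw [map_sum, Finset.smul_sum, ← Finset.sum_sub_distrib, Finset.sum_insert hν₀, hy,
          sub_self, zero_add]
        exact Finset.sum_congr rfl fun ν _ => by rw [hy, sub_smul]
      rw [← h2]
      exact P.sub_mem (hP _ h) (P.smul_mem _ h)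
    have h3 : ∀ ν ∈ s, y ν ∈ P := fun ν hν => by
      have hne : ν - ν₀ ≠ 0 := sub_ne_zero.2 fun hc => hν₀ (hc ▸ hν)
      exact (P.smul_mem_iff hne).1 (ih (fun ν => (ν - ν₀) • y ν)
        (fun ν => by rw [map_smul, hy, smul_comm]) h1 ν hν)
    intro ν hν
    rcases Finset.mem_insert.1 hν with rfl | hν
    · rw [Finset.sum_insert hν₀] at h
      exact (P.add_mem_iff_left (P.sum_mem h3)).1 h
    · exact h3 ν hν

/-- A linear combination of commuting diagonalizable operators is diagonalizable. -/
lemma iSup_eigenspace_combination {f g : Module.End ℂ F} (hfg : Commute f g)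
    (hf : ⨆ μ, f.eigenspace μ = ⊤) (hg : ⨆ μ, g.eigenspace μ = ⊤) (a b c : ℂ) :
    ⨆ μ, (a • f + b • g + c • (1 : Module.End ℂ F)).eigenspace μ = ⊤ := by
  rw [eq_top_iff, ← hf]
  refine iSup_le fun μ x hx => ?_
  have hP : ∀ y ∈ f.eigenspace μ, g y ∈ f.eigenspace μ := fun y hy => by
    rw [Module.End.mem_eigenspace_iff] at hy ⊢
    have := LinearMap.congr_fun hfg.eq y
    rw [Module.End.mul_apply, Module.End.mul_apply] at this
    rw [this, hy, map_smul]
  have hx2 : x ∈ ⨆ ν, g.eigenspace ν := hg ▸ Submodule.mem_top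
  obtain ⟨y, hy, rfl⟩ := (Submodule.mem_iSup_iff_exists_finsupp _ _).1 hx2
  have hy' : ∀ ν, g (y ν) = ν • y ν := fun ν => Module.End.mem_eigenspace_iff.1 (hy ν)
  have hmem := mem_of_sum_eigenvectors_mem hP y.support y hy' hx
  refine Submodule.sum_mem _ fun ν hν => Submodule.mem_iSup_of_mem (a * μ + b * ν + c) ?_
  rw [Module.End.mem_eigenspace_iff]
  simp only [LinearMap.add_apply, LinearMap.smul_apply, Module.End.one_apply, hy',
    Module.End.mem_eigenspace_iff.1 (hmem ν hν), add_smul, mul_smul]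

lemma ker_sup_range {f : Module.End ℂ F} (hf : ⨆ μ, f.eigenspace μ = ⊤) :
    LinearMap.ker f ⊔ LinearMap.range f = ⊤ := by
  rw [eq_top_iff, ← hf]
  refine iSup_le fun μ x hx => ?_
  rw [Module.End.mem_eigenspace_iff] at hx
  by_cases hμ : μ = 0
  · refine Submodule.mem_sup_left ?_
    rw [LinearMap.mem_ker, hx, hμ, zero_smul]
  · refine Submodule.mem_sup_right ⟨μ⁻¹ • x, ?_⟩
    rw [map_smul, hx, inv_smul_smul₀ hμ]

/-- The abstract form of the decomposition. -/
lemma FockRep.ker_sup_range_laplacian {N : ℕ} {q : ℂ}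
    {T w L K J : Matrix (Fin N) (Fin N) (Module.End ℂ F)} {v : F}
    (h : FockRep N q T w L K J v) (hq0 : q ≠ 0) (hq : ∀ n : ℕ, 0 < n → q ^ n ≠ 1) (c : ℂ)
    {Ui : Matrix (Fin N) (Fin N) (Module.End ℂ F)} (hu : uMat q w J * Ui = 1)
    (hu' : Ui * uMat q w J = 1) {Q₁ Q₂ : Module.End ℂ F}
    (hQ₁ : Q₁ = c • (qTr q (w * L * Ui) - qTr q w))
    (hQ₂ : Q₂ = c • (qTr q (J * K * uMat q J w) - qTr q J)) :
    LinearMap.ker (Q₁ * Q₂ + Q₂ * Q₁) ⊔ LinearMap.range (Q₁ * Q₂ + Q₂ * Q₁) = ⊤ := by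
  have hcomm : Commute (qTr q L) (qTr q (yMat q w K J)) := by
    have h1 : ∀ i, Commute (L i i) (qTr q (yMat q w K J)) := fun i => by
      have := congrFun (congrFun (h.ops.qTr_y_l hq0) i) i
      rwa [Matrix.mul_diagonal, Matrix.diagonal_mul] at this
    exact Commute.sum_left _ _ _ fun i _ => (h1 i).smul_left _
  have h1 := iSup_eigenspace_combination hcomm (h.iSup_eigenspace_qTr_l hq0 hq)
    (h.iSup_eigenspace_qTr_y hq0 hq) (c * c) (c * c * q ^ (2 * (N : ℤ)))
    (-(c * c * (2 * ∑ i, qWeight N q i)))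
  rw [hQ₁, hQ₂, smul_mul_smul_comm, smul_mul_smul_comm, ← smul_add, mul_assoc w, mul_assoc J,
    h.ops.laplacian hq0 hu hu', smul_sub, smul_add, smul_smul, smul_smul, sub_eq_add_neg,
    ← neg_smul]
  exact ker_sup_range h1

end Diagonalizable

/-! ### The Fock space as a representation of the abstract relations -/

section Fock

variable (N : ℕ) (q : ℂ)

/-- The action of the free algebra on the Fock space. -/
def freeAction : Free N →ₐ[ℂ] Module.End ℂ (Fock N q) :=
  (Algebra.lsmul ℂ ℂ (Fock N q)).comp (RingQuot.mkAlgHom ℂ (Rel N q))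

lemma freeAction_ι (g : Gen N) : freeAction N q (FreeAlgebra.ι ℂ g) =
    Algebra.lsmul ℂ ℂ (Fock N q) (gen N q g) := rfl

lemma freeAction_rel {X Y : Mat2 N} (h : MatRel N q X Y) :
    (freeAction N q).mapMatrix X = (freeAction N q).mapMatrix Y := by
  ext1 a b
  exact congrArg (Algebra.lsmul ℂ ℂ (Fock N q)) (RingQuot.mkAlgHom_rel ℂ ⟨X, Y, h, a, b, rfl, rfl⟩)

lemma freeAction_in2 (g : Fin N → Fin N → Gen N) :
    (freeAction N q).mapMatrix (in2 g) = amp (Fin N) (opMatrix N q g) := by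
  ext1 i j
  simp only [AlgHom.mapMatrix_apply, Matrix.map_apply, in2, Matrix.kroneckerMap_apply,
    amp_apply, Matrix.one_apply, apply_ite (freeAction N q), map_zero, ite_mul, one_mul,
    zero_mul, Matrix.of_apply, freeAction_ι, opMatrix]

lemma freeAction_in1 (g : Fin N → Fin N → Gen N) :
    (freeAction N q).mapMatrix (in1 g) = ampLeft (opMatrix N q g) := by
  ext1 i j
  simp only [AlgHom.mapMatrix_apply, Matrix.map_apply, in1, Matrix.kroneckerMap_apply,
    ampLeft, Matrix.one_apply, apply_ite (freeAction N q), map_zero, mul_ite, mul_one,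
    mul_zero, Matrix.of_apply, freeAction_ι, opMatrix]

lemma freeAction_RM : (freeAction N q).mapMatrix (RM N q) = RA N q _ := by
  ext1 i j
  exact (freeAction N q).commutes _

lemma freeAction_RMinv : (freeAction N q).mapMatrix (RMinv N q) = RAinv N q _ := by
  ext1 i j
  exact (freeAction N q).commutes _

lemma amp_eq_one {A : Type*} [Ring A] [Algebra ℂ A] {X : Matrix (Fin N) (Fin N) A}
    (h : amp (Fin N) X = 1) : X = 1 := by
  ext i j
  have := congrFun (congrFun h (i, i)) (i, j)
  rw [amp_apply, if_pos rfl] at this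
  rw [this]
  simp [Matrix.one_apply]

lemma diffOps_opMatrix : DiffOps N q (opMatrix N q Gen.T) (opMatrix N q Gen.ω)
    (opMatrix N q Gen.L) (opMatrix N q Gen.Linv) (opMatrix N q Gen.J) := by
  have key {X Y : Mat2 N} (h : MatRel N q X Y) := freeAction_rel N q h
  constructor
  case lk =>
    have := key MatRel.LLinv
    rw [map_mul, freeAction_in2, freeAction_in2, ← map_mul, map_one] at this
    exact amp_eq_one N this
  case kl =>
    have := key MatRel.LinvL
    rw [map_mul, freeAction_in2, freeAction_in2, ← map_mul, map_one] at this
    exact amp_eq_one N this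
  case ww =>
    simpa only [map_mul, map_neg, freeAction_in2, freeAction_RM, freeAction_RMinv] using
      key MatRel.ωω
  case wl =>
    simpa only [map_mul, freeAction_in2, freeAction_RM] using
      key MatRel.ωL
  case wj =>
    simpa only [map_mul, map_neg, map_add, freeAction_in2, freeAction_RM] using
      key MatRel.ωJ
  case ll =>
    simpa only [map_mul, freeAction_in2, freeAction_RM] using
      key MatRel.LL
  case jl =>
    simpa only [map_mul, freeAction_in2, freeAction_RM] using
      key MatRel.JL
  case jj =>
    simpa only [map_mul, map_neg, freeAction_in2, freeAction_RM, freeAction_RMinv] using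
      key MatRel.JJ
  case wt =>
    simpa only [map_mul, freeAction_in1, freeAction_in2, freeAction_RMinv] using
      key MatRel.ωT
  case jt =>
    simpa only [map_mul, freeAction_in1, freeAction_in2, freeAction_RM] using
      key MatRel.JT
  case lt =>
    simpa only [map_mul, freeAction_in1, freeAction_in2, freeAction_RM] using
      key MatRel.LT

lemma smul_vac (x : DiffAlg N q) : x • vac N q = (annihilators N q).mkQ x := by
  rw [vac, ← map_smul, smul_eq_mul, mul_one]

lemma smul_vac_eq_zero {x : DiffAlg N q} (hx : x ∈ annihilators N q) : x • vac N q = 0 := by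
  rw [smul_vac, Submodule.mkQ_apply, Submodule.Quotient.mk_eq_zero]
  exact hx

/-- The Fock space is a Fock representation. -/
lemma fockRep : FockRep N q (opMatrix N q Gen.T) (opMatrix N q Gen.ω)
    (opMatrix N q Gen.L) (opMatrix N q Gen.Linv) (opMatrix N q Gen.J) (vac N q) where
  ops := diffOps_opMatrix N q
  l_vac i j := by
    have := smul_vac_eq_zero N q (x := gen N q (Gen.L i j) - (if i = j then 1 else 0))
      (Submodule.subset_span (Or.inl ⟨i, j, rfl⟩))
    rw [sub_smul, sub_eq_zero] at this
    refine Eq.trans this ?_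
    split_ifs <;> simp
  j_vac i j := smul_vac_eq_zero N q (Submodule.subset_span (Or.inr ⟨i, j, rfl⟩))
  cyclic S hv hT hw hL hK hJ := by
    have h : ∀ a : Free N, ∀ x ∈ S, freeAction N q a x ∈ S := by
      intro a
      induction a using FreeAlgebra.induction with
      | grade0 r =>
        intro x hx
        rw [AlgHom.commutes, Module.algebraMap_end_apply]
        exact S.smul_mem _ hx
      | grade1 g =>
        intro x hx
        cases g with
        | T i j => exact hT i j x hx
        | ω i j => exact hw i j x hx
        | L i j => exact hL i j x hx
        | Linv i j => exact hK i j x hx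
        | J i j => exact hJ i j x hx
      | mul a b iha ihb =>
        intro x hx
        rw [map_mul]
        exact iha _ (ihb x hx)
      | add a b iha ihb =>
        intro x hx
        rw [map_add]
        exact S.add_mem (iha x hx) (ihb x hx)
    refine eq_top_iff.2 fun x _ => ?_
    obtain ⟨y, rfl⟩ := (annihilators N q).mkQ_surjective x
    obtain ⟨a, rfl⟩ := RingQuot.mkAlgHom_surjective ℂ (Rel N q) y
    rw [← smul_vac]
    exact h a _ hv

/-- The polynomials contain the vacuum and are stable under `T` and `ω`, so normal ordering
(`FockRep.eq_top`) makes them the whole space. -/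
lemma mem_polynomials (hq : q ≠ 0) (x : Fock N q) : x ∈ polynomials N q := by
  let B := Algebra.adjoin ℂ ({x | ∃ i j : Fin N, x = gen N q (Gen.T i j)} ∪
    {x | ∃ i j : Fin N, x = gen N q (Gen.ω i j)})
  let f : DiffAlg N q →ₗ[ℂ] Fock N q := (annihilators N q).mkQ.restrictScalars ℂ
  have hmul : ∀ g ∈ B, ∀ y ∈ (Subalgebra.toSubmodule B).map f,
      g • y ∈ (Subalgebra.toSubmodule B).map f := by
    rintro g hg _ ⟨p, hp, rfl⟩
    exact ⟨g * p, B.mul_mem hg hp, (annihilators N q).mkQ.map_smul g p⟩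
  have htop := (fockRep N q).eq_top hq (S := (Subalgebra.toSubmodule B).map f)
    ⟨1, B.one_mem, rfl⟩
    (fun i j y hy => hmul _ (Algebra.subset_adjoin (Or.inl ⟨i, j, rfl⟩)) y hy)
    (fun i j y hy => hmul _ (Algebra.subset_adjoin (Or.inr ⟨i, j, rfl⟩)) y hy)
  obtain ⟨p, hp, rfl⟩ : x ∈ (Subalgebra.toSubmodule B).map f := htop ▸ Submodule.mem_top
  exact ⟨p, hp, (smul_vac N q p).symm⟩

lemma isUnit_W (hq : q ≠ 0) : IsUnit (W N q) := (fockRep N q).isUnit_u hq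

lemma ker_sup_range_Laplacian (hq0 : q ≠ 0) (hq : ∀ n : ℕ, 0 < n → q ^ n ≠ 1) :
    LinearMap.ker (Laplacian N q) ⊔ LinearMap.range (Laplacian N q) = ⊤ := by
  exact (fockRep N q).ker_sup_range_laplacian hq0 hq (lam q)⁻¹
    (Ring.mul_inverse_cancel _ (isUnit_W N q hq0)) (Ring.inverse_mul_cancel _ (isUnit_W N q hq0))
    rfl rfl

end Fock

end QuantumGL

end

theorem mainTheorem6 (N : ℕ) (q : ℂ) (hq0 : q ≠ 0) (hq : ∀ n : ℕ, 0 < n → q ^ n ≠ 1) :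
    IsUnit (QuantumGL.W N q) ∧
      ∀ Ψ ∈ QuantumGL.polynomials N q,
        ∃ Ω ∈ QuantumGL.polynomials N q,
        ∃ χ ∈ QuantumGL.polynomials N q,
        ∃ Φ ∈ QuantumGL.polynomials N q,
          Ψ = Ω + QuantumGL.Q N q χ + QuantumGL.Qstar N q Φ ∧
            QuantumGL.Laplacian N q Ω = 0 := by
  refine ⟨QuantumGL.isUnit_W N q hq0, fun Ψ _ => ?_⟩
  have hΨ : Ψ ∈ LinearMap.ker (QuantumGL.Laplacian N q) ⊔
      LinearMap.range (QuantumGL.Laplacian N q) :=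
    QuantumGL.ker_sup_range_Laplacian N q hq0 hq ▸ Submodule.mem_top
  obtain ⟨Ω, hΩ, _, ⟨y, rfl⟩, rfl⟩ := Submodule.mem_sup.1 hΨ
  -- The component in the range is `Δ y = Q (Q* y) + Q* (Q y)`, which gives `χ = Q* y` and `Φ = Q
  -- y`.
  exact ⟨Ω, QuantumGL.mem_polynomials N q hq0 Ω, QuantumGL.Qstar N q y,
    QuantumGL.mem_polynomials N q hq0 _, QuantumGL.Q N q y, QuantumGL.mem_polynomials N q hq0 _,
    (add_assoc _ _ _).symm, hΩ⟩
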